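/- Consider the class of equations $$f(x)u_t=(e^{nu}u_x)_x+h(x)e^{mu},\qquad nf\neq0,\qquad(*)$$ where the arbitrary elements are the smooth functions $f,h$ of $x$ and the constants $n,m$. A generalized equivalence transformation of this class is a (locally defined, smooth) nondegenerate point transformation of $(t,x,u,f,h,n,m)$, whose $t$-, $x$- and $u$-components may depend on the arbitrary elements as well, such that for every equation of the class the transformation of $(t,x,u)$ obtained by substituting its arbitrary elements is nondegenerate and maps this equation (as a submanifold of the second-order jet space) to the equation of the class with the transformed arbitrary elements. The generalized equivalence group of the class $(*)$ is formed by the transformations $$\tilde t=\delta_1t+\delta_2,\quad \tilde x=\frac{\delta_6x+\delta_7}{\delta_4x+\delta_5},\quad \tilde u=\delta_3u-\frac{\delta_3}{n}\ln|\delta_4x+\delta_5|,$$ $$\tilde f=\frac{\delta_1}{\Delta^2}|\delta_4x+\delta_5|^3f,\quad \tilde h=\frac{\delta_3}{\Delta^2}|\delta_4x+\delta_5|^{\frac mn+3}h,\quad \tilde n=\frac n{\delta_3},\quad \tilde m=\frac m{\delta_3},$$ where $\delta_1,\dots,\delta_7$ are arbitrary constants with $\delta_1\delta_3\neq0$ and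 $\Delta=\delta_5\delta_6-\delta_4\delta_7\neq0$; the tuple $(\delta_4,\delta_5,\delta_6,\delta_7)$ is determined by the transformation up to a common sign, and $\delta_1,\delta_2,\delta_3$ are determined uniquely. In detail: (i) for all constants $\delta_j$ as above, this is a generalized equivalence transformation on the set $\{fn\neq0,\ \delta_4x+\delta_5\neq0\}$; (ii) these transformations contain the identity and are closed under composition and inversion; (iii) let $\Omega\subseteq\{fn\ne0\}$ be open in the space of $(t,x,u,f,h,n,m)$, with connected slices $\{n,m\text{ fixed}\}$. Then the generalized equivalence transformations defined on $\Omega$ are exactly the transformations of the above form with $\delta_4x+\delta_5\ne0$ on $\Omega$, where the $\delta_j$ are constant with respect to $t,x,u,f,h$. As $n$ and $m$ are themselves constants, the $\delta_j$ may be smooth functions of $(n,m)$, the nondegeneracy of $(n,m)\mapsto(n/\delta_3,m/\delta_3)$ then meaning that $\delta_3\neq n\,\partial_n\delta_3+m\,\partial_m\delta_3$. -/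

import Mathlib

open scoped ContDiff

noncomputable section

namespace RDExp

/-- The space of the variables `(t, x, u)` together with the values `(f, h, n, m)` of the
arbitrary elements; the coordinates `0, …, 6` are `t, x, u, f, h, n, m` in this order. -/
abbrev ExtSpace : Type := Fin 7 → ℝ

/-- The values allowed by the class: `f ≠ 0` and `n ≠ 0`. -/
def classSpace : Set ExtSpace := {p | p 3 ≠ 0 ∧ p 5 ≠ 0}

/-- A tuple of arbitrary elements `(f, h, n, m)`, i.e. an equation
`f(x) u_t = (e^{nu} u_x)_x + h(x) e^{mu}` with `n f ≠ 0` over an open set `I` of values of `x`. -/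
structure Equation where
  I : Set ℝ
  isOpen_I : IsOpen I
  f : ℝ → ℝ
  h : ℝ → ℝ
  n : ℝ
  m : ℝ
  smooth_f : ContDiffOn ℝ ∞ f I
  smooth_h : ContDiffOn ℝ ∞ h I
  f_ne : ∀ x ∈ I, f x ≠ 0
  n_ne : n ≠ 0

/-- The function `u` of `(t, x)` satisfies the equation `f u_t = (e^{nu} u_x)_x + h e^{mu}` at the
point `(t, x)`; this is a condition on the second-order jet of `u` at this point. -/
def Equation.HoldsAt (θ : Equation) (u : ℝ × ℝ → ℝ) (t x : ℝ) : Prop :=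
  θ.f x * deriv (fun s => u (s, x)) t =
    deriv (fun y => Real.exp (θ.n * u (t, y)) * deriv (fun z => u (t, z)) y) x
      + θ.h x * Real.exp (θ.m * u (t, x))

/-- The transformation `Φ` of the variables `(t, x, u)`, with components `T, X, U`, is a
nondegenerate point transformation on `D` which transforms the equation `θ` to the equation `θ'`:
whenever `Φ` carries (locally) the graph of a smooth function `u` onto the graph of a
smooth function `u'`, the second-order jet of `u` satisfies `θ` if and only if the corresponding
second-order jet of `u'` satisfies `θ'`. -/
def Transforms (Φ : (Fin 3 → ℝ) → (Fin 3 → ℝ)) (D : Set (Fin 3 → ℝ)) (θ θ' : Equation) : Prop :=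
  ContDiffOn ℝ ∞ Φ D ∧
  ∀ v ∈ D,
    (fderiv ℝ Φ v).det ≠ 0 ∧
    ∀ u u' : ℝ × ℝ → ℝ,
      ContDiffAt ℝ ∞ u (v 0, v 1) →
      u (v 0, v 1) = v 2 →
      ContDiffAt ℝ ∞ u' (Φ v 0, Φ v 1) →
      -- the image of the graph of `u` is transversal to the `u`-direction
      (fderiv ℝ (fun z : Fin 2 → ℝ =>
        (![Φ ![z 0, z 1, u (z 0, z 1)] 0, Φ ![z 0, z 1, u (z 0, z 1)] 1] : Fin 2 → ℝ))
          ![v 0, v 1]).det ≠ 0 →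
      (∀ᶠ z : ℝ × ℝ in nhds (v 0, v 1),
        u' (Φ ![z.1, z.2, u z] 0, Φ ![z.1, z.2, u z] 1) = Φ ![z.1, z.2, u z] 2) →
      (θ.HoldsAt u (v 0) (v 1) ↔ θ'.HoldsAt u' (Φ v 0) (Φ v 1))

/-- The point of the extended space over `v = (t, x, u)` given by the equation `θ`. -/
def Equation.lift (θ : Equation) (v : Fin 3 → ℝ) : ExtSpace :=
  ![v 0, v 1, v 2, θ.f (v 1), θ.h (v 1), θ.n, θ.m]

/-- The part of `(t, x, u)`-space over which `θ` takes values in `Ω`. -/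
def Equation.domain (θ : Equation) (Ω : Set ExtSpace) : Set (Fin 3 → ℝ) :=
  {v | v 1 ∈ θ.I ∧ θ.lift v ∈ Ω}

/-- The transformation of `(t, x, u)` obtained from `𝒯` by substituting the arbitrary elements of
the equation `θ`. -/
def Equation.restrict (θ : Equation) (𝒯 : ExtSpace → ExtSpace) (v : Fin 3 → ℝ) : Fin 3 → ℝ :=
  ![𝒯 (θ.lift v) 0, 𝒯 (θ.lift v) 1, 𝒯 (θ.lift v) 2]

/-- `𝒯` is a generalized equivalence transformation, defined on the open set `Ω`, of the class of
equations `f(x) u_t = (e^{nu} u_x)_x + h(x) e^{mu}`, `n f ≠ 0`: a nondegenerate point transformation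
of `(t, x, u, f, h, n, m)`, whose `(t, x, u)`-components may depend on the arbitrary elements too,
and which maps every equation `θ` of the class to an equation `θ'` of the class, where the
arbitrary elements of `θ'` are given by the remaining components of `𝒯`. -/
def IsGeneralizedEquivalence (Ω : Set ExtSpace) (𝒯 : ExtSpace → ExtSpace) : Prop :=
  ContDiffOn ℝ ∞ 𝒯 Ω ∧
  (∀ p ∈ Ω, (fderiv ℝ 𝒯 p).det ≠ 0) ∧
  ∀ θ : Equation, ∃ θ' : Equation,
    (∀ v ∈ θ.domain Ω,
      𝒯 (θ.lift v) 1 ∈ θ'.I ∧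
      𝒯 (θ.lift v) 3 = θ'.f (𝒯 (θ.lift v) 1) ∧
      𝒯 (θ.lift v) 4 = θ'.h (𝒯 (θ.lift v) 1) ∧
      𝒯 (θ.lift v) 5 = θ'.n ∧
      𝒯 (θ.lift v) 6 = θ'.m) ∧
    Transforms (θ.restrict 𝒯) (θ.domain Ω) θ θ'

/-- The tuples `(δ₁, …, δ₇)`. -/
structure Params where
  d1 : ℝ
  d2 : ℝ
  d3 : ℝ
  d4 : ℝ
  d5 : ℝ
  d6 : ℝ
  d7 : ℝ

/-- `Δ = δ₅ δ₆ - δ₄ δ₇`. -/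
def Params.disc (δ : Params) : ℝ := δ.d5 * δ.d6 - δ.d4 * δ.d7

/-- `δ₁ δ₃ ≠ 0` and `Δ ≠ 0`. -/
def Params.Valid (δ : Params) : Prop := δ.d1 * δ.d3 ≠ 0 ∧ δ.disc ≠ 0

/-- `δ₄ x + δ₅`. -/
def Params.den (δ : Params) (x : ℝ) : ℝ := δ.d4 * x + δ.d5

/-- The transformation with the parameters `δ₁, …, δ₇`. -/
def Params.toMap (δ : Params) (p : ExtSpace) : ExtSpace :=
  ![δ.d1 * p 0 + δ.d2,
    (δ.d6 * p 1 + δ.d7) / δ.den (p 1),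
    δ.d3 * p 2 - δ.d3 / p 5 * Real.log |δ.den (p 1)|,
    δ.d1 / δ.disc ^ 2 * |δ.den (p 1)| ^ 3 * p 3,
    δ.d3 / δ.disc ^ 2 * |δ.den (p 1)| ^ (p 6 / p 5 + 3) * p 4,
    p 5 / δ.d3,
    p 6 / δ.d3]

/-- The values of `(t, x, u, f, h, n, m)` allowed by the class at which `δ₄ x + δ₅ ≠ 0`. -/
def Params.maxDomain (δ : Params) : Set ExtSpace := {p | p ∈ classSpace ∧ δ.den (p 1) ≠ 0}

/-- Smooth dependence of the parameters on `(n, m)`. -/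
def SmoothParamsOn (δ : ℝ × ℝ → Params) (W : Set (ℝ × ℝ)) : Prop :=
  ContDiffOn ℝ ∞ (fun w => (δ w).d1) W ∧ ContDiffOn ℝ ∞ (fun w => (δ w).d2) W ∧
  ContDiffOn ℝ ∞ (fun w => (δ w).d3) W ∧ ContDiffOn ℝ ∞ (fun w => (δ w).d4) W ∧
  ContDiffOn ℝ ∞ (fun w => (δ w).d5) W ∧ ContDiffOn ℝ ∞ (fun w => (δ w).d6) W ∧
  ContDiffOn ℝ ∞ (fun w => (δ w).d7) W

/-- The values of `(n, m)` occurring in `Ω`. -/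
def paramValues (Ω : Set ExtSpace) : Set (ℝ × ℝ) := (fun p => (p 5, p 6)) '' Ω

end RDExp

end

/-! Write T, X, U for the components of the transformation in t, x, u, subscripts for partial
derivatives, and tildes for the new arbitrary elements. The substance is that every generalized
equivalence transformation belongs to the family.

Fix an equation and its image. The equation can be solved for u_xx, so u_t, u_x, u_tt may be
prescribed freely, and quadratic polynomials realize the jets that are needed. Freedom in u_tt
forces T_x = T_u = 0 (`Transforms.time`). Comparing two values of u_t gives f̃ (X_x + u_x X_u)² =
T_t f e^{ñU - nu}, hence X_u = 0 (`Transforms.leading`) and then U_u = n/ñ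
(`Transforms.pj_potential`). Splitting the rest in powers of u_x yields X_t = 0, X_xx = 2ñ U_x X_x
and a residual equation without u_x (`Transforms.space`).

Through every point of the extended space pass equations with affine f and h of arbitrary slopes c
and c'. For them the total x-derivative is ∂_x + c ∂_f + c' ∂_h, and splitting in c, c' shows that
T, X, U do not depend on f and h (`IsGeneralizedEquivalence.determiningEquations`).

Along the u-direction the residual equation relates exponentials with the exponents -n, 0, m - n and
(m̃ - ñ)n/ñ. Where h ≠ 0, m ≠ 0 and m ≠ n these separate; by density the consequences hold
everywhere: U_t = 0, U_xx = ñ U_x², m̃ n = m ñ, and a formula for h̃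
(`DeterminingEquations.separated`).

Now L = e^{nu - ñU} satisfies L_xx = 0 and (X L)_xx = 0. So X is linear fractional with the
denominator L, and U contains the logarithm of L. The leading relation, solved for T_t, gives T_tt =
0 and the formula for f̃. The coefficients of these affine functions have zero derivatives in t, x,
u, f, h, and connectedness of the slices makes them functions of (n, m) (`exists_descend`).

Conversely, membership in the family suffices by a computation with jets (`transforms_image`) and
with the kernel of the Jacobian (`det_ne_zero_of_params`). The group laws are those of 2×2 matrices,
combined with the multiplicativity of the denominators (`Params.den_comp`). -/

namespace RDExp

open Filter Topology

/-! ### Directional derivatives and functions along lines and curves -/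

section Calculus

variable {E : Type*} [NormedAddCommGroup E] [NormedSpace ℝ E]

/-- The derivative of `g` in the direction `e`, as a function of the point. -/
noncomputable def pd (g : E → ℝ) (e : E) (x : E) : ℝ := fderiv ℝ g x e

theorem pd_add_smul (g : E → ℝ) (a b : ℝ) (e e' x : E) :
    pd g (a • e + b • e') x = a * pd g e x + b * pd g e' x := by
  simp [pd]

theorem contDiffAt_pd {g : E → ℝ} {x : E} (hg : ContDiffAt ℝ ∞ g x) (e : E) :
    ContDiffAt ℝ ∞ (pd g e) x :=
  (hg.fderiv_right (m := ∞) (by simp)).clm_apply contDiffAt_const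

theorem contDiffOn_pd {g : E → ℝ} {D : Set E} (hD : IsOpen D) (hg : ContDiffOn ℝ ∞ g D) (e : E) :
    ContDiffOn ℝ ∞ (pd g e) D :=
  fun _ hx => (contDiffAt_pd (hg.contDiffAt (hD.mem_nhds hx)) e).contDiffWithinAt

theorem pd_comm {g : E → ℝ} {x : E} (hg : ContDiffAt ℝ ∞ g x) (e e' : E) :
    pd (pd g e) e' x = pd (pd g e') e x := by
  have h1 : DifferentiableAt ℝ (fderiv ℝ g) x :=
    (hg.fderiv_right (m := ∞) (by simp)).differentiableAt (by simp)
  have key : ∀ e e' : E, pd (pd g e) e' x = fderiv ℝ (fderiv ℝ g) x e' e := by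
    intro e e'
    have := (h1.hasFDerivAt.clm_apply (hasFDerivAt_const e x)).fderiv
    change fderiv ℝ (fun y => fderiv ℝ g y e) x e' = _
    rw [this]; simp
  rw [key, key]
  have h2 : ContDiffAt ℝ 2 g x := hg.of_le ENat.LEInfty.out
  exact (h2.isSymmSndFDerivAt (by simp [minSmoothness_of_isRCLikeNormedField])).eq _ _

theorem pd_congr {g g' : E → ℝ} {D : Set E} (hD : IsOpen D) (h : ∀ x ∈ D, g x = g' x) (e : E) :
    ∀ x ∈ D, pd g e x = pd g' e x := by
  intro x hx
  have : g =ᶠ[𝓝 x] g' := by filter_upwards [hD.mem_nhds hx] with y hy using h y hy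
  simp [pd, this.fderiv_eq]

theorem pd_eq_zero_of_const {g : E → ℝ} {D : Set E} (hD : IsOpen D) {c : ℝ}
    (h : ∀ x ∈ D, g x = c) (e : E) : ∀ x ∈ D, pd g e x = 0 := by
  intro x hx
  rw [pd_congr hD (g' := fun _ => c) h e x hx]
  simp [pd]

/-- Mixed derivatives commute. This is how first-order conditions such as X_u = 0 are passed on to
the derivatives X_x and X_t. -/
theorem pd_pd_eq_zero {g : E → ℝ} {D : Set E} (hD : IsOpen D) (hg : ContDiffOn ℝ ∞ g D) {e : E}
    (h : ∀ x ∈ D, pd g e x = 0) (e' : E) : ∀ x ∈ D, pd (pd g e') e x = 0 := by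
  intro x hx
  rw [pd_comm (hg.contDiffAt (hD.mem_nhds hx))]
  exact pd_eq_zero_of_const hD h e' x hx

theorem hasDerivAt_line {g : E → ℝ} {x e : E} {s : ℝ} (hg : DifferentiableAt ℝ g (x + s • e)) :
    HasDerivAt (fun s : ℝ => g (x + s • e)) (pd g e (x + s • e)) s := by
  have h1 : HasDerivAt (fun s : ℝ => x + s • e) e s := by
    simpa using ((hasDerivAt_id s).smul_const e).const_add x
  exact hg.hasFDerivAt.comp_hasDerivAt s h1

theorem hasDerivAt_line_zero {g : E → ℝ} {x : E} (hg : ContDiffAt ℝ ∞ g x) (e : E) :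
    HasDerivAt (fun s : ℝ => g (x + s • e)) (pd g e x) 0 := by
  have := hasDerivAt_line (g := g) (x := x) (e := e) (s := 0)
    (by simpa using hg.differentiableAt (by simp))
  simpa using this

theorem pd_eq_of_hasDerivAt {g : E → ℝ} {x e : E} {c : ℝ} (hg : ContDiffAt ℝ ∞ g x)
    (h : HasDerivAt (fun s : ℝ => g (x + s • e)) c 0) : pd g e x = c :=
  (hasDerivAt_line_zero hg e).unique h

theorem eventually_line_mem {D : Set E} (hD : IsOpen D) {x : E} (hx : x ∈ D) (e : E) :
    ∀ᶠ s : ℝ in 𝓝 0, x + s • e ∈ D := by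
  have hc : ContinuousAt (fun s : ℝ => x + s • e) 0 := by fun_prop
  exact hc.eventually_mem (by simpa using hD.mem_nhds hx)

/-- A function whose derivative in a direction is constant is affine along this direction. -/
theorem eventually_line_eq {g : E → ℝ} {D : Set E} (hD : IsOpen D) (hg : ContDiffOn ℝ ∞ g D)
    {e : E} {x : E} (hx : x ∈ D) {k : ℝ} (h : ∀ y ∈ D, (∃ s : ℝ, y = x + s • e) → pd g e y = k) :
    ∀ᶠ s : ℝ in 𝓝 0, g (x + s • e) = g x + k * s := by
  obtain ⟨r, hr, hball⟩ := Metric.eventually_nhds_iff_ball.1 (eventually_line_mem hD hx e)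
  filter_upwards [Metric.ball_mem_nhds (0 : ℝ) hr] with s hs
  have hd : ∀ s ∈ Metric.ball (0 : ℝ) r,
      HasDerivAt (fun s : ℝ => g (x + s • e) - k * s) 0 s := by
    intro s hs
    have h1 := hasDerivAt_line (g := g) (x := x) (e := e) (s := s)
      ((hg.contDiffAt (hD.mem_nhds (hball s hs))).differentiableAt (by simp))
    rw [h _ (hball s hs) ⟨s, rfl⟩] at h1
    have h2 := h1.sub ((hasDerivAt_id s).const_mul k)
    rw [mul_one, sub_self] at h2
    exact h2
  have := (convex_ball (0 : ℝ) r).is_const_of_fderivWithin_eq_zero (𝕜 := ℝ)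
    (f := fun s : ℝ => g (x + s • e) - k * s)
    (fun s hs => (hd s hs).differentiableAt.differentiableWithinAt)
    (fun s hs => by
      rw [fderivWithin_of_isOpen Metric.isOpen_ball hs]
      ext; simpa using (hd s hs).deriv)
    hs (Metric.mem_ball_self hr)
  simp at this
  linarith

/-- The second-order chain rule along a curve: a Hessian term in the velocity and a gradient term in
the acceleration. It replaces the general prolongation formulas for second-order jets, as curves
inside graphs carry all the information that is needed. -/
theorem deriv_deriv_comp {G : E → ℝ} {γ : ℝ → E} (hG : ContDiffAt ℝ ∞ G (γ 0))
    (hγ : ContDiffAt ℝ ∞ γ 0) :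
    deriv (fun s => G (γ s)) 0 = pd G (deriv γ 0) (γ 0) ∧
    deriv (deriv (fun s => G (γ s))) 0 =
      pd (pd G (deriv γ 0)) (deriv γ 0) (γ 0) + pd G (deriv (deriv γ) 0) (γ 0) := by
  have hev : ∀ᶠ s in 𝓝 (0 : ℝ), HasDerivAt (fun s => G (γ s)) (fderiv ℝ G (γ s) (deriv γ s)) s := by
    have h1 : ∀ᶠ y in 𝓝 (γ 0), ContDiffAt ℝ 1 G y :=
      (hG.of_le (by simp : (1 : ℕ∞ω) ≤ ∞)).eventually (by simp)
    have h2 : ∀ᶠ s in 𝓝 (0 : ℝ), ContDiffAt ℝ 1 γ s :=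
      (hγ.of_le (by simp : (1 : ℕ∞ω) ≤ ∞)).eventually (by simp)
    filter_upwards [hγ.continuousAt.eventually h1, h2] with s hs1 hs2
    exact (hs1.differentiableAt (by simp)).hasFDerivAt.comp_hasDerivAt s
      (hs2.differentiableAt (by simp)).hasDerivAt
  refine ⟨hev.self_of_nhds.deriv, ?_⟩
  have heq : deriv (fun s => G (γ s)) =ᶠ[𝓝 0] fun s => fderiv ℝ G (γ s) (deriv γ s) := by
    filter_upwards [hev] with s hs using hs.deriv
  rw [heq.deriv_eq]
  have h1 : DifferentiableAt ℝ (fderiv ℝ G) (γ 0) :=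
    (hG.fderiv_right (m := ∞) (by simp)).differentiableAt (by simp)
  have h2 : HasDerivAt γ (deriv γ 0) 0 := (hγ.differentiableAt (by simp)).hasDerivAt
  have h3 : DifferentiableAt ℝ (deriv γ) 0 := by
    have : ContDiffAt ℝ ∞ (fun s => fderiv ℝ γ s 1) 0 :=
      (hγ.fderiv_right (m := ∞) (by simp)).clm_apply contDiffAt_const
    exact this.differentiableAt (by simp)
  have h5 := ((h1.hasFDerivAt.comp_hasDerivAt (0 : ℝ) h2).clm_apply h3.hasDerivAt).deriv
  simp only [Function.comp_def] at h5
  rw [h5]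
  have h4 := (h1.hasFDerivAt.clm_apply (hasFDerivAt_const (deriv γ 0) (γ 0))).fderiv
  change _ = fderiv ℝ (fun y => fderiv ℝ G y (deriv γ 0)) (γ 0) (deriv γ 0) + _
  rw [h4]
  simp [pd]

end Calculus

/-- Expanding (e^{nu} u_x)_x makes the equation an algebraic condition on the jet, with u_xx
entering through a nonvanishing coefficient. -/
theorem Equation.holdsAt_iff (θ : Equation) {u : ℝ × ℝ → ℝ} {t x : ℝ}
    (hu : ContDiffAt ℝ ∞ u (t, x)) :
    θ.HoldsAt u t x ↔ θ.f x * pd u (1, 0) (t, x) =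
      Real.exp (θ.n * u (t, x)) *
        (pd (pd u (0, 1)) (0, 1) (t, x) + θ.n * pd u (0, 1) (t, x) ^ 2)
      + θ.h x * Real.exp (θ.m * u (t, x)) := by
  have e1 : deriv (fun s => u (s, x)) t = pd u (1, 0) (t, x) := by
    have h1 : HasDerivAt (fun s : ℝ => (s, x)) ((1 : ℝ), (0 : ℝ)) t :=
      (hasDerivAt_id t).prodMk (hasDerivAt_const t x)
    exact ((hu.differentiableAt (by simp)).hasFDerivAt.comp_hasDerivAt t h1).deriv
  have hline : ∀ y : ℝ, HasDerivAt (fun y : ℝ => (t, y)) ((0 : ℝ), (1 : ℝ)) y :=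
    fun y => (hasDerivAt_const y t).prodMk (hasDerivAt_id y)
  have hev : ∀ᶠ y in 𝓝 x, HasDerivAt (fun z => u (t, z)) (pd u (0, 1) (t, y)) y := by
    have h1 : ∀ᶠ y in 𝓝 (t, x), ContDiffAt ℝ 1 u y :=
      (hu.of_le (by simp : (1 : ℕ∞ω) ≤ ∞)).eventually (by simp)
    have hc : ContinuousAt (fun y : ℝ => (t, y)) x := by fun_prop
    filter_upwards [hc.eventually h1] with y hy
    exact (hy.differentiableAt (by simp)).hasFDerivAt.comp_hasDerivAt y (hline y)
  have e2 : (fun y => Real.exp (θ.n * u (t, y)) * deriv (fun z => u (t, z)) y) =ᶠ[𝓝 x]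
      fun y => Real.exp (θ.n * u (t, y)) * pd u (0, 1) (t, y) := by
    filter_upwards [hev] with y hy
    rw [hy.deriv]
  have h3 : HasDerivAt (fun y => pd u (0, 1) (t, y)) (pd (pd u (0, 1)) (0, 1) (t, x)) x :=
    ((contDiffAt_pd hu (0, 1)).differentiableAt (by simp)).hasFDerivAt.comp_hasDerivAt x (hline x)
  have e3 := (((hev.self_of_nhds.const_mul θ.n).exp).mul h3).deriv
  unfold Equation.HoldsAt
  rw [e1, e2.deriv_eq]
  have e4 : deriv (fun y => Real.exp (θ.n * u (t, y)) * pd u (0, 1) (t, y)) x = _ := e3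
  rw [e4]
  constructor <;> intro h <;> linear_combination h

/-! ### Descent to functions of n and m -/

section Slices

/-- A smooth function whose derivatives in the first five directions vanish is a smooth function of
the last two coordinates, provided that the slices are connected. -/
theorem exists_descend {Ω : Set ExtSpace} (hΩ : IsOpen Ω)
    (hs : ∀ n m : ℝ, IsPreconnected {p : ExtSpace | p ∈ Ω ∧ p 5 = n ∧ p 6 = m})
    {g : ExtSpace → ℝ} (hg : ContDiffOn ℝ ∞ g Ω)
    (h : ∀ p ∈ Ω, ∀ v : ExtSpace, v 5 = 0 → v 6 = 0 → pd g v p = 0) :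
    ∃ G : ℝ × ℝ → ℝ, ContDiffOn ℝ ∞ G (paramValues Ω) ∧ ∀ p ∈ Ω, G (p 5, p 6) = g p := by
  classical
  have hconst : ∀ p ∈ Ω, ∀ q ∈ Ω, p 5 = q 5 → p 6 = q 6 → g p = g q := by
    intro p hp q hq h5 h6
    -- Local constancy suffices on a preconnected slice. Within a ball inside Ω, two points of a
    -- slice are joined by a segment in Ω whose direction has no n- or m-component, and `g` is
    -- constant along it.
    refine (hs (p 5) (p 6)).induction₂ (fun x y => g x = g y) ?_ ?_ ?_ (x := p) (y := q)
      ⟨hp, rfl, rfl⟩ ⟨hq, h5.symm, h6.symm⟩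
    · rintro x ⟨hx, hx5, hx6⟩
      obtain ⟨r, hr, hball⟩ := Metric.isOpen_iff.1 hΩ x hx
      filter_upwards [inter_mem_nhdsWithin _ (Metric.ball_mem_nhds x hr)]
      rintro y ⟨⟨hy, hy5, hy6⟩, hyb⟩
      have hseg : ∀ s ∈ Set.Icc (0 : ℝ) 1, x + s • (y - x) ∈ Ω := by
        intro s hs
        refine hball ((convex_ball x r).segment_subset (Metric.mem_ball_self hr) hyb ?_)
        rw [segment_eq_image']
        exact ⟨s, hs, rfl⟩
      have hd : ∀ s ∈ Set.Icc (0 : ℝ) 1, HasDerivAt (fun s : ℝ => g (x + s • (y - x))) 0 s := by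
        intro s hs
        have h1 := hasDerivAt_line (g := g) (x := x) (e := y - x) (s := s)
          ((hg.contDiffAt (hΩ.mem_nhds (hseg s hs))).differentiableAt (by simp))
        rwa [h _ (hseg s hs) _ (by simp [hx5, hy5]) (by simp [hx6, hy6])] at h1
      have := constant_of_has_deriv_right_zero (f := fun s : ℝ => g (x + s • (y - x)))
        (a := 0) (b := 1)
        (fun s hs => (hd s hs).continuousAt.continuousWithinAt)
        (fun s hs => (hd s ⟨hs.1, hs.2.le⟩).hasDerivWithinAt) 1 (by simp)
      simpa using this.symm
    · intro x y z _ _ _ hxy hyz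
      exact hxy.trans hyz
    · intro x y _ _ hxy
      exact hxy.symm
  -- An arbitrary point of each nonempty slice; no continuity of this choice is needed.
  let c : ℝ × ℝ → ExtSpace := fun w => if h : w ∈ paramValues Ω then h.choose else 0
  have hc : ∀ w ∈ paramValues Ω, c w ∈ Ω ∧ (c w 5, c w 6) = w := by
    intro w hw
    simp only [c, dif_pos hw]
    exact hw.choose_spec
  have hG : ∀ p ∈ Ω, g (c (p 5, p 6)) = g p := by
    intro p hp
    obtain ⟨h1, h2⟩ := hc (p 5, p 6) ⟨p, hp, rfl⟩
    rw [Prod.mk.injEq] at h2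
    exact hconst _ h1 _ hp h2.1 h2.2
  refine ⟨fun w => g (c w), ?_, hG⟩
  rintro _ ⟨p, hp, rfl⟩
  -- Smoothness is checked with the smooth local section through `p` that varies only n and m; on it
  -- the value of `g` agrees with the one at the chosen point.
  let ι : ℝ × ℝ → ExtSpace := fun w => ![p 0, p 1, p 2, p 3, p 4, w.1, w.2]
  have hι : ContDiff ℝ ∞ ι := by
    rw [contDiff_pi]
    intro i
    fin_cases i <;> simp [ι] <;> fun_prop
  have hιp : ι (p 5, p 6) = p := by
    ext i; fin_cases i <;> rfl
  have h1 : ContDiffAt ℝ ∞ (fun w => g (ι w)) (p 5, p 6) :=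
    ContDiffAt.comp (p 5, p 6) (by rw [hιp]; exact hg.contDiffAt (hΩ.mem_nhds hp)) hι.contDiffAt
  refine (h1.congr_of_eventuallyEq ?_).contDiffWithinAt
  have hmem : ∀ᶠ w in 𝓝 (p 5, p 6), ι w ∈ Ω :=
    hι.continuous.continuousAt.eventually_mem (by rw [hιp]; exact hΩ.mem_nhds hp)
  filter_upwards [hmem] with w hw
  exact hG (ι w) hw

theorem isOpen_paramValues {Ω : Set ExtSpace} (hΩ : IsOpen Ω) : IsOpen (paramValues Ω) := by
  rw [isOpen_iff_mem_nhds]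
  rintro _ ⟨p, hp, rfl⟩
  let ι : ℝ × ℝ → ExtSpace := fun w => ![p 0, p 1, p 2, p 3, p 4, w.1, w.2]
  have hι : Continuous ι := by
    refine continuous_pi fun i => ?_
    fin_cases i <;> simp [ι] <;> fun_prop
  have hιp : ι (p 5, p 6) = p := by
    ext i; fin_cases i <;> rfl
  have hmem : ∀ᶠ w in 𝓝 (p 5, p 6), ι w ∈ Ω :=
    hι.continuousAt.eventually_mem (by rw [hιp]; exact hΩ.mem_nhds hp)
  filter_upwards [hmem] with w hw
  exact ⟨ι w, hw, rfl⟩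

end Slices

/-! ### The group structure of the family -/

namespace Params

/-- The parameters of the identity. -/
def one : Params := ⟨1, 0, 1, 0, 1, 1, 0⟩

/-- The parameters of the composition of `δ` followed by `δ'`. -/
def comp (δ' δ : Params) : Params where
  d1 := δ'.d1 * δ.d1
  d2 := δ'.d1 * δ.d2 + δ'.d2
  d3 := δ'.d3 * δ.d3
  d4 := δ'.d4 * δ.d6 + δ'.d5 * δ.d4
  d5 := δ'.d4 * δ.d7 + δ'.d5 * δ.d5
  d6 := δ'.d6 * δ.d6 + δ'.d7 * δ.d4
  d7 := δ'.d6 * δ.d7 + δ'.d7 * δ.d5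

/-- The parameters of the inverse transformation. -/
noncomputable def inv (δ : Params) : Params where
  d1 := 1 / δ.d1
  d2 := -δ.d2 / δ.d1
  d3 := 1 / δ.d3
  d4 := -δ.d4 / δ.disc
  d5 := δ.d6 / δ.disc
  d6 := δ.d5 / δ.disc
  d7 := -δ.d7 / δ.disc

theorem one_valid : one.Valid := by simp [Valid, disc, one]

/-- `disc` is the determinant of the matrix with the rows (δ₆, δ₇) and (δ₄, δ₅), and `comp`
multiplies these matrices. -/
theorem disc_comp (δ' δ : Params) : (comp δ' δ).disc = δ'.disc * δ.disc := by
  simp only [comp, disc]; ring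

theorem comp_valid {δ' δ : Params} (h' : δ'.Valid) (h : δ.Valid) : (comp δ' δ).Valid := by
  refine ⟨?_, by rw [disc_comp]; exact mul_ne_zero h'.2 h.2⟩
  have := mul_ne_zero h'.1 h.1
  simp only [comp]
  intro h0
  exact this (by linear_combination h0)

theorem inv_valid {δ : Params} (h : δ.Valid) : δ.inv.Valid := by
  have h1 := left_ne_zero_of_mul h.1
  have h3 := right_ne_zero_of_mul h.1
  have hd := h.2
  refine ⟨by simp [inv, h1, h3], ?_⟩
  have : δ.inv.disc = 1 / δ.disc := by
    simp only [inv]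
    rw [disc]
    field_simp
    simp only [disc]; ring
  rw [this]
  exact one_div_ne_zero hd

theorem comp_inv_self {δ : Params} (h : δ.Valid) : comp δ.inv δ = one := by
  have h1 := left_ne_zero_of_mul h.1
  have h3 := right_ne_zero_of_mul h.1
  have hd := h.2
  simp only [comp, one, inv, Params.mk.injEq]
  refine ⟨by field_simp, by field_simp; ring, by field_simp, by field_simp; ring, ?_, ?_, ?_⟩
  · field_simp; simp only [disc]; ring
  · field_simp; simp only [disc]; ring
  · field_simp; ring

/-- The cocycle property of the denominators of linear fractional maps. Logarithms, cubes and real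
powers of |δ₄x + δ₅| thereby compose correctly, which settles the u-, f- and h-components of a
composition. -/
theorem den_comp {δ' δ : Params} {x : ℝ} (hx : δ.den x ≠ 0) :
    (comp δ' δ).den x = δ'.den ((δ.d6 * x + δ.d7) / δ.den x) * δ.den x := by
  simp only [den] at hx ⊢
  simp only [comp]
  field_simp
  ring

theorem toMap_one (p : ExtSpace) : one.toMap p = p := by
  ext i
  fin_cases i <;> simp [toMap, one, den, disc]

theorem mem_maxDomain_one {p : ExtSpace} (hp : p ∈ classSpace) : p ∈ one.maxDomain :=
  ⟨hp, by simp [one, den]⟩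

theorem toMap_mem_classSpace {δ : Params} (h : δ.Valid) {p : ExtSpace} (hp : p ∈ δ.maxDomain) :
    δ.toMap p ∈ classSpace := by
  have h1 := left_ne_zero_of_mul h.1
  have h3 := right_ne_zero_of_mul h.1
  obtain ⟨⟨hf, hn⟩, hx⟩ := hp
  have hd := h.2
  constructor
  · simp [toMap, h1, hd, hf, hx]
  · simp [toMap, hn, h3]

theorem toMap_comp {δ' δ : Params} (h : δ.Valid) {p : ExtSpace}
    (hp : p ∈ δ.maxDomain) (hp' : δ'.den (δ.toMap p 1) ≠ 0) :
    (comp δ' δ).den (p 1) ≠ 0 ∧ δ'.toMap (δ.toMap p) = (comp δ' δ).toMap p := by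
  have h3 := right_ne_zero_of_mul h.1
  obtain ⟨⟨hf, hn⟩, hx⟩ := hp
  have hX : δ.toMap p 1 = (δ.d6 * p 1 + δ.d7) / δ.den (p 1) := rfl
  rw [hX] at hp'
  have hden := den_comp (δ' := δ') hx
  set X := (δ.d6 * p 1 + δ.d7) / δ.den (p 1) with hXdef
  have hden0 : (comp δ' δ).den (p 1) ≠ 0 := by rw [hden]; exact mul_ne_zero hp' hx
  refine ⟨hden0, ?_⟩
  have habs : |(comp δ' δ).den (p 1)| = |δ'.den X| * |δ.den (p 1)| := by rw [hden, abs_mul]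
  have hpos : 0 < |δ.den (p 1)| := abs_pos.2 hx
  have hpos' : 0 < |δ'.den X| := abs_pos.2 hp'
  -- Both n and m are divided by δ₃, so the exponent m/n + 3 is the same for both factors.
  have hexp : p 6 / δ.d3 / (p 5 / δ.d3) = p 6 / p 5 := by field_simp
  ext i
  fin_cases i
  · simp [toMap, comp]; ring
  · change (δ'.d6 * X + δ'.d7) / δ'.den X = ((comp δ' δ).d6 * p 1 + (comp δ' δ).d7) /
      (comp δ' δ).den (p 1)
    rw [div_eq_div_iff hp' hden0, hden, hXdef]
    have : (comp δ' δ).d6 * p 1 + (comp δ' δ).d7 = (δ'.d6 * X + δ'.d7) * δ.den (p 1) := by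
      rw [hXdef, add_mul, mul_assoc, div_mul_cancel₀ _ hx]
      simp only [comp, den]; ring
    rw [this]; ring
  · change δ'.d3 * (δ.d3 * p 2 - δ.d3 / p 5 * Real.log |δ.den (p 1)|)
        - δ'.d3 / (p 5 / δ.d3) * Real.log |δ'.den X| =
      δ'.d3 * δ.d3 * p 2 - δ'.d3 * δ.d3 / p 5 * Real.log |(comp δ' δ).den (p 1)|
    rw [habs, Real.log_mul hpos'.ne' hpos.ne']
    field_simp
    ring
  · change δ'.d1 / δ'.disc ^ 2 * |δ'.den X| ^ 3 *
        (δ.d1 / δ.disc ^ 2 * |δ.den (p 1)| ^ 3 * p 3) =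
      δ'.d1 * δ.d1 / (comp δ' δ).disc ^ 2 * |(comp δ' δ).den (p 1)| ^ 3 * p 3
    rw [habs, disc_comp, mul_pow, mul_pow, mul_div_mul_comm]
    ring
  · change δ'.d3 / δ'.disc ^ 2 * |δ'.den X| ^ (p 6 / δ.d3 / (p 5 / δ.d3) + 3) *
        (δ.d3 / δ.disc ^ 2 * |δ.den (p 1)| ^ (p 6 / p 5 + 3) * p 4) =
      δ'.d3 * δ.d3 / (comp δ' δ).disc ^ 2 * |(comp δ' δ).den (p 1)| ^ (p 6 / p 5 + 3) * p 4
    rw [habs, disc_comp, hexp, Real.mul_rpow hpos'.le hpos.le, mul_pow, mul_div_mul_comm]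
    ring
  · change p 5 / δ.d3 / δ'.d3 = p 5 / (δ'.d3 * δ.d3)
    rw [div_div, mul_comm]
  · change p 6 / δ.d3 / δ'.d3 = p 6 / (δ'.d3 * δ.d3)
    rw [div_div, mul_comm]

/-- By the cocycle property this denominator times δ₄x + δ₅ is the denominator of the identity,
which is 1. -/
theorem den_inv {δ : Params} (h : δ.Valid) {p : ExtSpace} (hp : p ∈ δ.maxDomain) :
    δ.inv.den (δ.toMap p 1) ≠ 0 := by
  have h1 := den_comp (δ' := δ.inv) hp.2
  rw [comp_inv_self h] at h1
  intro h0
  change δ.inv.den ((δ.d6 * p 1 + δ.d7) / δ.den (p 1)) = 0 at h0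
  rw [h0] at h1
  simp [one, den] at h1

theorem toMap_inv {δ : Params} (h : δ.Valid) {p : ExtSpace} (hp : p ∈ δ.maxDomain) :
    δ.toMap p ∈ δ.inv.maxDomain ∧ δ.inv.toMap (δ.toMap p) = p := by
  refine ⟨⟨toMap_mem_classSpace h hp, den_inv h hp⟩, ?_⟩
  rw [(toMap_comp h hp (den_inv h hp)).2, comp_inv_self h, toMap_one]

end Params

/-! ### Uniqueness of the parameters up to sign -/

theorem toMap_eq_of_sign {δ δ' : Params} {ε : ℝ} (hε : ε = 1 ∨ ε = -1) (h1 : δ.d1 = δ'.d1)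
    (h2 : δ.d2 = δ'.d2) (h3 : δ.d3 = δ'.d3) (h4 : δ.d4 = ε * δ'.d4) (h5 : δ.d5 = ε * δ'.d5)
    (h6 : δ.d6 = ε * δ'.d6) (h7 : δ.d7 = ε * δ'.d7) : δ.toMap = δ'.toMap := by
  have hden : ∀ x, δ.den x = ε * δ'.den x := by
    intro x; simp only [Params.den, h4, h5]; ring
  have hε0 : ε ≠ 0 := by rcases hε with rfl | rfl <;> norm_num
  have hε2 : ε ^ 2 = 1 := by rcases hε with rfl | rfl <;> norm_num
  have hεa : |ε| = 1 := by rcases hε with rfl | rfl <;> norm_num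
  have habs : ∀ x, |δ.den x| = |δ'.den x| := by
    intro x; rw [hden, abs_mul, hεa, one_mul]
  have hdisc : δ.disc = δ'.disc := by
    simp only [Params.disc, h4, h5, h6, h7]
    linear_combination (δ'.d5 * δ'.d6 - δ'.d4 * δ'.d7) * hε2
  funext p
  have hX : (δ.d6 * p 1 + δ.d7) / δ.den (p 1) = (δ'.d6 * p 1 + δ'.d7) / δ'.den (p 1) := by
    rw [hden, h6, h7, mul_assoc, ← mul_add, mul_div_mul_left _ _ hε0]
  simp only [Params.toMap, habs, hdisc, h1, h2, h3, hX]

/-- Polynomials of degree at most two which agree near a point have the same coefficients. -/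
theorem quadratic_coeff_eq {a b c a' b' c' x : ℝ}
    (h : ∀ᶠ s : ℝ in 𝓝 0, a * (x + s) ^ 2 + b * (x + s) + c =
      a' * (x + s) ^ 2 + b' * (x + s) + c') : a = a' ∧ b = b' ∧ c = c' := by
  obtain ⟨r, hr, hb⟩ := Metric.eventually_nhds_iff_ball.1 h
  have h0 := hb 0 (Metric.mem_ball_self hr)
  have h1 := hb (r / 2) (by simp [abs_of_pos hr]; linarith)
  have h2 := hb (-(r / 2)) (by simp [abs_of_pos hr]; linarith)
  have ea : (a - a') * r ^ 2 = 0 := by linear_combination 2 * h1 + 2 * h2 - 4 * h0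
  have ha : a = a' := by
    rcases mul_eq_zero.1 ea with h | h
    · linarith
    · exact absurd h (pow_ne_zero 2 hr.ne')
  subst ha
  have eb : (b - b') * r = 0 := by linear_combination h1 - h2
  have hb' : b = b' := by
    rcases mul_eq_zero.1 eb with h | h
    · linarith
    · exact absurd h hr.ne'
  subst hb'
  exact ⟨rfl, rfl, by linarith⟩

/-- The u-components determine log |δ₄x + δ₅|, hence the square of the denominator as a polynomial
in x, hence (δ₄, δ₅) up to a common sign. Cross-multiplying the x-components then transfers this
sign to (δ₆, δ₇). -/
theorem sign_of_eqOn {δ δ' : Params} (h : δ.Valid) (h' : δ'.Valid) {Ω : Set ExtSpace}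
    (hΩ : IsOpen Ω) (hne : Ω.Nonempty) (hsub : Ω ⊆ δ.maxDomain) (hsub' : Ω ⊆ δ'.maxDomain)
    (heq : Set.EqOn δ.toMap δ'.toMap Ω) :
    δ.d1 = δ'.d1 ∧ δ.d2 = δ'.d2 ∧ δ.d3 = δ'.d3 ∧
      ∃ ε : ℝ, (ε = 1 ∨ ε = -1) ∧
        δ.d4 = ε * δ'.d4 ∧ δ.d5 = ε * δ'.d5 ∧ δ.d6 = ε * δ'.d6 ∧ δ.d7 = ε * δ'.d7 := by
  obtain ⟨p, hp⟩ := hne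
  have hn : p 5 ≠ 0 := (hsub hp).1.2
  have hd3 := right_ne_zero_of_mul h.1
  have hd3' := right_ne_zero_of_mul h'.1
  have e3 : δ.d3 = δ'.d3 := by
    have : p 5 / δ.d3 = p 5 / δ'.d3 := congrFun (heq hp) 5
    field_simp at this
    exact this.symm
  -- The t-component is affine, so the quadratic coefficients compared here are both zero.
  have e12 : (0 : ℝ) = 0 ∧ δ.d1 = δ'.d1 ∧ δ.d2 = δ'.d2 := by
    apply quadratic_coeff_eq (x := p 0)
    filter_upwards [eventually_line_mem hΩ hp (Pi.single 0 1)] with s hs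
    have := congrFun (heq hs) 0
    simp [Params.toMap] at this
    linear_combination this
  have hden : ∀ q ∈ Ω, δ.den (q 1) ^ 2 = δ'.den (q 1) ^ 2 := by
    intro q hq
    have hq5 : q 5 ≠ 0 := (hsub hq).1.2
    have h2 : δ.d3 * q 2 - δ.d3 / q 5 * Real.log |δ.den (q 1)| =
      δ'.d3 * q 2 - δ'.d3 / q 5 * Real.log |δ'.den (q 1)| := congrFun (heq hq) 2
    rw [← e3] at h2
    have h3 : Real.log |δ.den (q 1)| = Real.log |δ'.den (q 1)| := by
      have : δ.d3 / q 5 ≠ 0 := div_ne_zero hd3 hq5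
      apply mul_left_cancel₀ this
      linarith
    rw [← sq_abs, Real.log_injOn_pos (abs_pos.2 (hsub hq).2) (abs_pos.2 (hsub' hq).2) h3, sq_abs]
  have hnum : ∀ q ∈ Ω, (δ.d6 * q 1 + δ.d7) * δ'.den (q 1) =
      (δ'.d6 * q 1 + δ'.d7) * δ.den (q 1) := by
    intro q hq
    have h2 : (δ.d6 * q 1 + δ.d7) / δ.den (q 1) = (δ'.d6 * q 1 + δ'.d7) / δ'.den (q 1) :=
      congrFun (heq hq) 1
    rwa [div_eq_div_iff (hsub hq).2 (hsub' hq).2] at h2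
  have e45 : δ.d4 ^ 2 = δ'.d4 ^ 2 ∧ 2 * δ.d4 * δ.d5 = 2 * δ'.d4 * δ'.d5 ∧
      δ.d5 ^ 2 = δ'.d5 ^ 2 := by
    apply quadratic_coeff_eq (x := p 1)
    filter_upwards [eventually_line_mem hΩ hp (Pi.single 1 1)] with s hs
    have := hden _ hs
    simp [Params.den] at this
    linear_combination this
  have e67 : δ.d6 * δ'.d4 = δ'.d6 * δ.d4 ∧
      δ.d6 * δ'.d5 + δ.d7 * δ'.d4 = δ'.d6 * δ.d5 + δ'.d7 * δ.d4 ∧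
      δ.d7 * δ'.d5 = δ'.d7 * δ.d5 := by
    apply quadratic_coeff_eq (x := p 1)
    filter_upwards [eventually_line_mem hΩ hp (Pi.single 1 1)] with s hs
    have := hnum _ hs
    simp [Params.den] at this
    linear_combination this
  refine ⟨e12.2.1, e12.2.2, e3, ?_⟩
  -- If δ'₄ ≠ 0, the sign is read off from δ₄ and the mixed coefficient carries it over to δ₅;
  -- otherwise δ₄ = 0 as well and the sign is that of δ₅.
  obtain ⟨ε, hε, h4, h5⟩ : ∃ ε : ℝ, (ε = 1 ∨ ε = -1) ∧ δ.d4 = ε * δ'.d4 ∧ δ.d5 = ε * δ'.d5 := by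
    obtain ⟨ha, hb, hc⟩ := e45
    by_cases h0 : δ'.d4 = 0
    · have h0' : δ.d4 = 0 := by
        rw [h0] at ha; simpa using ha
      rcases sq_eq_sq_iff_eq_or_eq_neg.1 hc with h | h
      · exact ⟨1, Or.inl rfl, by simp [h0, h0'], by simp [h]⟩
      · exact ⟨-1, Or.inr rfl, by simp [h0, h0'], by simp [h]⟩
    · rcases sq_eq_sq_iff_eq_or_eq_neg.1 ha with h | h
      · refine ⟨1, Or.inl rfl, by simp [h], ?_⟩
        rw [h] at hb
        apply mul_left_cancel₀ h0
        linarith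
      · refine ⟨-1, Or.inr rfl, by simp [h], ?_⟩
        rw [h] at hb
        apply mul_left_cancel₀ h0
        linarith
  have hε2 : ε * ε = 1 := by rcases hε with rfl | rfl <;> norm_num
  refine ⟨ε, hε, h4, h5, ?_, ?_⟩
  all_goals
    rw [h4, h5] at e67
    obtain ⟨h1, h2, h3⟩ := e67
    have hD' := h'.2
    simp only [Params.disc] at hD'
    apply mul_left_cancel₀ hD'
  · by_cases h0 : δ'.d4 = 0
    · simp only [h0] at h2 ⊢
      linear_combination δ'.d6 * h2
    · have h6 : δ.d6 = ε * δ'.d6 := by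
        apply mul_left_cancel₀ h0; linear_combination h1
      rw [h6]
  · by_cases h0 : δ'.d4 = 0
    · have h50 : δ'.d5 ≠ 0 := by
        rintro h50; simp [h0, h50] at hD'
      have h7 : δ.d7 = ε * δ'.d7 := by
        apply mul_left_cancel₀ h50; linear_combination h3
      rw [h7]
    · have h6 : δ.d6 = ε * δ'.d6 := by
        apply mul_left_cancel₀ h0; linear_combination h1
      have h7 : δ.d7 = ε * δ'.d7 := by
        apply mul_left_cancel₀ h0
        rw [h6] at h2
        linear_combination h2
      rw [h7]

/-! ### Jets of graphs under point transformations -/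

theorem pd_vec_three (g : (Fin 3 → ℝ) → ℝ) (a b c : ℝ) (v : Fin 3 → ℝ) :
    pd g ![a, b, c] v =
      a * pd g (Pi.single 0 1) v + b * pd g (Pi.single 1 1) v + c * pd g (Pi.single 2 1) v := by
  have : (![a, b, c] : Fin 3 → ℝ) =
      a • Pi.single 0 1 + b • Pi.single 1 1 + c • Pi.single 2 1 := by
    ext i; fin_cases i <;> simp
  rw [this]
  simp [pd]

theorem fderiv_apply_eq_pd {ι ι' : Type*} [Fintype ι] [Fintype ι'] {Φ : (ι → ℝ) → (ι' → ℝ)}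
    {v : ι → ℝ} (h : DifferentiableAt ℝ Φ v) (e : ι → ℝ) (i : ι') :
    fderiv ℝ Φ v e i = pd (fun y => Φ y i) e v := by
  rw [pd, fderiv_apply h i]; rfl

theorem det_fderiv_three {Φ : (Fin 3 → ℝ) → (Fin 3 → ℝ)} {v : Fin 3 → ℝ}
    (h : DifferentiableAt ℝ Φ v) :
    (fderiv ℝ Φ v).det = Matrix.det (Matrix.of fun i j : Fin 3 =>
      pd (fun y => Φ y i) (Pi.single j 1) v) := by
  rw [ContinuousLinearMap.det, ← LinearMap.det_toMatrix']
  congr 1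
  ext i j
  rw [LinearMap.toMatrix'_apply, Matrix.of_apply, ← fderiv_apply_eq_pd h]
  congr 2

theorem det_fderiv_two {Φ : (Fin 2 → ℝ) → (Fin 2 → ℝ)} {v : Fin 2 → ℝ}
    (h : DifferentiableAt ℝ Φ v) :
    (fderiv ℝ Φ v).det = Matrix.det (Matrix.of fun i j : Fin 2 =>
      pd (fun y => Φ y i) (Pi.single j 1) v) := by
  rw [ContinuousLinearMap.det, ← LinearMap.det_toMatrix']
  congr 1
  ext i j
  rw [LinearMap.toMatrix'_apply, Matrix.of_apply, ← fderiv_apply_eq_pd h]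
  congr 2

theorem deriv_deriv_eq {F : Type*} [NormedAddCommGroup F] [NormedSpace ℝ F] {γ γ' : ℝ → F} {κ : F}
    (h : ∀ᶠ s in 𝓝 (0 : ℝ), HasDerivAt γ (γ' s) s) (h' : HasDerivAt γ' κ 0) :
    deriv γ 0 = γ' 0 ∧ deriv (deriv γ) 0 = κ := by
  refine ⟨h.self_of_nhds.deriv, ?_⟩
  have : deriv γ =ᶠ[𝓝 0] γ' := h.mono fun s hs => hs.deriv
  rw [this.deriv_eq, h'.deriv]

theorem hasDerivAt_deriv {F : Type*} [NormedAddCommGroup F] [NormedSpace ℝ F] {γ : ℝ → F}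
    (h : ContDiffAt ℝ ∞ γ 0) :
    (∀ᶠ s in 𝓝 (0 : ℝ), HasDerivAt γ (deriv γ s) s) ∧
      HasDerivAt (deriv γ) (deriv (deriv γ) 0) 0 := by
  constructor
  · have h2 : ∀ᶠ s in 𝓝 (0 : ℝ), ContDiffAt ℝ 1 γ s :=
      (h.of_le (by simp : (1 : ℕ∞ω) ≤ ∞)).eventually (by simp)
    exact h2.mono fun s hs => (hs.differentiableAt (by simp)).hasDerivAt
  · have : ContDiffAt ℝ ∞ (fun s => fderiv ℝ γ s 1) 0 :=
      (h.fderiv_right (m := ∞) (by simp)).clm_apply contDiffAt_const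
    exact (this.differentiableAt (by simp)).hasDerivAt

/-- The tangent vector of the graph of a function with first-order derivatives `a`, `b`, over the
vector `(α, β)`. -/
def graphVec (a b α β : ℝ) : Fin 3 → ℝ := ![α, β, α * a + β * b]

/-- A straight line in the (t, x)-plane has no acceleration, so its lift to the graph accelerates
only vertically, by the second derivative of `u` along the line. This is the only second-order
information that enters the chain rule. -/
theorem graph_curve {u : ℝ × ℝ → ℝ} {v : Fin 3 → ℝ} (hu : ContDiffAt ℝ ∞ u (v 0, v 1))
    (α β : ℝ) :
    let γ : ℝ → Fin 3 → ℝ := fun s => ![v 0 + s * α, v 1 + s * β, u (v 0 + s * α, v 1 + s * β)]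
    ContDiffAt ℝ ∞ γ 0 ∧
    deriv γ 0 = graphVec (pd u (1, 0) (v 0, v 1)) (pd u (0, 1) (v 0, v 1)) α β ∧
    deriv (deriv γ) 0 = ![0, 0, pd (pd u (α, β)) (α, β) (v 0, v 1)] := by
  intro γ
  let ℓ : ℝ → ℝ × ℝ := fun s => (v 0 + s * α, v 1 + s * β)
  have hℓ : ContDiff ℝ ∞ ℓ := by fun_prop
  have hℓ0 : ℓ 0 = (v 0, v 1) := by simp [ℓ]
  have hℓ1 : ∀ s, HasDerivAt ℓ (α, β) s := fun s =>
    HasDerivAt.prodMk (by simpa using ((hasDerivAt_id s).mul_const α).const_add (v 0))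
      (by simpa using ((hasDerivAt_id s).mul_const β).const_add (v 1))
  obtain ⟨hℓd, hℓdd⟩ := deriv_deriv_eq (Eventually.of_forall hℓ1) (hasDerivAt_const 0 (α, β))
  have hw : ContDiffAt ℝ ∞ (fun s => u (ℓ s)) 0 :=
    ContDiffAt.comp 0 (by rw [hℓ0]; exact hu) hℓ.contDiffAt
  obtain ⟨c1, c2⟩ := deriv_deriv_comp (G := u) (γ := ℓ) (by rw [hℓ0]; exact hu) hℓ.contDiffAt
  rw [hℓd, hℓ0] at c1
  rw [hℓd, hℓdd, hℓ0] at c2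
  obtain ⟨d1, d2⟩ := hasDerivAt_deriv hw
  have hγ1 : ∀ᶠ s in 𝓝 (0 : ℝ), HasDerivAt γ ![α, β, deriv (fun s => u (ℓ s)) s] s := by
    filter_upwards [d1] with s hs
    rw [hasDerivAt_pi]
    intro i
    fin_cases i
    · simpa [γ] using ((hasDerivAt_id s).mul_const α).const_add (v 0)
    · simpa [γ] using ((hasDerivAt_id s).mul_const β).const_add (v 1)
    · exact hs
  have hγ2 : HasDerivAt (fun s => (![α, β, deriv (fun s => u (ℓ s)) s] : Fin 3 → ℝ))
      ![0, 0, deriv (deriv (fun s => u (ℓ s))) 0] 0 := by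
    rw [hasDerivAt_pi]
    intro i
    fin_cases i
    · exact hasDerivAt_const _ _
    · exact hasDerivAt_const _ _
    · exact d2
  obtain ⟨e1, e2⟩ := deriv_deriv_eq hγ1 hγ2
  refine ⟨?_, ?_, ?_⟩
  · rw [contDiffAt_pi]
    intro i
    fin_cases i
    · exact hℓ.fst.contDiffAt
    · exact hℓ.snd.contDiffAt
    · exact hw
  · rw [e1, c1]
    have h3 : ((α, β) : ℝ × ℝ) = α • (1, 0) + β • (0, 1) := by simp
    rw [h3, pd_add_smul]
    rfl
  · rw [e2, c2]
    simp [pd]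

/-- The relations between the second-order jets of two functions whose graphs are mapped to one
another. -/
theorem graph_relation {Φ : (Fin 3 → ℝ) → (Fin 3 → ℝ)} {v : Fin 3 → ℝ} {u u' : ℝ × ℝ → ℝ}
    (hΦ : ContDiffAt ℝ ∞ Φ v) (hu : ContDiffAt ℝ ∞ u (v 0, v 1)) (huv : u (v 0, v 1) = v 2)
    (hu' : ContDiffAt ℝ ∞ u' (Φ v 0, Φ v 1))
    (heq : ∀ᶠ z : ℝ × ℝ in 𝓝 (v 0, v 1),
        u' (Φ ![z.1, z.2, u z] 0, Φ ![z.1, z.2, u z] 1) = Φ ![z.1, z.2, u z] 2)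
    (α β : ℝ) {ν : Fin 3 → ℝ}
    (hν : ν = graphVec (pd u (1, 0) (v 0, v 1)) (pd u (0, 1) (v 0, v 1)) α β) {q : ℝ}
    (hq : q = pd (pd u (α, β)) (α, β) (v 0, v 1)) {w : ℝ × ℝ}
    (hw : w = (pd (fun y => Φ y 0) ν v, pd (fun y => Φ y 1) ν v)) :
    u' (Φ v 0, Φ v 1) = Φ v 2 ∧
    pd u' (1, 0) (Φ v 0, Φ v 1) * pd (fun y => Φ y 0) ν v +
      pd u' (0, 1) (Φ v 0, Φ v 1) * pd (fun y => Φ y 1) ν v = pd (fun y => Φ y 2) ν v ∧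
    pd (pd u' w) w (Φ v 0, Φ v 1) +
      pd u' (1, 0) (Φ v 0, Φ v 1) * (pd (pd (fun y => Φ y 0) ν) ν v +
        q * pd (fun y => Φ y 0) (Pi.single 2 1) v) +
      pd u' (0, 1) (Φ v 0, Φ v 1) * (pd (pd (fun y => Φ y 1) ν) ν v +
        q * pd (fun y => Φ y 1) (Pi.single 2 1) v) =
      pd (pd (fun y => Φ y 2) ν) ν v + q * pd (fun y => Φ y 2) (Pi.single 2 1) v := by
  obtain ⟨hγ, hγ1, hγ2⟩ := graph_curve hu α β
  rw [← hν] at hγ1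
  rw [← hq] at hγ2
  set γ : ℝ → Fin 3 → ℝ :=
    fun s => ![v 0 + s * α, v 1 + s * β, u (v 0 + s * α, v 1 + s * β)] with hγdef
  have hγ0 : γ 0 = v := by
    ext i; fin_cases i <;> simp [γ, huv]
  have hΦi : ∀ i, ContDiffAt ℝ ∞ (fun y => Φ y i) (γ 0) := by
    rw [hγ0]; exact contDiffAt_pi.1 hΦ
  have hc : ∀ i, deriv (fun s => Φ (γ s) i) 0 = pd (fun y => Φ y i) ν v ∧
      deriv (deriv (fun s => Φ (γ s) i)) 0 = pd (pd (fun y => Φ y i) ν) ν v +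
        q * pd (fun y => Φ y i) (Pi.single 2 1) v := by
    intro i
    have := deriv_deriv_comp (hΦi i) hγ
    rw [hγ1, hγ2, hγ0, pd_vec_three _ 0 0 q] at this
    simpa using this
  have hs : ∀ i, ContDiffAt ℝ ∞ (fun s => Φ (γ s) i) 0 := fun i => (hΦi i).comp 0 hγ
  let τ : ℝ → ℝ × ℝ := fun s => (Φ (γ s) 0, Φ (γ s) 1)
  have hτ : ContDiffAt ℝ ∞ τ 0 := (hs 0).prodMk (hs 1)
  have hτ0 : τ 0 = (Φ v 0, Φ v 1) := by simp [τ, hγ0]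
  obtain ⟨hτ1, hτ2⟩ := deriv_deriv_eq (γ := τ)
    (by filter_upwards [(hasDerivAt_deriv (hs 0)).1, (hasDerivAt_deriv (hs 1)).1] with s h0 h1
        exact h0.prodMk h1)
    ((hasDerivAt_deriv (hs 0)).2.prodMk (hasDerivAt_deriv (hs 1)).2)
  obtain ⟨d1, d2⟩ := deriv_deriv_comp (G := u') (γ := τ) (by rw [hτ0]; exact hu') hτ
  have hpd : ∀ (g : ℝ × ℝ → ℝ) (x y : ℝ) (z : ℝ × ℝ),
      pd g (x, y) z = x * pd g (1, 0) z + y * pd g (0, 1) z := by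
    intro g x y z
    rw [← pd_add_smul]; simp
  -- The image curve lies in the graph of `u'`. This identity holds near 0, so it may be
  -- differentiated twice, which gives the two remaining relations.
  have hcomp : (fun s => u' (τ s)) =ᶠ[𝓝 0] fun s => Φ (γ s) 2 := by
    have hl : ContinuousAt (fun s : ℝ => (v 0 + s * α, v 1 + s * β)) 0 := by fun_prop
    have := hl.eventually (p := fun z : ℝ × ℝ =>
      u' (Φ ![z.1, z.2, u z] 0, Φ ![z.1, z.2, u z] 1) = Φ ![z.1, z.2, u z] 2) (by simpa using heq)
    filter_upwards [this] with s hs using hs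
  have hw' : deriv τ 0 = w := by rw [hτ1, hw, (hc 0).1, (hc 1).1]
  refine ⟨?_, ?_, ?_⟩
  · have := hcomp.self_of_nhds
    simpa [hτ0, hγ0] using this
  · rw [hcomp.deriv_eq, hw', hτ0, hw, hpd, (hc 2).1] at d1
    linarith
  · rw [hcomp.deriv.deriv_eq, hw', hτ0, hτ2, hpd u', (hc 2).2, (hc 0).2, (hc 1).2] at d2
    linarith

/-- The partial derivative of the `i`-th component of `Φ` with respect to the `j`-th variable. -/
noncomputable def pj {ι ι' : Type*} [Fintype ι] [DecidableEq ι] (Φ : (ι → ℝ) → (ι' → ℝ)) (i : ι')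
    (j : ι) : (ι → ℝ) → ℝ :=
  pd (fun y => Φ y i) (Pi.single j 1)

theorem pd_graphVec (Φ : (Fin 3 → ℝ) → (Fin 3 → ℝ)) (i : Fin 3) (a b α β : ℝ) (v : Fin 3 → ℝ) :
    pd (fun y => Φ y i) (graphVec a b α β) v =
      α * (pj Φ i 0 v + a * pj Φ i 2 v) + β * (pj Φ i 1 v + b * pj Φ i 2 v) := by
  rw [graphVec, pd_vec_three]
  simp only [pj]
  ring

/-- The quadratic polynomial over the point `v` with the first-order derivatives `a`, `b` and the
second-order derivatives `c`, `0`, `e`. -/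
noncomputable def quadJet (v : Fin 3 → ℝ) (a b c e : ℝ) (z : ℝ × ℝ) : ℝ :=
  v 2 + a * (z.1 - v 0) + b * (z.2 - v 1) + c / 2 * (z.1 - v 0) ^ 2 + e / 2 * (z.2 - v 1) ^ 2

theorem contDiff_quadJet (v : Fin 3 → ℝ) (a b c e : ℝ) : ContDiff ℝ ∞ (quadJet v a b c e) := by
  unfold quadJet; fun_prop

theorem pd_quadJet (v : Fin 3 → ℝ) (a b c e α β : ℝ) :
    pd (quadJet v a b c e) (α, β) =
      fun z => α * (a + c * (z.1 - v 0)) + β * (b + e * (z.2 - v 1)) := by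
  funext z
  refine pd_eq_of_hasDerivAt (contDiff_quadJet v a b c e).contDiffAt ?_
  have h1 : HasDerivAt (fun s : ℝ => z.1 + s * α - v 0) α 0 := by
    simpa using (((hasDerivAt_id (0 : ℝ)).mul_const α).const_add z.1).sub_const (v 0)
  have h2 : HasDerivAt (fun s : ℝ => z.2 + s * β - v 1) β 0 := by
    simpa using (((hasDerivAt_id (0 : ℝ)).mul_const β).const_add z.2).sub_const (v 1)
  have := ((((h1.const_mul a).const_add (v 2)).add (h2.const_mul b)).add
    ((h1.pow 2).const_mul (c / 2))).add ((h2.pow 2).const_mul (e / 2))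
  refine this.congr_deriv ?_
  simp
  ring

theorem pd_pd_quadJet (v : Fin 3 → ℝ) (a b c e α β : ℝ) (z : ℝ × ℝ) :
    pd (pd (quadJet v a b c e) (α, β)) (α, β) z = c * α ^ 2 + e * β ^ 2 := by
  rw [pd_quadJet]
  refine pd_eq_of_hasDerivAt (ContDiff.contDiffAt (by fun_prop)) ?_
  have h1 : HasDerivAt (fun s : ℝ => z.1 + s * α - v 0) α 0 := by
    simpa using (((hasDerivAt_id (0 : ℝ)).mul_const α).const_add z.1).sub_const (v 0)
  have h2 : HasDerivAt (fun s : ℝ => z.2 + s * β - v 1) β 0 := by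
    simpa using (((hasDerivAt_id (0 : ℝ)).mul_const β).const_add z.2).sub_const (v 1)
  have := (((h1.const_mul c).const_add a).const_mul α).add
    (((h2.const_mul e).const_add b).const_mul β)
  refine this.congr_deriv ?_
  ring

/-- The condition which a transformation between two equations imposes on second-order jets. -/
theorem Transforms.jet_condition {Φ : (Fin 3 → ℝ) → (Fin 3 → ℝ)} {D : Set (Fin 3 → ℝ)}
    {θ θ' : Equation} (h : Transforms Φ D θ θ') (hD : IsOpen D) {v : Fin 3 → ℝ} (hv : v ∈ D)
    (a b c e : ℝ)
    (hJ : (pj Φ 0 0 v + a * pj Φ 0 2 v) * (pj Φ 1 1 v + b * pj Φ 1 2 v) -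
      (pj Φ 0 1 v + b * pj Φ 0 2 v) * (pj Φ 1 0 v + a * pj Φ 1 2 v) ≠ 0) :
    ∃ P Q S : ℝ,
      P * (pj Φ 0 0 v + a * pj Φ 0 2 v) + Q * (pj Φ 1 0 v + a * pj Φ 1 2 v) =
        pj Φ 2 0 v + a * pj Φ 2 2 v ∧
      P * (pj Φ 0 1 v + b * pj Φ 0 2 v) + Q * (pj Φ 1 1 v + b * pj Φ 1 2 v) =
        pj Φ 2 1 v + b * pj Φ 2 2 v ∧
      (∀ α β : ℝ,
        α * (pj Φ 0 0 v + a * pj Φ 0 2 v) + β * (pj Φ 0 1 v + b * pj Φ 0 2 v) = 0 →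
        α * (pj Φ 1 0 v + a * pj Φ 1 2 v) + β * (pj Φ 1 1 v + b * pj Φ 1 2 v) = 1 →
        S + P * (pd (pd (fun y => Φ y 0) (graphVec a b α β)) (graphVec a b α β) v +
            (c * α ^ 2 + e * β ^ 2) * pj Φ 0 2 v) +
          Q * (pd (pd (fun y => Φ y 1) (graphVec a b α β)) (graphVec a b α β) v +
            (c * α ^ 2 + e * β ^ 2) * pj Φ 1 2 v) =
          pd (pd (fun y => Φ y 2) (graphVec a b α β)) (graphVec a b α β) v +
            (c * α ^ 2 + e * β ^ 2) * pj Φ 2 2 v) ∧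
      (θ.f (v 1) * a = Real.exp (θ.n * v 2) * (e + θ.n * b ^ 2) +
          θ.h (v 1) * Real.exp (θ.m * v 2) ↔
        θ'.f (Φ v 1) * P = Real.exp (θ'.n * Φ v 2) * (S + θ'.n * Q ^ 2) +
          θ'.h (Φ v 1) * Real.exp (θ'.m * Φ v 2)) := by
  have hΦ : ContDiffAt ℝ ∞ Φ v := h.1.contDiffAt (hD.mem_nhds hv)
  set u := quadJet v a b c e with hu_def
  have hu : ContDiff ℝ ∞ u := contDiff_quadJet v a b c e
  have huv : u (v 0, v 1) = v 2 := by simp [u, quadJet]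
  have hua : pd u (1, 0) (v 0, v 1) = a := by simp [u, pd_quadJet]
  have hub : pd u (0, 1) (v 0, v 1) = b := by simp [u, pd_quadJet]
  let gr : (Fin 2 → ℝ) → (Fin 3 → ℝ) := fun z => ![z 0, z 1, u (z 0, z 1)]
  have hgr : ContDiff ℝ ∞ gr := by
    rw [contDiff_pi]
    intro i
    fin_cases i <;> simp [gr] <;> fun_prop
  let z₀ : Fin 2 → ℝ := ![v 0, v 1]
  have hgr0 : gr z₀ = v := by
    ext i; fin_cases i <;> simp [gr, z₀, huv]
  let ψ : (Fin 2 → ℝ) → (Fin 2 → ℝ) := fun z => ![Φ (gr z) 0, Φ (gr z) 1]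
  have hΦgr : ∀ i, ContDiffAt ℝ ∞ (fun z => Φ (gr z) i) z₀ := fun i =>
    ContDiffAt.comp z₀ (g := fun y => Φ y i) (by rw [hgr0]; exact contDiffAt_pi.1 hΦ i)
      hgr.contDiffAt
  have hψ : ContDiffAt ℝ ∞ ψ z₀ := by
    rw [contDiffAt_pi]
    intro i
    fin_cases i
    · exact hΦgr 0
    · exact hΦgr 1
  have hψ0 : ψ z₀ = ![Φ v 0, Φ v 1] := by simp [ψ, hgr0]
  have hpd : ∀ (i : Fin 3) (x y : ℝ), pd (fun z => Φ (gr z) i) ![x, y] z₀ =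
      x * (pj Φ i 0 v + a * pj Φ i 2 v) + y * (pj Φ i 1 v + b * pj Φ i 2 v) := by
    intro i x y
    obtain ⟨g1, g2, -⟩ := graph_curve (v := v) hu.contDiffAt x y
    rw [hua, hub] at g2
    have hγ0 : (![v 0 + 0 * x, v 1 + 0 * y, u (v 0 + 0 * x, v 1 + 0 * y)] : Fin 3 → ℝ) = v := by
      ext i; fin_cases i <;> simp [huv]
    have h1 := (deriv_deriv_comp (G := fun y => Φ y i) (by
      simp only [hγ0]; exact contDiffAt_pi.1 hΦ i) g1).1
    rw [g2, hγ0, pd_graphVec] at h1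
    rw [← h1]
    refine pd_eq_of_hasDerivAt (hΦgr i) ?_
    have h2 : (fun s : ℝ => Φ (gr (z₀ + s • ![x, y])) i) = fun s : ℝ =>
        Φ ![v 0 + s * x, v 1 + s * y, u (v 0 + s * x, v 1 + s * y)] i := by
      funext s
      simp [gr, z₀]
    rw [h2, hasDerivAt_deriv_iff]
    have h3 : ContDiffAt ℝ ∞ (fun s : ℝ =>
        Φ ![v 0 + s * x, v 1 + s * y, u (v 0 + s * x, v 1 + s * y)] i) 0 :=
      ContDiffAt.comp (0 : ℝ) (g := fun y => Φ y i)
        (by simp only [hγ0]; exact contDiffAt_pi.1 hΦ i) g1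
    exact h3.differentiableAt (by simp)
  have hdet : (fderiv ℝ ψ z₀).det ≠ 0 := by
    rw [det_fderiv_two (hψ.differentiableAt (by simp)), Matrix.det_fin_two]
    have s0 : (Pi.single 0 1 : Fin 2 → ℝ) = ![1, 0] := by ext i; fin_cases i <;> simp
    have s1 : (Pi.single 1 1 : Fin 2 → ℝ) = ![0, 1] := by ext i; fin_cases i <;> simp
    have e0 : ∀ w, pd (fun z => ψ z 0) w z₀ = pd (fun z => Φ (gr z) 0) w z₀ := fun w => rfl
    have e1 : ∀ w, pd (fun z => ψ z 1) w z₀ = pd (fun z => Φ (gr z) 1) w z₀ := fun w => rfl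
    simp only [Matrix.of_apply, s0, s1, e0, e1, hpd]
    convert hJ using 1
    ring
  -- Since the total Jacobian of (T, X) along the graph is nonzero, the inverse function theorem
  -- makes the image of the graph locally the graph of a function `u'`.
  let ψ' := (fderiv ℝ ψ z₀).toContinuousLinearEquivOfDetNeZero hdet
  have hψ' : HasFDerivAt ψ (ψ' : (Fin 2 → ℝ) →L[ℝ] (Fin 2 → ℝ)) z₀ := by
    rw [ContinuousLinearMap.coe_toContinuousLinearEquivOfDetNeZero]
    exact (hψ.differentiableAt (by simp)).hasFDerivAt
  let κ := hψ.localInverse hψ' (by simp)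
  have hκ : ContDiffAt ℝ ∞ κ (ψ z₀) := hψ.to_localInverse hψ' (by simp)
  have hκl : ∀ᶠ z in 𝓝 z₀, κ (ψ z) = z :=
    (hψ.hasStrictFDerivAt' hψ' (by simp)).eventually_left_inverse
  let u' : ℝ × ℝ → ℝ := fun y => Φ (gr (κ ![y.1, y.2])) 2
  have hvec : ContDiff ℝ ∞ (fun y : ℝ × ℝ => (![y.1, y.2] : Fin 2 → ℝ)) := by
    rw [contDiff_pi]
    intro i
    fin_cases i <;> simp <;> fun_prop
  have hu' : ContDiffAt ℝ ∞ u' (Φ v 0, Φ v 1) := by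
    have h1 : ContDiffAt ℝ ∞ (fun y : ℝ × ℝ => κ ![y.1, y.2]) (Φ v 0, Φ v 1) :=
      ContDiffAt.comp (Φ v 0, Φ v 1) (g := κ) (by rw [hψ0] at hκ; exact hκ) hvec.contDiffAt
    have h2 : κ ![Φ v 0, Φ v 1] = z₀ := by rw [← hψ0]; exact hκl.self_of_nhds
    exact ContDiffAt.comp (Φ v 0, Φ v 1) (g := fun z => Φ (gr z) 2)
      (by simpa [h2] using hΦgr 2) h1
  have heq : ∀ᶠ z : ℝ × ℝ in 𝓝 (v 0, v 1),
      u' (Φ ![z.1, z.2, u z] 0, Φ ![z.1, z.2, u z] 1) = Φ ![z.1, z.2, u z] 2 := by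
    have h1 := (hvec.continuous.continuousAt (x := (v 0, v 1))).eventually hκl
    filter_upwards [h1] with z hz
    have h2 : ψ ![z.1, z.2] = ![Φ ![z.1, z.2, u z] 0, Φ ![z.1, z.2, u z] 1] := by
      simp [ψ, gr]
    rw [h2] at hz
    simp only [u', hz]
    simp [gr]
  have hrel := fun α β => graph_relation hΦ hu.contDiffAt huv hu' heq α β rfl
    (pd_pd_quadJet v a b c e α β (v 0, v 1)).symm rfl
  simp only [hua, hub] at hrel
  have hval := (hrel 0 0).1
  refine ⟨pd u' (1, 0) (Φ v 0, Φ v 1), pd u' (0, 1) (Φ v 0, Φ v 1),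
    pd (pd u' (0, 1)) (0, 1) (Φ v 0, Φ v 1), ?_, ?_, ?_, ?_⟩
  · have := (hrel 1 0).2.1
    simpa [pd_graphVec] using this
  · have := (hrel 0 1).2.1
    simpa [pd_graphVec] using this
  -- When (α, β) is sent to (0, 1) by the derivative of (T, X) along the graph, the Hessian term is
  -- exactly the second x-derivative `S` of `u'`.
  · intro α β h0 h1
    have := (hrel α β).2.2
    have hw : (pd (fun y => Φ y 0) (graphVec a b α β) v,
        pd (fun y => Φ y 1) (graphVec a b α β) v) = ((0, 1) : ℝ × ℝ) := by
      rw [pd_graphVec, pd_graphVec, h0, h1]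
    rw [hw] at this
    exact this
  · have := (h.2 v hv).2 u u' hu.contDiffAt huv hu' hdet heq
    rw [θ.holdsAt_iff hu.contDiffAt, θ'.holdsAt_iff hu', hua, hub, huv, hval] at this
    have hxx : pd (pd u (0, 1)) (0, 1) (v 0, v 1) = e := by
      rw [pd_pd_quadJet]; ring
    rwa [hxx] at this

/-! ### Determining equations for one equation and its image -/

theorem Transforms.det_ne_zero {Φ : (Fin 3 → ℝ) → (Fin 3 → ℝ)} {D : Set (Fin 3 → ℝ)}
    {θ θ' : Equation} (h : Transforms Φ D θ θ') (hD : IsOpen D) {v : Fin 3 → ℝ} (hv : v ∈ D) :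
    pj Φ 0 0 v * pj Φ 1 1 v * pj Φ 2 2 v - pj Φ 0 0 v * pj Φ 1 2 v * pj Φ 2 1 v
      - pj Φ 0 1 v * pj Φ 1 0 v * pj Φ 2 2 v + pj Φ 0 1 v * pj Φ 1 2 v * pj Φ 2 0 v
      + pj Φ 0 2 v * pj Φ 1 0 v * pj Φ 2 1 v - pj Φ 0 2 v * pj Φ 1 1 v * pj Φ 2 0 v ≠ 0 := by
  have h1 := (h.2 v hv).1
  rw [det_fderiv_three ((h.1.contDiffAt (hD.mem_nhds hv)).differentiableAt (by simp)),
    Matrix.det_fin_three] at h1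
  exact h1

/-- As e^{nu} ≠ 0, the equation can be solved for u_xx: any u_t = a and u_x = b extend to a jet on
the equation, and u_tt remains free. -/
theorem Equation.exists_jet (θ : Equation) (v : Fin 3 → ℝ) (a b : ℝ) :
    θ.f (v 1) * a = Real.exp (θ.n * v 2) *
      ((Real.exp (-(θ.n * v 2)) * (θ.f (v 1) * a - θ.h (v 1) * Real.exp (θ.m * v 2)) -
        θ.n * b ^ 2) + θ.n * b ^ 2) + θ.h (v 1) * Real.exp (θ.m * v 2) := by
  have : Real.exp (θ.n * v 2) * Real.exp (-(θ.n * v 2)) = 1 := by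
    rw [← Real.exp_add]; simp
  linear_combination (-(θ.f (v 1) * a - θ.h (v 1) * Real.exp (θ.m * v 2))) * this

/-- The time component of a transformation between two equations only depends on time. -/
theorem Transforms.time {Φ : (Fin 3 → ℝ) → (Fin 3 → ℝ)} {D : Set (Fin 3 → ℝ)}
    {θ θ' : Equation} (h : Transforms Φ D θ θ') (hD : IsOpen D) {v : Fin 3 → ℝ} (hv : v ∈ D) :
    pj Φ 0 1 v = 0 ∧ pj Φ 0 2 v = 0 := by
  have hdet := h.det_ne_zero hD hv
  have key : ∀ a b : ℝ, (pj Φ 0 0 v + a * pj Φ 0 2 v) * (pj Φ 1 1 v + b * pj Φ 1 2 v) -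
      (pj Φ 0 1 v + b * pj Φ 0 2 v) * (pj Φ 1 0 v + a * pj Φ 1 2 v) ≠ 0 →
      pj Φ 0 1 v + b * pj Φ 0 2 v = 0 := by
    intro a b hJ
    have hjet := θ.exists_jet v a b
    set e := Real.exp (-(θ.n * v 2)) * (θ.f (v 1) * a - θ.h (v 1) * Real.exp (θ.m * v 2)) -
        θ.n * b ^ 2
    -- Two jets on θ that differ only in u_tt, with the values 0 and 1. Their images have the same
    -- first-order derivatives, and then θ' forces the same second x-derivative.
    obtain ⟨P, Q, S, hP, hQ, hS, hiff⟩ := h.jet_condition hD hv a b 0 e hJ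
    obtain ⟨P', Q', S', hP', hQ', hS', hiff'⟩ := h.jet_condition hD hv a b 1 e hJ
    have hj := hiff.1 hjet
    have hj' := hiff'.1 hjet
    generalize pj Φ 0 0 v = Tt at *
    generalize pj Φ 0 1 v = Tx at *
    generalize pj Φ 0 2 v = Tu at *
    generalize pj Φ 1 0 v = Xt at *
    generalize pj Φ 1 1 v = Xx at *
    generalize pj Φ 1 2 v = Xu at *
    generalize pj Φ 2 0 v = Ut at *
    generalize pj Φ 2 1 v = Ux at *
    generalize pj Φ 2 2 v = Uu at *
    have eP : P = P' := by
      apply mul_left_cancel₀ hJ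
      linear_combination (Xx + b * Xu) * (hP - hP') - (Xt + a * Xu) * (hQ - hQ')
    have eQ : Q = Q' := by
      apply mul_left_cancel₀ hJ
      linear_combination (Tt + a * Tu) * (hQ - hQ') - (Tx + b * Tu) * (hP - hP')
    subst eP eQ
    have eS : S = S' := by
      have := Real.exp_ne_zero (θ'.n * Φ v 2)
      apply mul_left_cancel₀ this
      linear_combination hj' - hj
    subst eS
    set J := (Tt + a * Tu) * (Xx + b * Xu) - (Tx + b * Tu) * (Xt + a * Xu) with hJdef
    -- By row and column operations, this quantity times J is the Jacobian determinant of the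
    -- transformation.
    have hK : Uu - P * Tu - Q * Xu ≠ 0 := by
      intro hK
      apply hdet
      linear_combination (-(Tx * Xu - Tu * Xx)) * hP + (Tt * Xu - Tu * Xt) * hQ + J * hK
    -- By Cramer's rule, the direction sent to (0, 1) has the t-component α = -(T_x + b T_u)/J. The
    -- change of u_tt contributes its square times the nonzero factor of `hK`, so α must vanish.
    by_contra hne
    set α := -(Tx + b * Tu) / J with hα
    have e1 : α * (Tt + a * Tu) + (Tt + a * Tu) / J * (Tx + b * Tu) = 0 := by
      rw [hα]; field_simp; ring
    have e2 : α * (Xt + a * Xu) + (Tt + a * Tu) / J * (Xx + b * Xu) = 1 := by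
      rw [hα]; field_simp; rw [hJdef]; ring
    have s1 := hS _ _ e1 e2
    have s2 := hS' _ _ e1 e2
    have : (Uu - P * Tu - Q * Xu) * α ^ 2 = 0 := by linear_combination s1 - s2
    rcases mul_eq_zero.1 this with h0 | h0
    · exact hK h0
    · rw [hα] at h0
      simp [hJ] at h0
      exact hne (by linarith)
  generalize pj Φ 0 0 v = Tt at *
  generalize pj Φ 0 1 v = Tx at *
  generalize pj Φ 0 2 v = Tu at *
  generalize pj Φ 1 0 v = Xt at *
  generalize pj Φ 1 1 v = Xx at *
  generalize pj Φ 1 2 v = Xu at *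
  have concl : ∀ b b' : ℝ, b ≠ b' → Tx + b * Tu = 0 → Tx + b' * Tu = 0 → Tx = 0 ∧ Tu = 0 := by
    intro b b' hb h1 h2
    have hTu : Tu = 0 := by
      apply mul_left_cancel₀ (sub_ne_zero.2 hb)
      linear_combination h1 - h2
    refine ⟨?_, hTu⟩
    rw [hTu] at h1; linarith
  -- The term ab cancels in J, which is affine in a and b. If its b-coefficient vanishes, some a
  -- makes J ≠ 0 for all b, since otherwise all 2×2 minors of the rows of T and X would vanish. If
  -- not, take a = 0 and solve J = 1 and J = 2 for b. Two values of b suffice.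
  by_cases m2 : Tt * Xu - Xt * Tu = 0
  · obtain ⟨a, ha⟩ : ∃ a : ℝ, (Tt * Xx - Xt * Tx) + a * (Tu * Xx - Xu * Tx) ≠ 0 := by
      by_contra! hc
      have h0 := hc 0
      have h1 := hc 1
      simp only [zero_mul, add_zero, one_mul] at h0 h1
      rw [h0, zero_add] at h1
      apply hdet
      linear_combination pj Φ 2 2 v * h0 - pj Φ 2 1 v * m2 - pj Φ 2 0 v * h1
    have hb : ∀ b : ℝ, Tx + b * Tu = 0 := fun b => key a b (by
      intro h0; apply ha; linear_combination h0 - b * m2)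
    exact concl 0 1 (by norm_num) (hb 0) (hb 1)
  · set m0 := Tt * Xx - Xt * Tx
    set m := Tt * Xu - Xt * Tu
    have hb : ∀ y : ℝ, y ≠ 0 → Tx + (y - m0) / m * Tu = 0 := by
      intro y hy
      apply key 0
      intro h0
      apply hy
      have : m0 + (y - m0) / m * m = 0 := by linear_combination h0
      rw [div_mul_cancel₀ _ m2] at this
      linarith
    refine concl _ _ ?_ (hb 1 one_ne_zero) (hb 2 two_ne_zero)
    intro h0
    rw [div_left_inj' m2] at h0
    linarith

/-- The basic relation between the coefficients at the time derivatives. -/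
theorem Transforms.leading {Φ : (Fin 3 → ℝ) → (Fin 3 → ℝ)} {D : Set (Fin 3 → ℝ)}
    {θ θ' : Equation} (h : Transforms Φ D θ θ') (hD : IsOpen D) (hDI : ∀ v ∈ D, v 1 ∈ θ.I)
    {v : Fin 3 → ℝ} (hv : v ∈ D) :
    pj Φ 0 0 v ≠ 0 ∧ pj Φ 1 1 v ≠ 0 ∧ pj Φ 1 2 v = 0 ∧
      θ'.f (Φ v 1) * pj Φ 1 1 v ^ 2 = pj Φ 0 0 v * θ.f (v 1) *
        (Real.exp (θ'.n * Φ v 2) * Real.exp (-(θ.n * v 2))) := by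
  have hdet := h.det_ne_zero hD hv
  obtain ⟨hTx, hTu⟩ := h.time hD hv
  have hf := θ.f_ne _ (hDI v hv)
  rw [hTx, hTu] at hdet
  have hTt : pj Φ 0 0 v ≠ 0 := by
    intro h0; apply hdet; rw [h0]; ring
  -- Raising u_t from 0 to 1 at fixed u_x = b raises u_xx by f e^{-nu} on θ. Comparing the two image
  -- jets on θ' cancels everything else, in particular h and h̃.
  have key : ∀ b : ℝ, pj Φ 1 1 v + b * pj Φ 1 2 v ≠ 0 →
      θ'.f (Φ v 1) * (pj Φ 1 1 v + b * pj Φ 1 2 v) ^ 2 = pj Φ 0 0 v * θ.f (v 1) *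
        (Real.exp (θ'.n * Φ v 2) * Real.exp (-(θ.n * v 2))) := by
    intro b hb
    have hj0 := θ.exists_jet v 0 b
    have hj1 := θ.exists_jet v 1 b
    set e0 := Real.exp (-(θ.n * v 2)) * (θ.f (v 1) * 0 - θ.h (v 1) * Real.exp (θ.m * v 2)) -
        θ.n * b ^ 2 with he0
    set e1 := Real.exp (-(θ.n * v 2)) * (θ.f (v 1) * 1 - θ.h (v 1) * Real.exp (θ.m * v 2)) -
        θ.n * b ^ 2 with he1
    have he : e1 = e0 + θ.f (v 1) * Real.exp (-(θ.n * v 2)) := by rw [he0, he1]; ring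
    obtain ⟨P, Q, S, hP, hQ, hS, hiff⟩ := h.jet_condition hD hv 0 b 0 e0
      (by simp [hTx, hTu, hTt, hb])
    obtain ⟨P', Q', S', hP', hQ', hS', hiff'⟩ := h.jet_condition hD hv 1 b 0 e1
      (by simp [hTx, hTu, hTt, hb])
    have hj := hiff.1 hj0
    have hj' := hiff'.1 hj1
    have s1 := hS 0 (1 / (pj Φ 1 1 v + b * pj Φ 1 2 v)) (by simp [hTx, hTu])
      (by rw [zero_mul, zero_add, one_div_mul_cancel hb])
    have s2 := hS' 0 (1 / (pj Φ 1 1 v + b * pj Φ 1 2 v)) (by simp [hTx, hTu])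
      (by rw [zero_mul, zero_add, one_div_mul_cancel hb])
    -- Since T_x = T_u = 0, the direction sent to (0, 1) has no t-component. Second derivatives
    -- along it do not see u_t.
    have hg : graphVec 1 b 0 (1 / (pj Φ 1 1 v + b * pj Φ 1 2 v)) =
      graphVec 0 b 0 (1 / (pj Φ 1 1 v + b * pj Φ 1 2 v)) := by simp [graphVec]
    rw [hg] at s2
    rw [hTx, hTu] at *
    have hT0 : pd (pd (fun y => Φ y 0) (graphVec 0 b 0 (1 / (pj Φ 1 1 v + b * pj Φ 1 2 v))))
        (graphVec 0 b 0 (1 / (pj Φ 1 1 v + b * pj Φ 1 2 v))) v = 0 := by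
      refine pd_eq_zero_of_const hD (c := 0) ?_ _ v hv
      intro y hy
      rw [pd_graphVec, (h.time hD hy).1, (h.time hD hy).2]; ring
    rw [hT0] at s1 s2
    generalize pd (pd (fun y => Φ y 1) (graphVec 0 b 0 (1 / (pj Φ 1 1 v + b * pj Φ 1 2 v))))
        (graphVec 0 b 0 (1 / (pj Φ 1 1 v + b * pj Φ 1 2 v))) v = X2 at *
    generalize pd (pd (fun y => Φ y 2) (graphVec 0 b 0 (1 / (pj Φ 1 1 v + b * pj Φ 1 2 v))))
        (graphVec 0 b 0 (1 / (pj Φ 1 1 v + b * pj Φ 1 2 v))) v = U2 at *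
    generalize pj Φ 0 0 v = Tt at *
    generalize pj Φ 1 0 v = Xt at *
    generalize pj Φ 1 2 v = Xu at *
    generalize pj Φ 2 0 v = Ut at *
    generalize pj Φ 2 1 v = Ux at *
    generalize pj Φ 2 2 v = Uu at *
    generalize hY : pj Φ 1 1 v + b * Xu = Y at *
    have eQ : Q = Q' := by
      apply mul_right_cancel₀ hb
      linear_combination hQ - hQ'
    subst eQ
    have hK : Uu - Q * Xu ≠ 0 := by
      intro hK
      apply hdet
      linear_combination Tt * Y * hK + Tt * Uu * hY + Tt * Xu * hQ
    have dP : (P' - P) * Tt = Uu - Q * Xu := by linear_combination hP' - hP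
    have dS : S' - S = (Uu - Q * Xu) * (θ.f (v 1) * Real.exp (-(θ.n * v 2))) * (1 / Y) ^ 2 := by
      rw [he] at s2
      linear_combination s2 - s1
    have dS' : (S' - S) * Y ^ 2 = (Uu - Q * Xu) * (θ.f (v 1) * Real.exp (-(θ.n * v 2))) := by
      rw [dS]; field_simp
    apply mul_left_cancel₀ hK
    linear_combination (-θ'.f (Φ v 1) * Y ^ 2) * dP + Tt * Y ^ 2 * (hj' - hj) +
      Tt * Real.exp (θ'.n * Φ v 2) * dS'
  -- If X_u ≠ 0, then X_x + b X_u attains the values 1 and 2, while the right-hand side of `key`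
  -- does not depend on b and is nonzero.
  have hXu : pj Φ 1 2 v = 0 := by
    by_contra hne
    have hk : ∀ y : ℝ, y ≠ 0 → θ'.f (Φ v 1) * y ^ 2 = pj Φ 0 0 v * θ.f (v 1) *
        (Real.exp (θ'.n * Φ v 2) * Real.exp (-(θ.n * v 2))) := by
      intro y hy
      have hy' : pj Φ 1 1 v + (y - pj Φ 1 1 v) / pj Φ 1 2 v * pj Φ 1 2 v = y := by
        rw [div_mul_cancel₀ _ hne]; ring
      have := key ((y - pj Φ 1 1 v) / pj Φ 1 2 v) (by rwa [hy'])
      rwa [hy'] at this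
    have h1 := hk 1 one_ne_zero
    have h2 := hk 2 two_ne_zero
    have h3 : pj Φ 0 0 v * θ.f (v 1) *
        (Real.exp (θ'.n * Φ v 2) * Real.exp (-(θ.n * v 2))) = 0 := by
      linear_combination (1 / 3 : ℝ) * h2 - (4 / 3 : ℝ) * h1
    have := Real.exp_ne_zero (θ'.n * Φ v 2)
    have := Real.exp_ne_zero (-(θ.n * v 2))
    simp_all
  have hXx : pj Φ 1 1 v ≠ 0 := by
    intro h0; apply hdet; rw [h0, hXu]; ring
  refine ⟨hTt, hXx, hXu, ?_⟩
  have := key 0 (by simpa using hXx)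
  simpa using this

theorem pd_const_mul_add {E : Type*} [NormedAddCommGroup E] [NormedSpace ℝ E] {g : E → ℝ} {x : E}
    (hg : DifferentiableAt ℝ g x) (a k : ℝ) (e : E) :
    pd (fun y => a * g y + k) e x = a * pd g e x := by
  simp only [pd]
  rw [fderiv_add_const, fderiv_const_mul hg]
  rfl

theorem contDiffOn_pj {ι ι' : Type*} [Fintype ι] [DecidableEq ι] [Fintype ι']
    {Φ : (ι → ℝ) → (ι' → ℝ)} {D : Set (ι → ℝ)} (hD : IsOpen D) (h : ContDiffOn ℝ ∞ Φ D) (i : ι')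
    (j : ι) : ContDiffOn ℝ ∞ (pj Φ i j) D :=
  contDiffOn_pd hD (contDiffOn_pi.1 h i) _

/-- Along the u-direction X, X_x and T_t stay constant, as X_u = T_u = 0, and so do f and f̃. The
leading relation therefore keeps the exponent ñU - nu constant; differentiate it in u. -/
theorem Transforms.pj_potential {Φ : (Fin 3 → ℝ) → (Fin 3 → ℝ)} {D : Set (Fin 3 → ℝ)}
    {θ θ' : Equation} (h : Transforms Φ D θ θ') (hD : IsOpen D) (hDI : ∀ v ∈ D, v 1 ∈ θ.I)
    {v : Fin 3 → ℝ} (hv : v ∈ D) : pj Φ 2 2 v = θ.n / θ'.n := by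
  have hΦ := contDiffOn_pi.1 h.1
  have l1 := eventually_line_eq hD (hΦ 1) (e := Pi.single 2 1) hv (k := 0)
    (fun y hy _ => (h.leading hD hDI hy).2.2.1)
  have l2 := eventually_line_eq hD (contDiffOn_pj hD h.1 1 1) (e := Pi.single 2 1) hv (k := 0)
    (fun y hy _ => pd_pd_eq_zero hD (hΦ 1) (fun z hz => (h.leading hD hDI hz).2.2.1) _ y hy)
  have l3 := eventually_line_eq hD (contDiffOn_pj hD h.1 0 0) (e := Pi.single 2 1) hv (k := 0)
    (fun y hy _ => pd_pd_eq_zero hD (hΦ 0) (fun z hz => (h.time hD hz).2) _ y hy)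
  obtain ⟨hTt, hXx, -, hlead⟩ := h.leading hD hDI hv
  have hf := θ.f_ne _ (hDI v hv)
  have hev : ∀ᶠ s : ℝ in 𝓝 0, θ'.n * Φ (v + s • Pi.single 2 1) 2 = θ'.n * Φ v 2 + θ.n * s := by
    filter_upwards [l1, l2, l3, eventually_line_mem hD hv (Pi.single 2 1)] with s h1 h2 h3 hs
    have hl := (h.leading hD hDI hs).2.2.2
    have e1 : (v + s • (Pi.single 2 1 : Fin 3 → ℝ)) 1 = v 1 := by simp
    have e2 : (v + s • (Pi.single 2 1 : Fin 3 → ℝ)) 2 = v 2 + s := by simp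
    rw [h1, h2, h3, e1, e2] at hl
    simp only [zero_mul, add_zero] at hl
    rw [hlead] at hl
    have := mul_left_cancel₀ (mul_ne_zero hTt hf) hl
    rw [← Real.exp_add, ← Real.exp_add] at this
    have := Real.exp_injective this
    linarith
  have hd1 := (hasDerivAt_line_zero ((hΦ 2).contDiffAt (hD.mem_nhds hv)) (Pi.single 2 1)).const_mul
    θ'.n
  have hd2 : HasDerivAt (fun s : ℝ => θ'.n * Φ v 2 + θ.n * s) θ.n 0 := by
    simpa using ((hasDerivAt_id (0 : ℝ)).const_mul θ.n).const_add (θ'.n * Φ v 2)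
  have := hd1.unique (hd2.congr_of_eventuallyEq hev)
  rw [eq_div_iff θ'.n_ne, ← this, mul_comm]
  rfl

/-- The determining equations at the first powers of the derivative `u_x`. -/
theorem Transforms.determining {Φ : (Fin 3 → ℝ) → (Fin 3 → ℝ)} {D : Set (Fin 3 → ℝ)}
    {θ θ' : Equation} (h : Transforms Φ D θ θ') (hD : IsOpen D) (hDI : ∀ v ∈ D, v 1 ∈ θ.I)
    {v : Fin 3 → ℝ} (hv : v ∈ D) (b : ℝ) :
    θ.f (v 1) * Real.exp (-(θ.n * v 2)) * (pj Φ 2 0 v -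
      (pj Φ 2 1 v + b * (θ.n / θ'.n)) / pj Φ 1 1 v * pj Φ 1 0 v) =
    pd (pj Φ 2 1) (Pi.single 1 1) v + θ.n / θ'.n *
      (Real.exp (-(θ.n * v 2)) * (-(θ.h (v 1) * Real.exp (θ.m * v 2))) - θ.n * b ^ 2) -
      (pj Φ 2 1 v + b * (θ.n / θ'.n)) / pj Φ 1 1 v * pd (pj Φ 1 1) (Pi.single 1 1) v +
      θ'.n * (pj Φ 2 1 v + b * (θ.n / θ'.n)) ^ 2 +
      pj Φ 1 1 v ^ 2 * θ'.h (Φ v 1) *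
        (Real.exp (θ'.m * Φ v 2) * Real.exp (-(θ'.n * Φ v 2))) := by
  have hΦ := contDiffOn_pi.1 h.1
  obtain ⟨hTt, hXx, hXu, hlead⟩ := h.leading hD hDI hv
  obtain ⟨hTx, hTu⟩ := h.time hD hv
  have hUu := h.pj_potential hD hDI hv
  have hj0 := θ.exists_jet v 0 b
  set e0 := Real.exp (-(θ.n * v 2)) * (θ.f (v 1) * 0 - θ.h (v 1) * Real.exp (θ.m * v 2)) -
      θ.n * b ^ 2 with he0
  obtain ⟨P, Q, S, hP, hQ, hS, hiff⟩ := h.jet_condition hD hv 0 b 0 e0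
    (by simp [hTx, hTu, hTt, hXx, hXu])
  have hj := hiff.1 hj0
  have s1 := hS 0 (1 / pj Φ 1 1 v) (by simp [hTx, hTu]) (by simp [hXu, hXx])
  set β := 1 / pj Φ 1 1 v with hβ
  have hβX : β * pj Φ 1 1 v = 1 := by rw [hβ, one_div_mul_cancel hXx]
  have hT0 : pd (pd (fun y => Φ y 0) (graphVec 0 b 0 β)) (graphVec 0 b 0 β) v = 0 := by
    refine pd_eq_zero_of_const hD (c := 0) ?_ _ v hv
    intro y hy
    rw [pd_graphVec, (h.time hD hy).1, (h.time hD hy).2]; ring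
  have hX2 : pd (pd (fun y => Φ y 1) (graphVec 0 b 0 β)) (graphVec 0 b 0 β) v =
      β ^ 2 * pd (pj Φ 1 1) (Pi.single 1 1) v := by
    rw [pd_congr hD (g' := fun y => β * pj Φ 1 1 y + 0) (by
        intro y hy
        rw [pd_graphVec, (h.leading hD hDI hy).2.2.1]; ring) _ v hv,
      pd_const_mul_add (((contDiffOn_pj hD h.1 1 1).contDiffAt (hD.mem_nhds hv)).differentiableAt
        (by simp)), graphVec, pd_vec_three]
    have : pd (pj Φ 1 1) (Pi.single 2 1) v = 0 :=
      pd_pd_eq_zero hD (hΦ 1) (fun z hz => (h.leading hD hDI hz).2.2.1) _ v hv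
    rw [this]; ring
  have hU2 : pd (pd (fun y => Φ y 2) (graphVec 0 b 0 β)) (graphVec 0 b 0 β) v =
      β ^ 2 * pd (pj Φ 2 1) (Pi.single 1 1) v := by
    rw [pd_congr hD (g' := fun y => β * pj Φ 2 1 y + β * b * (θ.n / θ'.n)) (by
        intro y hy
        rw [pd_graphVec, h.pj_potential hD hDI hy]; ring) _ v hv,
      pd_const_mul_add (((contDiffOn_pj hD h.1 2 1).contDiffAt (hD.mem_nhds hv)).differentiableAt
        (by simp)), graphVec, pd_vec_three]
    have : pd (pj Φ 2 1) (Pi.single 2 1) v = 0 := by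
      have := pd_comm ((hΦ 2).contDiffAt (hD.mem_nhds hv)) (Pi.single 1 1) (Pi.single 2 1)
      rw [pj, this]
      exact pd_eq_zero_of_const hD (fun y hy => h.pj_potential hD hDI hy) _ v hv
    rw [this]; ring
  rw [hT0, hX2, hU2, hTu, hXu, hUu] at s1
  rw [hTx, hTu, hXu, hUu] at hQ
  rw [hTu, hXu, hUu] at hP
  have hE : Real.exp (θ'.n * Φ v 2) * Real.exp (-(θ'.n * Φ v 2)) = 1 := by
    rw [← Real.exp_add]; simp
  have hE0 := Real.exp_ne_zero (θ'.n * Φ v 2)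
  -- The derivatives `P`, `Q`, `S` of the image function are now eliminated: `hQ'`, `hS2` and `hPt`
  -- express them through those of Φ, and the leading relation removes f̃ and T_t.
  have hQ' : (pj Φ 2 1 v + b * (θ.n / θ'.n)) / pj Φ 1 1 v = Q := by
    rw [div_eq_iff hXx]; linear_combination -hQ
  rw [hQ']
  have hQ2 : pj Φ 2 1 v + b * (θ.n / θ'.n) = Q * pj Φ 1 1 v := by linear_combination -hQ
  rw [hQ2]
  have hS2 : S * pj Φ 1 1 v ^ 2 = pd (pj Φ 2 1) (Pi.single 1 1) v + θ.n / θ'.n * e0 -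
      Q * pd (pj Φ 1 1) (Pi.single 1 1) v := by
    have : S = β ^ 2 * (pd (pj Φ 2 1) (Pi.single 1 1) v + θ.n / θ'.n * e0 -
      Q * pd (pj Φ 1 1) (Pi.single 1 1) v) := by linear_combination s1
    rw [this]
    linear_combination (pd (pj Φ 2 1) (Pi.single 1 1) v + θ.n / θ'.n * e0 -
      Q * pd (pj Φ 1 1) (Pi.single 1 1) v) * (β * pj Φ 1 1 v + 1) * hβX
  have he0' : e0 = Real.exp (-(θ.n * v 2)) * (-(θ.h (v 1) * Real.exp (θ.m * v 2))) -
    θ.n * b ^ 2 := by rw [he0]; ring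
  rw [← he0']
  have hPt : P * pj Φ 0 0 v = pj Φ 2 0 v - Q * pj Φ 1 0 v := by linear_combination hP
  rw [← hPt]
  apply mul_left_cancel₀ hE0
  linear_combination pj Φ 1 1 v ^ 2 * hj - P * hlead + Real.exp (θ'.n * Φ v 2) * hS2 -
    pj Φ 1 1 v ^ 2 * θ'.h (Φ v 1) * Real.exp (θ'.m * Φ v 2) * hE

/-- The determining equation is polynomial in b = u_x. Its quadratic part cancels, its linear part
gives the first two assertions and its value at b = 0 the third. -/
theorem Transforms.space {Φ : (Fin 3 → ℝ) → (Fin 3 → ℝ)} {D : Set (Fin 3 → ℝ)}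
    {θ θ' : Equation} (h : Transforms Φ D θ θ') (hD : IsOpen D) (hDI : ∀ v ∈ D, v 1 ∈ θ.I)
    {v : Fin 3 → ℝ} (hv : v ∈ D) :
    pj Φ 1 0 v = 0 ∧
    pd (pj Φ 1 1) (Pi.single 1 1) v = 2 * θ'.n * pj Φ 2 1 v * pj Φ 1 1 v ∧
    θ.f (v 1) * Real.exp (-(θ.n * v 2)) * pj Φ 2 0 v =
      pd (pj Φ 2 1) (Pi.single 1 1) v - θ'.n * pj Φ 2 1 v ^ 2 -
      θ.n / θ'.n * θ.h (v 1) * (Real.exp (θ.m * v 2) * Real.exp (-(θ.n * v 2))) +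
      pj Φ 1 1 v ^ 2 * θ'.h (Φ v 1) *
        (Real.exp (θ'.m * Φ v 2) * Real.exp (-(θ'.n * Φ v 2))) := by
  have hΦ := contDiffOn_pi.1 h.1
  have hXu : ∀ z ∈ D, pj Φ 1 2 z = 0 := fun z hz => (h.leading hD hDI hz).2.2.1
  have hn := θ.n_ne
  have hn' := θ'.n_ne
  have first : ∀ y ∈ D, pd (pj Φ 1 1) (Pi.single 1 1) y - 2 * θ'.n * pj Φ 2 1 y * pj Φ 1 1 y =
      θ.f (y 1) * Real.exp (-(θ.n * y 2)) * pj Φ 1 0 y := by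
    intro y hy
    have d0 := h.determining hD hDI hy 0
    have d1 := h.determining hD hDI hy 1
    have hXx := (h.leading hD hDI hy).2.1
    have := hXx
    generalize pj Φ 1 1 y = Xx at *
    generalize pj Φ 2 1 y = Ux at *
    have hδ : θ.n / θ'.n ≠ 0 := div_ne_zero hn hn'
    -- Because of this identity the b²-terms cancel, so the difference of the equations for b = 1
    -- and b = 0 is the linear coefficient.
    have hδ' : θ'.n * (θ.n / θ'.n) = θ.n := by field_simp
    generalize θ.n / θ'.n = δ at *
    have q0 : (Ux + 0 * δ) / Xx = Ux * Xx⁻¹ := by ring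
    have q1 : (Ux + 1 * δ) / Xx = (Ux + δ) * Xx⁻¹ := by ring
    rw [q0] at d0
    rw [q1] at d1
    have hi : Xx⁻¹ * Xx = 1 := inv_mul_cancel₀ hXx
    apply mul_left_cancel₀ hδ
    generalize Xx⁻¹ = r at *
    rw [← hδ'] at *
    linear_combination (d1 - d0) * Xx + (δ * θ.f (y 1) * Real.exp (-(θ'.n * δ * y 2)) * pj Φ 1 0 y -
      δ * pd (pj Φ 1 1) (Pi.single 1 1) y) * hi
  -- In `first`, the left-hand side and X_t are constant along u, but e^{-nu} is not, since n ≠ 0.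
  -- Two points on a u-line thus give X_t = 0.
  have hXt : pj Φ 1 0 v = 0 := by
    have l1 := eventually_line_eq hD (contDiffOn_pj hD h.1 1 1) (e := Pi.single 2 1) hv (k := 0)
      (fun y hy _ => pd_pd_eq_zero hD (hΦ 1) hXu _ y hy)
    have l2 := eventually_line_eq hD (contDiffOn_pj hD h.1 1 0) (e := Pi.single 2 1) hv (k := 0)
      (fun y hy _ => pd_pd_eq_zero hD (hΦ 1) hXu _ y hy)
    have l3 := eventually_line_eq hD (contDiffOn_pj hD h.1 2 1) (e := Pi.single 2 1) hv (k := 0)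
      (fun y hy _ => by
        rw [pj, pd_comm ((hΦ 2).contDiffAt (hD.mem_nhds hy))]
        exact pd_eq_zero_of_const hD (fun y hy => h.pj_potential hD hDI hy) _ y hy)
    have l4 := eventually_line_eq hD (contDiffOn_pd hD (contDiffOn_pj hD h.1 1 1) (Pi.single 1 1))
      (e := Pi.single 2 1) hv (k := 0) (fun y hy _ => pd_pd_eq_zero hD (contDiffOn_pj hD h.1 1 1)
        (fun y hy => pd_pd_eq_zero hD (hΦ 1) hXu _ y hy) _ y hy)
    have hev := l1.and (l2.and (l3.and (l4.and (eventually_line_mem hD hv (Pi.single 2 1)))))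
    obtain ⟨s, ⟨h1, h2, h3, h4, hs⟩, hs0⟩ :=
      ((hev.filter_mono nhdsWithin_le_nhds).and (self_mem_nhdsWithin (a := (0 : ℝ)) (s := {0}ᶜ))).exists
    have f0 := first v hv
    have f1 := first _ hs
    have e1 : (v + s • (Pi.single 2 1 : Fin 3 → ℝ)) 1 = v 1 := by simp
    have e2 : (v + s • (Pi.single 2 1 : Fin 3 → ℝ)) 2 = v 2 + s := by simp
    rw [h1, h2, h3, h4, e1, e2] at f1
    simp only [zero_mul, add_zero] at f1
    rw [f0] at f1
    by_contra hne
    have h5 := mul_left_cancel₀ (θ.f_ne _ (hDI v hv)) (mul_right_cancel₀ hne f1)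
    have h6 := Real.exp_injective h5
    have h7 : θ.n * s = 0 := by linarith
    exact hs0 (by simpa [hn] using h7)
  have hXxx := first v hv
  rw [hXt, mul_zero] at hXxx
  refine ⟨hXt, by linarith, ?_⟩
  have d0 := h.determining hD hDI hv 0
  have hXx := (h.leading hD hDI hv).2.1
  have q0 : (pj Φ 2 1 v + 0 * (θ.n / θ'.n)) / pj Φ 1 1 v = pj Φ 2 1 v * (pj Φ 1 1 v)⁻¹ := by ring
  rw [q0] at d0
  have hi : (pj Φ 1 1 v)⁻¹ * pj Φ 1 1 v = 1 := inv_mul_cancel₀ hXx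
  rw [hXt] at d0
  linear_combination d0 - pj Φ 2 1 v * (pj Φ 1 1 v)⁻¹ * hXxx - 2 * θ'.n * pj Φ 2 1 v ^ 2 * hi

/-! ### Variation of the arbitrary elements -/

/-- The equation through the point `p` whose arbitrary elements `f` and `h` are affine functions with
the slopes `c` and `c'`. -/
def affineEquation (p : ExtSpace) (hp : p 5 ≠ 0) (c c' : ℝ) : Equation where
  I := {x | p 3 + c * (x - p 1) ≠ 0}
  isOpen_I := isOpen_ne_fun (by fun_prop) continuous_const
  f := fun x => p 3 + c * (x - p 1)
  h := fun x => p 4 + c' * (x - p 1)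
  n := p 5
  m := p 6
  smooth_f := ContDiff.contDiffOn (by fun_prop)
  smooth_h := ContDiff.contDiffOn (by fun_prop)
  f_ne := fun _ hx => hx
  n_ne := hp

/-- The projection of a point of the extended space to the space of `(t, x, u)`. -/
def basePoint (p : ExtSpace) : Fin 3 → ℝ := ![p 0, p 1, p 2]

/-- The linear part of `Equation.lift` for `affineEquation`. -/
def liftVec (c c' : ℝ) (ε : Fin 3 → ℝ) : ExtSpace := ![ε 0, ε 1, ε 2, c * ε 1, c' * ε 1, 0, 0]

section

variable {p : ExtSpace} {hp : p 5 ≠ 0} {c c' : ℝ}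

theorem lift_basePoint : (affineEquation p hp c c').lift (basePoint p) = p := by
  ext i
  fin_cases i <;> simp [Equation.lift, affineEquation, basePoint]

theorem lift_add_smul (v ε : Fin 3 → ℝ) (s : ℝ) :
    (affineEquation p hp c c').lift (v + s • ε) =
      (affineEquation p hp c c').lift v + s • liftVec c c' ε := by
  ext i
  fin_cases i <;> simp [Equation.lift, affineEquation, liftVec] <;> ring

theorem contDiff_lift : ContDiff ℝ ∞ (affineEquation p hp c c').lift := by
  rw [contDiff_pi]
  intro i
  fin_cases i <;> simp [Equation.lift, affineEquation] <;> fun_prop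

theorem pd_comp_lift {g : ExtSpace → ℝ} {v : Fin 3 → ℝ}
    (hg : ContDiffAt ℝ ∞ g ((affineEquation p hp c c').lift v)) (ε : Fin 3 → ℝ) :
    pd (fun v => g ((affineEquation p hp c c').lift v)) ε v =
      pd g (liftVec c c' ε) ((affineEquation p hp c c').lift v) := by
  refine pd_eq_of_hasDerivAt (hg.comp v contDiff_lift.contDiffAt) ?_
  simp only [lift_add_smul]
  exact hasDerivAt_line_zero hg _

theorem isOpen_domain {Ω : Set ExtSpace} (hΩ : IsOpen Ω) :
    IsOpen ((affineEquation p hp c c').domain Ω) := by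
  have h1 : IsOpen {v : Fin 3 → ℝ | v 1 ∈ (affineEquation p hp c c').I} :=
    (affineEquation p hp c c').isOpen_I.preimage (continuous_apply 1)
  exact h1.inter (hΩ.preimage contDiff_lift.continuous)

theorem basePoint_mem {Ω : Set ExtSpace} (hΩ : p ∈ Ω) (hf : p 3 ≠ 0) :
    basePoint p ∈ (affineEquation p hp c c').domain Ω := by
  refine ⟨?_, by rw [lift_basePoint]; exact hΩ⟩
  simpa [affineEquation, basePoint] using hf

end

theorem liftVec_single_zero (c c' : ℝ) : liftVec c c' (Pi.single 0 1) = Pi.single 0 1 := by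
  ext i; fin_cases i <;> simp [liftVec]

theorem liftVec_single_one (c c' : ℝ) : liftVec c c' (Pi.single 1 1) =
    Pi.single 1 1 + c • Pi.single 3 1 + c' • Pi.single 4 1 := by
  ext i; fin_cases i <;> simp [liftVec]

theorem liftVec_single_two (c c' : ℝ) : liftVec c c' (Pi.single 2 1) = Pi.single 2 1 := by
  ext i; fin_cases i <;> simp [liftVec]

/-- This is the total x-derivative on an equation whose f and h have the slopes c and c' at the
point. As both slopes are arbitrary, identities polynomial in them can be split. -/
theorem pd_liftVec (g : ExtSpace → ℝ) (c c' : ℝ) (p : ExtSpace) :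
    pd g (liftVec c c' (Pi.single 1 1)) p =
      pd g (Pi.single 1 1) p + c * pd g (Pi.single 3 1) p + c' * pd g (Pi.single 4 1) p := by
  rw [liftVec_single_one]
  simp [pd]

/-- The conditions on a generalized equivalence transformation at a point, which are obtained from
the equations with affine arbitrary elements. -/
theorem IsGeneralizedEquivalence.at_point {Ω : Set ExtSpace} {𝒯 : ExtSpace → ExtSpace}
    (h : IsGeneralizedEquivalence Ω 𝒯) (hΩ : IsOpen Ω) (hsub : Ω ⊆ classSpace) {p : ExtSpace}
    (hp : p ∈ Ω) (c c' : ℝ) {w : ExtSpace} (hw : w = liftVec c c' (Pi.single 1 1)) :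
    𝒯 p 5 ≠ 0 ∧ pj 𝒯 0 0 p ≠ 0 ∧
    (pd (fun q => 𝒯 q 0) w p = 0 ∧ pj 𝒯 0 2 p = 0) ∧
    (pj 𝒯 1 0 p = 0 ∧ pj 𝒯 1 2 p = 0) ∧
    pj 𝒯 2 2 p = p 5 / 𝒯 p 5 ∧
    (∀ i : Fin 7, i = 5 ∨ i = 6 →
      pj 𝒯 i 0 p = 0 ∧ pd (fun q => 𝒯 q i) w p = 0 ∧ pj 𝒯 i 2 p = 0) ∧
    (∀ i : Fin 7, i = 3 ∨ i = 4 → pj 𝒯 i 0 p = 0 ∧ pj 𝒯 i 2 p = 0) ∧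
    pd (fun q => 𝒯 q 1) w p ≠ 0 ∧
    𝒯 p 3 * pd (fun q => 𝒯 q 1) w p ^ 2 =
      pj 𝒯 0 0 p * p 3 * (Real.exp (𝒯 p 5 * 𝒯 p 2) * Real.exp (-(p 5 * p 2))) ∧
    pd (pd (fun q => 𝒯 q 1) w) w p =
      2 * 𝒯 p 5 * pd (fun q => 𝒯 q 2) w p * pd (fun q => 𝒯 q 1) w p ∧
    p 3 * Real.exp (-(p 5 * p 2)) * pj 𝒯 2 0 p =
      pd (pd (fun q => 𝒯 q 2) w) w p - 𝒯 p 5 * pd (fun q => 𝒯 q 2) w p ^ 2 -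
      p 5 / 𝒯 p 5 * p 4 * (Real.exp (p 6 * p 2) * Real.exp (-(p 5 * p 2))) +
      pd (fun q => 𝒯 q 1) w p ^ 2 * 𝒯 p 4 *
        (Real.exp (𝒯 p 6 * 𝒯 p 2) * Real.exp (-(𝒯 p 5 * 𝒯 p 2))) := by
  obtain ⟨h𝒯, -, hall⟩ := h
  obtain ⟨hp3, hp5⟩ := hsub hp
  obtain ⟨θ', hcomp, htr⟩ := hall (affineEquation p hp5 c c')
  set θ := affineEquation p hp5 c c' with hθ
  set D := θ.domain Ω with hDdef
  have hD : IsOpen D := isOpen_domain hΩ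
  have hDI : ∀ v ∈ D, v 1 ∈ θ.I := fun v hv => hv.1
  have hv : basePoint p ∈ D := basePoint_mem hp hp3
  have hlift : θ.lift (basePoint p) = p := lift_basePoint
  have hsm : ∀ (i : Fin 7), ∀ v ∈ D, ContDiffAt ℝ ∞ (fun q => 𝒯 q i) (θ.lift v) := fun i v hv =>
    (contDiffOn_pi.1 h𝒯 i).contDiffAt (hΩ.mem_nhds hv.2)
  have hpd : ∀ (i : Fin 7) (ε : Fin 3 → ℝ), ∀ v ∈ D, pd (fun v => 𝒯 (θ.lift v) i) ε v =
      pd (fun q => 𝒯 q i) (liftVec c c' ε) (θ.lift v) := fun i ε v hv => pd_comp_lift (hsm i v hv) ε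
  have hpd2 : ∀ (i : Fin 7) (ε : Fin 3 → ℝ), ∀ v ∈ D, pd (pd (fun v => 𝒯 (θ.lift v) i) ε) ε v =
      pd (pd (fun q => 𝒯 q i) (liftVec c c' ε)) (liftVec c c' ε) (θ.lift v) := by
    intro i ε v hv
    rw [pd_congr hD (hpd i ε) ε v hv]
    exact pd_comp_lift (contDiffAt_pd (hsm i v hv) _) ε
  have a0 : (fun v => θ.restrict 𝒯 v 0) = fun v => 𝒯 (θ.lift v) 0 := rfl
  have a1 : (fun v => θ.restrict 𝒯 v 1) = fun v => 𝒯 (θ.lift v) 1 := rfl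
  have a2 : (fun v => θ.restrict 𝒯 v 2) = fun v => 𝒯 (θ.lift v) 2 := rfl
  have b1 : θ.restrict 𝒯 (basePoint p) 1 = 𝒯 p 1 := by
    change 𝒯 (θ.lift (basePoint p)) 1 = _; rw [hlift]
  have b2 : θ.restrict 𝒯 (basePoint p) 2 = 𝒯 p 2 := by
    change 𝒯 (θ.lift (basePoint p)) 2 = _; rw [hlift]
  obtain ⟨hI', hf', hh', hn', hm'⟩ := hcomp _ hv
  rw [hlift] at hI' hf' hh' hn' hm'
  have hθn : θ.n = p 5 := rfl
  have hθm : θ.m = p 6 := rfl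
  have hθf : θ.f (basePoint p 1) = p 3 := by simp [hθ, affineEquation, basePoint]
  have hθh : θ.h (basePoint p 1) = p 4 := by simp [hθ, affineEquation, basePoint]
  have hv2 : basePoint p 2 = p 2 := rfl
  obtain ⟨t1, t2⟩ := htr.time hD hv
  obtain ⟨t0, x1, x2, hlead⟩ := htr.leading hD hDI hv
  have hpot := htr.pj_potential hD hDI hv
  obtain ⟨x0, hxx, hlast⟩ := htr.space hD hDI hv
  simp only [pj, a0, a1, a2, hpd _ _ _ hv, hpd2 _ _ _ hv, hlift, liftVec_single_zero,
    liftVec_single_two, ← hw, b1, b2, ← hf', ← hh', ← hn', ← hm', hθn, hθm, hθf, hθh, hv2]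
    at t0 t1 t2 x0 x1 x2 hlead hpot hxx hlast
  refine ⟨hn'.symm ▸ θ'.n_ne, t0, ⟨t1, t2⟩, ⟨x0, x2⟩, hpot, ?_, ?_, x1, hlead, hxx, hlast⟩
  · intro i hi
    obtain ⟨k, hk⟩ : ∃ k, ∀ v ∈ D, 𝒯 (θ.lift v) i = k := by
      rcases hi with rfl | rfl
      · exact ⟨θ'.n, fun v hv => (hcomp v hv).2.2.2.1⟩
      · exact ⟨θ'.m, fun v hv => (hcomp v hv).2.2.2.2⟩
    have := fun ε => pd_eq_zero_of_const hD hk ε _ hv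
    simp only [hpd _ _ _ hv, hlift] at this
    have e0 := this (Pi.single 0 1)
    have e1 := this (Pi.single 1 1)
    have e2 := this (Pi.single 2 1)
    rw [liftVec_single_zero] at e0
    rw [← hw] at e1
    rw [liftVec_single_two] at e2
    exact ⟨e0, e1, e2⟩
  · intro i hi
    -- The values of f̃ and h̃ are functions of X alone on a fixed equation, so they are stationary
    -- wherever X is, in particular along t and u.
    obtain ⟨g, hg, hgd⟩ : ∃ g : ℝ → ℝ, (∀ v ∈ D, 𝒯 (θ.lift v) i = g (𝒯 (θ.lift v) 1)) ∧
        DifferentiableAt ℝ g (𝒯 p 1) := by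
      rcases hi with rfl | rfl
      · exact ⟨θ'.f, fun v hv => (hcomp v hv).2.1,
          (θ'.smooth_f.contDiffAt (θ'.isOpen_I.mem_nhds hI')).differentiableAt (by simp)⟩
      · exact ⟨θ'.h, fun v hv => (hcomp v hv).2.2.1,
          (θ'.smooth_h.contDiffAt (θ'.isOpen_I.mem_nhds hI')).differentiableAt (by simp)⟩
    have hz : ∀ ε : Fin 3 → ℝ, pd (fun q => 𝒯 q 1) (liftVec c c' ε) p = 0 →
        pd (fun q => 𝒯 q i) (liftVec c c' ε) p = 0 := by
      intro ε h0
      have h1 := pd_congr hD hg ε _ hv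
      rw [hpd _ _ _ hv, hlift] at h1
      rw [h1]
      have h2 : HasFDerivAt (fun v => 𝒯 (θ.lift v) 1)
          (fderiv ℝ (fun v => 𝒯 (θ.lift v) 1) (basePoint p)) (basePoint p) :=
        (((hsm 1 _ hv).comp _ contDiff_lift.contDiffAt).differentiableAt (by simp)).hasFDerivAt
      have h3 : HasDerivAt g (deriv g (𝒯 p 1)) (𝒯 (θ.lift (basePoint p)) 1) := by
        rw [hlift]; exact hgd.hasDerivAt
      have h4 := (HasDerivAt.comp_hasFDerivAt (f := fun v => 𝒯 (θ.lift v) 1) (basePoint p) h3 h2).fderiv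
      have h5 : pd (fun v => 𝒯 (θ.lift v) 1) ε (basePoint p) = 0 := by
        rw [hpd _ _ _ hv, hlift, h0]
      change fderiv ℝ (g ∘ fun v => 𝒯 (θ.lift v) 1) (basePoint p) ε = 0
      rw [h4]
      change deriv g (𝒯 p 1) • pd (fun v => 𝒯 (θ.lift v) 1) ε (basePoint p) = 0
      rw [h5, smul_zero]
    have e0 := hz (Pi.single 0 1)
    have e2 := hz (Pi.single 2 1)
    rw [liftVec_single_zero] at e0
    rw [liftVec_single_two] at e2
    exact ⟨e0 x0, e2 x2⟩

/-- The determining equations of the generalized equivalence transformations. -/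
structure DeterminingEquations (Ω : Set ExtSpace) (𝒯 : ExtSpace → ExtSpace) : Prop where
  n_ne : ∀ p ∈ Ω, 𝒯 p 5 ≠ 0
  time_ne : ∀ p ∈ Ω, pj 𝒯 0 0 p ≠ 0
  space_ne : ∀ p ∈ Ω, pj 𝒯 1 1 p ≠ 0
  time : ∀ p ∈ Ω, pj 𝒯 0 1 p = 0 ∧ pj 𝒯 0 2 p = 0 ∧ pj 𝒯 0 3 p = 0 ∧ pj 𝒯 0 4 p = 0
  space : ∀ p ∈ Ω, pj 𝒯 1 0 p = 0 ∧ pj 𝒯 1 2 p = 0 ∧ pj 𝒯 1 3 p = 0 ∧ pj 𝒯 1 4 p = 0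
  potential : ∀ p ∈ Ω, pj 𝒯 2 2 p = p 5 / 𝒯 p 5 ∧ pj 𝒯 2 3 p = 0 ∧ pj 𝒯 2 4 p = 0
  constants : ∀ i : Fin 7, i = 5 ∨ i = 6 → ∀ p ∈ Ω, pj 𝒯 i 0 p = 0 ∧ pj 𝒯 i 1 p = 0 ∧
    pj 𝒯 i 2 p = 0 ∧ pj 𝒯 i 3 p = 0 ∧ pj 𝒯 i 4 p = 0
  elements : ∀ i : Fin 7, i = 3 ∨ i = 4 → ∀ p ∈ Ω, pj 𝒯 i 0 p = 0 ∧ pj 𝒯 i 2 p = 0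
  leading : ∀ p ∈ Ω, 𝒯 p 3 * pj 𝒯 1 1 p ^ 2 =
    pj 𝒯 0 0 p * p 3 * (Real.exp (𝒯 p 5 * 𝒯 p 2) * Real.exp (-(p 5 * p 2)))
  second : ∀ p ∈ Ω, pd (pj 𝒯 1 1) (Pi.single 1 1) p = 2 * 𝒯 p 5 * pj 𝒯 2 1 p * pj 𝒯 1 1 p
  balance : ∀ p ∈ Ω, p 3 * Real.exp (-(p 5 * p 2)) * pj 𝒯 2 0 p =
    pd (pj 𝒯 2 1) (Pi.single 1 1) p - 𝒯 p 5 * pj 𝒯 2 1 p ^ 2 -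
    p 5 / 𝒯 p 5 * p 4 * (Real.exp (p 6 * p 2) * Real.exp (-(p 5 * p 2))) +
    pj 𝒯 1 1 p ^ 2 * 𝒯 p 4 * (Real.exp (𝒯 p 6 * 𝒯 p 2) * Real.exp (-(𝒯 p 5 * 𝒯 p 2)))

theorem coeff_eq_zero {a b c : ℝ} (h : ∀ x y : ℝ, a + x * b + y * c = 0) :
    a = 0 ∧ b = 0 ∧ c = 0 := by
  have h0 := h 0 0
  have h1 := h 1 0
  have h2 := h 0 1
  simp only [zero_mul, add_zero, one_mul] at h0 h1 h2
  exact ⟨h0, by linarith, by linarith⟩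

/-- Each condition at a point holds for all slopes c, c' and is split with respect to them.
Independence of X from f and h comes first: it turns total derivatives of X into partial ones in the
condition that is then used for U. -/
theorem IsGeneralizedEquivalence.determiningEquations {Ω : Set ExtSpace}
    {𝒯 : ExtSpace → ExtSpace} (h : IsGeneralizedEquivalence Ω 𝒯) (hΩ : IsOpen Ω)
    (hsub : Ω ⊆ classSpace) : DeterminingEquations Ω 𝒯 := by
  have hsm := contDiffOn_pi.1 h.1
  have hw0 : liftVec 0 0 (Pi.single 1 1) = Pi.single 1 1 := by
    rw [liftVec_single_one]; simp
  have hspace : ∀ p ∈ Ω, pj 𝒯 1 0 p = 0 ∧ pj 𝒯 1 2 p = 0 ∧ pj 𝒯 1 3 p = 0 ∧ pj 𝒯 1 4 p = 0 := by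
    intro p hp
    have hk := fun c c' => (h.at_point hΩ hsub hp c c' rfl).2.2.2.2.2.2.2.2.1
    simp only [pd_liftVec] at hk
    obtain ⟨_, t0, _, ⟨x0, x2⟩, _, _, _, x1, h0, -⟩ := h.at_point hΩ hsub hp 0 0 hw0.symm
    have hF : 𝒯 p 3 ≠ 0 := by
      intro hF
      rw [hF, zero_mul] at h0
      have h1 : pj 𝒯 0 0 p * p 3 ≠ 0 := mul_ne_zero t0 (hsub hp).1
      exact mul_ne_zero h1 (mul_ne_zero (Real.exp_ne_zero _) (Real.exp_ne_zero _)) h0.symm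
    -- In f̃ (X_x + c X_f + c' X_h)² nothing but the bracket depends on the slopes, and f̃ ≠ 0. The
    -- square of an affine function is constant only if its slope is zero.
    have hlin : ∀ y : ℝ, (∀ s : ℝ, (pj 𝒯 1 1 p + s * y) ^ 2 = pj 𝒯 1 1 p ^ 2) → y = 0 := by
      intro y hy
      have h1 := hy 1
      have h2 := hy (-1)
      have : y ^ 2 = 0 := by linarith
      simpa using this
    refine ⟨x0, x2, hlin _ fun s => ?_, hlin _ fun s => ?_⟩
    · apply mul_left_cancel₀ hF
      have := hk s 0
      rw [← h0] at this
      simpa [pj] using this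
    · apply mul_left_cancel₀ hF
      have := hk 0 s
      rw [← h0] at this
      simpa [pj] using this
  refine ⟨?_, ?_, ?_, ?_, hspace, ?_, ?_, ?_, ?_, ?_, ?_⟩
  · intro p hp
    exact (h.at_point hΩ hsub hp 0 0 rfl).1
  · intro p hp
    exact (h.at_point hΩ hsub hp 0 0 rfl).2.1
  · intro p hp
    exact (h.at_point hΩ hsub hp 0 0 hw0.symm).2.2.2.2.2.2.2.1
  · intro p hp
    have hk := fun c c' => (h.at_point hΩ hsub hp c c' rfl).2.2.1.1
    simp only [pd_liftVec] at hk
    obtain ⟨h1, h3, h4⟩ := coeff_eq_zero hk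
    exact ⟨h1, (h.at_point hΩ hsub hp 0 0 rfl).2.2.1.2, h3, h4⟩
  · intro p hp
    obtain ⟨hn, _, _, _, hu, _, _, x1, _, hxx, -⟩ := h.at_point hΩ hsub hp 0 0 hw0.symm
    refine ⟨hu, ?_⟩
    have hk := fun c c' => (h.at_point hΩ hsub hp c c' rfl).2.2.2.2.2.2.2.2.2.1
    have hX : ∀ c c', ∀ q ∈ Ω, pd (fun q => 𝒯 q 1) (liftVec c c' (Pi.single 1 1)) q =
        pj 𝒯 1 1 q := by
      intro c c' q hq
      obtain ⟨-, -, h3, h4⟩ := hspace q hq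
      rw [pd_liftVec]
      simp only [pj] at h3 h4 ⊢
      rw [h3, h4]; ring
    have hXX : ∀ c c', pd (pd (fun q => 𝒯 q 1) (liftVec c c' (Pi.single 1 1)))
        (liftVec c c' (Pi.single 1 1)) p = pd (pj 𝒯 1 1) (Pi.single 1 1) p := by
      intro c c'
      rw [pd_congr hΩ (hX c c') _ p hp, pd_liftVec]
      have e3 : pd (pj 𝒯 1 1) (Pi.single 3 1) p = 0 :=
        pd_pd_eq_zero hΩ (hsm 1) (fun q hq => (hspace q hq).2.2.1) _ p hp
      have e4 : pd (pj 𝒯 1 1) (Pi.single 4 1) p = 0 :=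
        pd_pd_eq_zero hΩ (hsm 1) (fun q hq => (hspace q hq).2.2.2) _ p hp
      rw [e3, e4]; ring
    -- In X_xx = 2ñ U_x X_x only the total derivative of U still contains the slopes. Subtracting
    -- the case c = c' = 0 leaves c U_f + c' U_h = 0.
    have := coeff_eq_zero (a := 0) (b := pj 𝒯 2 3 p) (c := pj 𝒯 2 4 p) (by
      intro s s'
      have h1 := hk s s'
      rw [hXX, hX s s' p hp, pd_liftVec] at h1
      change pd (pj 𝒯 1 1) _ p = 2 * 𝒯 p 5 * pj 𝒯 2 1 p * pj 𝒯 1 1 p at hxx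
      rw [hxx] at h1
      have h2 : 2 * 𝒯 p 5 * pj 𝒯 1 1 p ≠ 0 := mul_ne_zero (mul_ne_zero two_ne_zero hn) x1
      apply mul_left_cancel₀ h2
      simp only [pj] at h1 ⊢
      linear_combination -h1)
    exact this.2
  · intro i hi p hp
    have hk := fun c c' => ((h.at_point hΩ hsub hp c c' rfl).2.2.2.2.2.1 i hi).2.1
    simp only [pd_liftVec] at hk
    obtain ⟨h1, h3, h4⟩ := coeff_eq_zero hk
    obtain ⟨h0, -, h2⟩ := (h.at_point hΩ hsub hp 0 0 rfl).2.2.2.2.2.1 i hi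
    exact ⟨h0, h1, h2, h3, h4⟩
  · intro i hi p hp
    exact (h.at_point hΩ hsub hp 0 0 rfl).2.2.2.2.2.2.1 i hi
  · intro p hp
    exact (h.at_point hΩ hsub hp 0 0 hw0.symm).2.2.2.2.2.2.2.2.1
  · intro p hp
    exact (h.at_point hΩ hsub hp 0 0 hw0.symm).2.2.2.2.2.2.2.2.2.1
  · intro p hp
    exact (h.at_point hΩ hsub hp 0 0 hw0.symm).2.2.2.2.2.2.2.2.2.2

/-! ### Separation of exponentials in u -/

theorem eventually_deriv_exp_sum {ι : Type*} [Fintype ι] {c l : ι → ℝ}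
    (h : ∀ᶠ s : ℝ in 𝓝 0, ∑ i, c i * Real.exp (l i * s) = 0) :
    ∀ᶠ s : ℝ in 𝓝 0, ∑ i, c i * l i * Real.exp (l i * s) = 0 := by
  have h1 : deriv (fun s : ℝ => ∑ i, c i * Real.exp (l i * s)) =ᶠ[𝓝 0] deriv fun _ => (0 : ℝ) :=
    EventuallyEq.deriv h
  filter_upwards [h1] with s hs
  have h2 : HasDerivAt (fun s : ℝ => ∑ i, c i * Real.exp (l i * s))
      (∑ i, c i * l i * Real.exp (l i * s)) s := by
    refine HasDerivAt.fun_sum fun i _ => ?_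
    have := (((hasDerivAt_id s).const_mul (l i)).exp).const_mul (c i)
    refine this.congr_deriv ?_
    simp only [id_eq]; ring
  rw [h2.deriv] at hs
  simpa using hs

/-- Linear independence of exponential functions, in the form needed to separate the determining
equation with respect to `u`. -/
theorem exp_separation {σ A B C n μ κ : ℝ} (hn : n ≠ 0) (hC : C ≠ 0) (hμ : μ ≠ 0)
    (hμn : μ + n ≠ 0) (h : ∀ᶠ s : ℝ in 𝓝 0, A * Real.exp (-n * s) =
      σ - C * Real.exp (μ * s) + B * Real.exp (κ * s)) :
    A = 0 ∧ σ = 0 ∧ κ = μ ∧ B = C := by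
  have h0 : ∀ᶠ s : ℝ in 𝓝 0, ∑ i, (![σ, -A, -C, B] : Fin 4 → ℝ) i *
      Real.exp ((![0, -n, μ, κ] : Fin 4 → ℝ) i * s) = 0 := by
    filter_upwards [h] with s hs
    simp [Fin.sum_univ_four] at hs ⊢
    linarith
  have h1 := eventually_deriv_exp_sum (c := (![σ, -A, -C, B] : Fin 4 → ℝ)) h0
  have h2 := eventually_deriv_exp_sum (c := fun i => (![σ, -A, -C, B] : Fin 4 → ℝ) i *
    (![0, -n, μ, κ] : Fin 4 → ℝ) i) h1
  have h3 := eventually_deriv_exp_sum (c := fun i => (![σ, -A, -C, B] : Fin 4 → ℝ) i *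
    (![0, -n, μ, κ] : Fin 4 → ℝ) i * (![0, -n, μ, κ] : Fin 4 → ℝ) i) h2
  have k0 := h0.self_of_nhds
  have k1 := h1.self_of_nhds
  have k2 := h2.self_of_nhds
  have k3 := h3.self_of_nhds
  simp [Fin.sum_univ_four] at k0 k1 k2 k3
  -- The derivatives at 0 are the power sums ∑ cᵢ lᵢᵏ. Combining them with the coefficients of λ(λ +
  -- n)(λ - κ) kills the exponents 0, -n, κ and leaves only the term of μ.
  have hκ : κ = μ := by
    have : C * μ * (μ + n) * (κ - μ) = 0 := by
      linear_combination k3 + (n - κ) * k2 - n * κ * k1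
    have h4 : C * μ * (μ + n) ≠ 0 := mul_ne_zero (mul_ne_zero hC hμ) hμn
    have := (mul_eq_zero.1 this).resolve_left h4
    linarith
  subst hκ
  -- The polynomial λ(λ + n) now isolates the common exponent.
  have hB : B = C := by
    apply mul_left_cancel₀ (mul_ne_zero hμ hμn)
    linear_combination k2 + n * k1
  subst hB
  have hA : A = 0 := by
    apply mul_left_cancel₀ hn
    linear_combination k1
  exact ⟨hA, by rw [hA] at k0; linarith, rfl, rfl⟩

/-- Continuous functions which agree at the points with `h ≠ 0`, `m ≠ 0` and `m ≠ n` agree. -/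
theorem eq_of_eq_generic {Ω : Set ExtSpace} (hΩ : IsOpen Ω) {g g' : ExtSpace → ℝ}
    (hg : ContinuousOn g Ω) (hg' : ContinuousOn g' Ω)
    (h : ∀ p ∈ Ω, p 4 ≠ 0 → p 6 ≠ 0 → p 6 ≠ p 5 → g p = g' p) : ∀ p ∈ Ω, g p = g' p := by
  intro p hp
  -- Moving h and m at equal rates with n fixed leaves each of the exceptional sets h = 0, m = 0, m
  -- = n after at most one parameter value.
  let e : ExtSpace := Pi.single 4 1 + Pi.single 6 1
  have e4 : ∀ s : ℝ, (p + s • e) 4 = p 4 + s := by intro s; simp [e]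
  have e5 : ∀ s : ℝ, (p + s • e) 5 = p 5 := by intro s; simp [e]
  have e6 : ∀ s : ℝ, (p + s • e) 6 = p 6 + s := by intro s; simp [e]
  have hne : ∀ a : ℝ, ∀ᶠ s : ℝ in 𝓝[≠] 0, s ≠ a := by
    intro a
    by_cases ha : a = 0
    · rw [ha]; exact self_mem_nhdsWithin
    · exact mem_nhdsWithin_of_mem_nhds (isOpen_ne.mem_nhds (Ne.symm ha))
  have hev : ∀ᶠ s : ℝ in 𝓝[≠] 0, g (p + s • e) = g' (p + s • e) := by
    filter_upwards [(eventually_line_mem hΩ hp e).filter_mono nhdsWithin_le_nhds, hne (-p 4),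
      hne (-p 6), hne (p 5 - p 6)] with s hs h4 h6 h56
    refine h _ hs ?_ ?_ ?_
    · rw [e4]; intro h0; exact h4 (by linarith)
    · rw [e6]; intro h0; exact h6 (by linarith)
    · rw [e6, e5]; intro h0; exact h56 (by linarith)
  have hl : Tendsto (fun s : ℝ => p + s • e) (𝓝[≠] 0) (𝓝 p) := by
    have hc : ContinuousAt (fun s : ℝ => p + s • e) 0 := by fun_prop
    have := hc.tendsto.mono_left (nhdsWithin_le_nhds (s := {0}ᶜ))
    simpa using this
  have t1 := (hg.continuousAt (hΩ.mem_nhds hp)).tendsto.comp hl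
  have t2 := (hg'.continuousAt (hΩ.mem_nhds hp)).tendsto.comp hl
  exact tendsto_nhds_unique_of_eventuallyEq t1 t2 hev

/-! ### Differentiation rules and functions of n and m alone -/

section

variable {E : Type*} [NormedAddCommGroup E] [NormedSpace ℝ E]

theorem pd_mul {g g' : E → ℝ} {x : E} (hg : ContDiffAt ℝ ∞ g x) (hg' : ContDiffAt ℝ ∞ g' x)
    (e : E) : pd (fun y => g y * g' y) e x = pd g e x * g' x + g x * pd g' e x := by
  refine pd_eq_of_hasDerivAt (hg.mul hg') ?_
  simpa using (hasDerivAt_line_zero hg e).fun_mul (hasDerivAt_line_zero hg' e)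

theorem pd_sub {g g' : E → ℝ} {x : E} (hg : ContDiffAt ℝ ∞ g x) (hg' : ContDiffAt ℝ ∞ g' x)
    (e : E) : pd (fun y => g y - g' y) e x = pd g e x - pd g' e x :=
  pd_eq_of_hasDerivAt (hg.sub hg') ((hasDerivAt_line_zero hg e).sub (hasDerivAt_line_zero hg' e))

theorem pd_add {g g' : E → ℝ} {x : E} (hg : ContDiffAt ℝ ∞ g x) (hg' : ContDiffAt ℝ ∞ g' x)
    (e : E) : pd (fun y => g y + g' y) e x = pd g e x + pd g' e x :=
  pd_eq_of_hasDerivAt (hg.add hg') ((hasDerivAt_line_zero hg e).add (hasDerivAt_line_zero hg' e))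

theorem pd_neg {g : E → ℝ} {x : E} (hg : ContDiffAt ℝ ∞ g x) (e : E) :
    pd (fun y => -g y) e x = -pd g e x :=
  pd_eq_of_hasDerivAt hg.neg (hasDerivAt_line_zero hg e).neg

theorem pd_inv {g : E → ℝ} {x : E} (hg : ContDiffAt ℝ ∞ g x) (h0 : g x ≠ 0) (e : E) :
    pd (fun y => (g y)⁻¹) e x = -pd g e x / g x ^ 2 := by
  refine pd_eq_of_hasDerivAt (hg.inv h0) ?_
  simpa using (hasDerivAt_line_zero hg e).fun_inv (by simpa using h0)

theorem pd_exp {g : E → ℝ} {x : E} (hg : ContDiffAt ℝ ∞ g x) (e : E) :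
    pd (fun y => Real.exp (g y)) e x = Real.exp (g x) * pd g e x := by
  refine pd_eq_of_hasDerivAt hg.exp ?_
  simpa using (hasDerivAt_line_zero hg e).exp

end

theorem contDiff_coord (k : Fin 7) : ContDiff ℝ ∞ fun q : ExtSpace => q k := by fun_prop

theorem pd_coord (k j : Fin 7) (p : ExtSpace) :
    pd (fun q : ExtSpace => q k) (Pi.single j 1) p = if k = j then 1 else 0 := by
  refine pd_eq_of_hasDerivAt (contDiff_coord k).contDiffAt ?_
  by_cases h : k = j
  · subst h
    simpa using (hasDerivAt_id (0 : ℝ)).const_add (p k)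
  · simp [h, hasDerivAt_const]

/-- The function does not depend on the variables other than `n` and `m`, infinitesimally. -/
def Flat (Ω : Set ExtSpace) (g : ExtSpace → ℝ) : Prop :=
  ∀ p ∈ Ω, ∀ j : Fin 7, j ≠ 5 → j ≠ 6 → pd g (Pi.single j 1) p = 0

theorem Flat.pd_eq_zero {Ω : Set ExtSpace} {g : ExtSpace → ℝ} (h : Flat Ω g) :
    ∀ p ∈ Ω, ∀ v : ExtSpace, v 5 = 0 → v 6 = 0 → pd g v p = 0 := by
  intro p hp v h5 h6
  have hv : v = ∑ j, v j • (Pi.single j 1 : ExtSpace) := by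
    ext i
    simp [Finset.sum_apply, Pi.single_apply]
  rw [hv, pd, map_sum]
  refine Finset.sum_eq_zero fun j _ => ?_
  rw [map_smul]
  by_cases hj5 : j = 5
  · rw [hj5, h5, zero_smul]
  by_cases hj6 : j = 6
  · rw [hj6, h6, zero_smul]
  have := h p hp j hj5 hj6
  rw [pd] at this
  rw [this, smul_zero]

/-- A function which is affine in the variable with the index `k` and depends on no other variables
but `n` and `m` has constant coefficients. -/
theorem flat_sub_mul {Ω : Set ExtSpace} (hΩ : IsOpen Ω) {g : ExtSpace → ℝ}
    (hg : ContDiffOn ℝ ∞ g Ω) {k : Fin 7}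
    (h : ∀ p ∈ Ω, ∀ j : Fin 7, j ≠ 5 → j ≠ 6 → j ≠ k → pd g (Pi.single j 1) p = 0)
    (hkk : ∀ p ∈ Ω, pd (pd g (Pi.single k 1)) (Pi.single k 1) p = 0) :
    Flat Ω (pd g (Pi.single k 1)) ∧ Flat Ω fun q => g q - q k * pd g (Pi.single k 1) q := by
  have h1 : Flat Ω (pd g (Pi.single k 1)) := by
    intro p hp j h5 h6
    by_cases hj : j = k
    · rw [hj]; exact hkk p hp
    · exact pd_pd_eq_zero hΩ hg (fun q hq => h q hq j h5 h6 hj) _ p hp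
  refine ⟨h1, ?_⟩
  intro p hp j h5 h6
  have hgp := hg.contDiffAt (hΩ.mem_nhds hp)
  have hk := (contDiff_coord k).contDiffAt (x := p)
  rw [pd_sub hgp (hk.mul (contDiffAt_pd hgp _)), pd_mul hk (contDiffAt_pd hgp _), pd_coord,
    h1 p hp j h5 h6]
  by_cases hj : j = k
  · subst hj; simp
  · simp [h p hp j h5 h6 hj, Ne.symm hj]

/-! ### Integration of the determining equations -/

namespace DeterminingEquations

variable {Ω : Set ExtSpace} {𝒯 : ExtSpace → ExtSpace}

/-- The function `ñ ũ - n u`. -/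
def shift (𝒯 : ExtSpace → ExtSpace) (q : ExtSpace) : ℝ := 𝒯 q 5 * 𝒯 q 2 - q 5 * q 2

theorem contDiffOn_shift (hs : ∀ i, ContDiffOn ℝ ∞ (fun q => 𝒯 q i) Ω) :
    ContDiffOn ℝ ∞ (shift 𝒯) Ω :=
  ((hs 5).mul (hs 2)).sub ((contDiff_coord 5).contDiffOn.mul (contDiff_coord 2).contDiffOn)

theorem constants_flat (h : DeterminingEquations Ω 𝒯) {i : Fin 7} (hi : i = 5 ∨ i = 6) :
    Flat Ω fun q => 𝒯 q i := by
  intro p hp j h5 h6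
  obtain ⟨h0, h1, h2, h3, h4⟩ := h.constants i hi p hp
  fin_cases j
  · exact h0
  · exact h1
  · exact h2
  · exact h3
  · exact h4
  · exact absurd rfl h5
  · exact absurd rfl h6

theorem pd_shift (h : DeterminingEquations Ω 𝒯) (hΩ : IsOpen Ω)
    (hs : ∀ i, ContDiffOn ℝ ∞ (fun q => 𝒯 q i) Ω) {p : ExtSpace} (hp : p ∈ Ω) {j : Fin 7}
    (h5 : j ≠ 5) (h6 : j ≠ 6) :
    pd (shift 𝒯) (Pi.single j 1) p = 𝒯 p 5 * pj 𝒯 2 j p - p 5 * if 2 = j then 1 else 0 := by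
  have hsp := fun i => (hs i).contDiffAt (hΩ.mem_nhds hp)
  have hc := fun i => (contDiff_coord i).contDiffAt (x := p)
  unfold shift
  rw [pd_sub ((hsp 5).mul (hsp 2)) ((hc 5).mul (hc 2)), pd_mul (hsp 5) (hsp 2),
    pd_mul (hc 5) (hc 2), pd_coord, pd_coord, h.constants_flat (Or.inl rfl) p hp j h5 h6]
  simp [Ne.symm h5, pj]

theorem ratio_flat (h : DeterminingEquations Ω 𝒯) (hΩ : IsOpen Ω)
    (hs : ∀ i, ContDiffOn ℝ ∞ (fun q => 𝒯 q i) Ω) : Flat Ω fun q => q 5 / 𝒯 q 5 := by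
  intro p hp j h5 h6
  have h1 := (hs 5).contDiffAt (hΩ.mem_nhds hp)
  have hc := (contDiff_coord 5).contDiffAt (x := p)
  have h1i : ContDiffAt ℝ ∞ (fun q => (𝒯 q 5)⁻¹) p := h1.inv (h.n_ne p hp)
  simp only [div_eq_mul_inv]
  rw [pd_mul hc h1i, pd_inv h1 (h.n_ne p hp), pd_coord,
    h.constants_flat (Or.inl rfl) p hp j h5 h6]
  simp [Ne.symm h5]

theorem pd_potential (h : DeterminingEquations Ω 𝒯) (hΩ : IsOpen Ω)
    (hs : ∀ i, ContDiffOn ℝ ∞ (fun q => 𝒯 q i) Ω) {j : Fin 7} (h5 : j ≠ 5) (h6 : j ≠ 6) :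
    ∀ p ∈ Ω, pd (pj 𝒯 2 j) (Pi.single 2 1) p = 0 := by
  intro p hp
  rw [pj, pd_comm ((hs 2).contDiffAt (hΩ.mem_nhds hp))]
  change pd (pj 𝒯 2 2) _ p = 0
  rw [pd_congr hΩ (fun q hq => (h.potential q hq).1) _ p hp]
  exact h.ratio_flat hΩ hs p hp j h5 h6

/-- On a u-line the balance equation is a relation between the exponentials with the exponents -n,
0, m - n and (m̃ - ñ)n/ñ. Under the three inequalities the first three are distinct and the m - n
term has a nonzero coefficient, so only the last exponential can cancel it. -/
theorem generic (h : DeterminingEquations Ω 𝒯) (hΩ : IsOpen Ω) (hsub : Ω ⊆ classSpace)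
    (hT : ContDiffOn ℝ ∞ 𝒯 Ω) {p : ExtSpace} (hp : p ∈ Ω) (h4 : p 4 ≠ 0) (h6 : p 6 ≠ 0)
    (h65 : p 6 ≠ p 5) :
    pj 𝒯 2 0 p = 0 ∧ pd (pj 𝒯 2 1) (Pi.single 1 1) p - 𝒯 p 5 * pj 𝒯 2 1 p ^ 2 = 0 ∧
    𝒯 p 6 * p 5 = p 6 * 𝒯 p 5 ∧
    pj 𝒯 1 1 p ^ 2 * 𝒯 p 4 * (Real.exp (𝒯 p 6 * 𝒯 p 2) * Real.exp (-(𝒯 p 5 * 𝒯 p 2))) =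
      p 5 / 𝒯 p 5 * p 4 * (Real.exp (p 6 * p 2) * Real.exp (-(p 5 * p 2))) := by
  have hs := contDiffOn_pi.1 hT
  have hn : p 5 ≠ 0 := (hsub hp).2
  have hN := h.n_ne p hp
  -- Apart from U and the explicit u, everything in the balance equation is constant along u; U is
  -- affine there because ñU - nu is constant.
  have line0 : ∀ {g : ExtSpace → ℝ}, ContDiffOn ℝ ∞ g Ω →
      (∀ q ∈ Ω, pd g (Pi.single 2 1) q = 0) →
      ∀ᶠ s : ℝ in 𝓝 0, g (p + s • Pi.single 2 1) = g p := by
    intro g hg h0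
    filter_upwards [eventually_line_eq hΩ hg hp (k := 0) fun y hy _ => h0 y hy] with s hs
    simpa using hs
  have l5 := line0 (hs 5) fun q hq => (h.constants 5 (Or.inl rfl) q hq).2.2.1
  have l6 := line0 (hs 6) fun q hq => (h.constants 6 (Or.inr rfl) q hq).2.2.1
  have l4 := line0 (hs 4) fun q hq => (h.elements 4 (Or.inr rfl) q hq).2
  have lV := line0 (contDiffOn_shift hs) fun q hq => by
    rw [h.pd_shift hΩ hs hq (by decide) (by decide), (h.potential q hq).1]
    have := h.n_ne q hq
    field_simp
    simp
  have l11 := line0 (contDiffOn_pj hΩ hT 1 1) fun q hq =>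
    pd_pd_eq_zero hΩ (hs 1) (fun z hz => (h.space z hz).2.1) _ q hq
  have l20 := line0 (contDiffOn_pj hΩ hT 2 0) (h.pd_potential hΩ hs (by decide) (by decide))
  have l21 := line0 (contDiffOn_pj hΩ hT 2 1) (h.pd_potential hΩ hs (by decide) (by decide))
  have l211 := line0 (contDiffOn_pd hΩ (contDiffOn_pj hΩ hT 2 1) (Pi.single 1 1)) fun q hq =>
    pd_pd_eq_zero hΩ (contDiffOn_pj hΩ hT 2 1) (h.pd_potential hΩ hs (by decide) (by decide)) _ q hq
  have hev : ∀ᶠ s : ℝ in 𝓝 0,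
      (p 3 * Real.exp (-(p 5 * p 2)) * pj 𝒯 2 0 p) * Real.exp (-p 5 * s) =
      (pd (pj 𝒯 2 1) (Pi.single 1 1) p - 𝒯 p 5 * pj 𝒯 2 1 p ^ 2) -
      (p 5 / 𝒯 p 5 * p 4 * (Real.exp (p 6 * p 2) * Real.exp (-(p 5 * p 2)))) *
        Real.exp ((p 6 - p 5) * s) +
      (pj 𝒯 1 1 p ^ 2 * 𝒯 p 4 * (Real.exp (𝒯 p 6 * 𝒯 p 2) * Real.exp (-(𝒯 p 5 * 𝒯 p 2)))) *
        Real.exp ((𝒯 p 6 - 𝒯 p 5) * (p 5 / 𝒯 p 5) * s) := by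
    filter_upwards [l5, l6, l4, lV, l11, l20, l21, l211,
      eventually_line_mem hΩ hp (Pi.single 2 1)] with s s5 s6 s4 sV s11 s20 s21 s211 hs
    have c : ∀ i, i ≠ 2 → (p + s • (Pi.single 2 1 : ExtSpace)) i = p i := by
      intro i hi; simp [hi]
    have c2 : (p + s • (Pi.single 2 1 : ExtSpace)) 2 = p 2 + s := by simp
    have hb := h.balance _ hs
    simp only [shift] at sV
    rw [s5, c 5 (by decide), c2] at sV
    have hU : 𝒯 (p + s • (Pi.single 2 1 : ExtSpace)) 2 = 𝒯 p 2 + p 5 / 𝒯 p 5 * s := by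
      field_simp
      linarith
    rw [s5, s6, s4, s11, s20, s21, s211, hU, c 3 (by decide), c 4 (by decide), c 5 (by decide),
      c 6 (by decide), c2] at hb
    have x1 : Real.exp (-(p 5 * (p 2 + s))) = Real.exp (-(p 5 * p 2)) * Real.exp (-p 5 * s) := by
      rw [← Real.exp_add]; congr 1; ring
    have x2 : Real.exp (p 6 * (p 2 + s)) * Real.exp (-(p 5 * (p 2 + s))) =
        Real.exp (p 6 * p 2) * Real.exp (-(p 5 * p 2)) * Real.exp ((p 6 - p 5) * s) := by
      rw [← Real.exp_add, ← Real.exp_add, ← Real.exp_add]; congr 1; ring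
    have x3 : Real.exp (𝒯 p 6 * (𝒯 p 2 + p 5 / 𝒯 p 5 * s)) *
        Real.exp (-(𝒯 p 5 * (𝒯 p 2 + p 5 / 𝒯 p 5 * s))) =
        Real.exp (𝒯 p 6 * 𝒯 p 2) * Real.exp (-(𝒯 p 5 * 𝒯 p 2)) *
          Real.exp ((𝒯 p 6 - 𝒯 p 5) * (p 5 / 𝒯 p 5) * s) := by
      rw [← Real.exp_add, ← Real.exp_add, ← Real.exp_add]; congr 1; ring
    rw [x2, x3, x1] at hb
    linear_combination hb
  obtain ⟨hA, hσ, hκ, hB⟩ := exp_separation hn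
    (mul_ne_zero (mul_ne_zero (div_ne_zero hn hN) h4)
      (mul_ne_zero (Real.exp_ne_zero _) (Real.exp_ne_zero _)))
    (sub_ne_zero.2 h65) (by simpa using h6) hev
  refine ⟨?_, hσ, ?_, hB⟩
  · exact (mul_eq_zero.1 hA).resolve_left (mul_ne_zero (hsub hp).1 (Real.exp_ne_zero _))
  · field_simp at hκ
    linear_combination hκ

/-- Both sides of each identity are continuous, and the points treated in `generic` are dense in Ω.
-/
theorem separated (h : DeterminingEquations Ω 𝒯) (hΩ : IsOpen Ω) (hsub : Ω ⊆ classSpace)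
    (hT : ContDiffOn ℝ ∞ 𝒯 Ω) {p : ExtSpace} (hp : p ∈ Ω) :
    pj 𝒯 2 0 p = 0 ∧ pd (pj 𝒯 2 1) (Pi.single 1 1) p = 𝒯 p 5 * pj 𝒯 2 1 p ^ 2 ∧
    𝒯 p 6 * p 5 = p 6 * 𝒯 p 5 ∧
    pj 𝒯 1 1 p ^ 2 * 𝒯 p 4 * (Real.exp (𝒯 p 6 * 𝒯 p 2) * Real.exp (-(𝒯 p 5 * 𝒯 p 2))) =
      p 5 / 𝒯 p 5 * p 4 * (Real.exp (p 6 * p 2) * Real.exp (-(p 5 * p 2))) := by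
  have hs := contDiffOn_pi.1 hT
  have c := fun i => (hs i).continuousOn
  have cj := fun i j => (contDiffOn_pj hΩ hT i j).continuousOn
  have cc := fun i : Fin 7 => (contDiff_coord i).continuous.continuousOn (s := Ω)
  refine ⟨?_, ?_, ?_, ?_⟩
  · exact eq_of_eq_generic hΩ (cj 2 0) continuousOn_const
      (fun q hq h4 h6 h65 => (h.generic hΩ hsub hT hq h4 h6 h65).1) p hp
  · exact eq_of_eq_generic hΩ
      (contDiffOn_pd hΩ (contDiffOn_pj hΩ hT 2 1) (Pi.single 1 1)).continuousOn
      (g' := fun p => 𝒯 p 5 * pj 𝒯 2 1 p ^ 2) ((c 5).mul ((cj 2 1).pow 2))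
      (fun q hq h4 h6 h65 => sub_eq_zero.1 (h.generic hΩ hsub hT hq h4 h6 h65).2.1) p hp
  · exact eq_of_eq_generic hΩ (g := fun p => 𝒯 p 6 * p 5) (g' := fun p => p 6 * 𝒯 p 5)
      ((c 6).mul (cc 5)) ((cc 6).mul (c 5))
      (fun q hq h4 h6 h65 => (h.generic hΩ hsub hT hq h4 h6 h65).2.2.1) p hp
  · refine eq_of_eq_generic hΩ
      (g := fun p => pj 𝒯 1 1 p ^ 2 * 𝒯 p 4 *
        (Real.exp (𝒯 p 6 * 𝒯 p 2) * Real.exp (-(𝒯 p 5 * 𝒯 p 2))))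
      (g' := fun p => p 5 / 𝒯 p 5 * p 4 * (Real.exp (p 6 * p 2) * Real.exp (-(p 5 * p 2)))) ?_ ?_
      (fun q hq h4 h6 h65 => (h.generic hΩ hsub hT hq h4 h6 h65).2.2.2) p hp
    · exact (((cj 1 1).pow 2).mul (c 4)).mul
        ((((c 6).mul (c 2)).rexp).mul (((c 5).mul (c 2)).neg.rexp))
    · exact (((cc 5).div (c 5) h.n_ne).mul (cc 4)).mul
        ((((cc 6).mul (cc 2)).rexp).mul (((cc 5).mul (cc 2)).neg.rexp))

/-- The denominator of the linear fractional function, and the numerator. -/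
noncomputable def lden (𝒯 : ExtSpace → ExtSpace) (q : ExtSpace) : ℝ := Real.exp (-shift 𝒯 q)

noncomputable def lnum (𝒯 : ExtSpace → ExtSpace) (q : ExtSpace) : ℝ := 𝒯 q 1 * lden 𝒯 q

theorem contDiffOn_lden (hs : ∀ i, ContDiffOn ℝ ∞ (fun q => 𝒯 q i) Ω) :
    ContDiffOn ℝ ∞ (lden 𝒯) Ω := (contDiffOn_shift hs).neg.exp

theorem contDiffOn_lnum (hs : ∀ i, ContDiffOn ℝ ∞ (fun q => 𝒯 q i) Ω) :
    ContDiffOn ℝ ∞ (lnum 𝒯) Ω := (hs 1).mul (contDiffOn_lden hs)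

theorem pd_lden (h : DeterminingEquations Ω 𝒯) (hΩ : IsOpen Ω) (hsub : Ω ⊆ classSpace)
    (hT : ContDiffOn ℝ ∞ 𝒯 Ω) {p : ExtSpace} (hp : p ∈ Ω) :
    pd (lden 𝒯) (Pi.single 1 1) p = -(lden 𝒯 p * (𝒯 p 5 * pj 𝒯 2 1 p)) ∧
    ∀ j : Fin 7, j ≠ 5 → j ≠ 6 → j ≠ 1 → pd (lden 𝒯) (Pi.single j 1) p = 0 := by
  have hs := contDiffOn_pi.1 hT
  have hV := (contDiffOn_shift hs).contDiffAt (hΩ.mem_nhds hp)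
  have key : ∀ e, pd (lden 𝒯) e p = -(lden 𝒯 p * pd (shift 𝒯) e p) := by
    intro e
    unfold lden
    rw [pd_exp hV.neg, pd_neg hV]; ring
  refine ⟨?_, ?_⟩
  · rw [key, h.pd_shift hΩ hs hp (by decide) (by decide)]; simp
  · intro j h5 h6 h1
    rw [key, h.pd_shift hΩ hs hp h5 h6]
    obtain ⟨u2, u3, u4⟩ := h.potential p hp
    have u0 := (h.separated hΩ hsub hT hp).1
    fin_cases j
    · simp [u0]
    · exact absurd rfl h1
    · have := h.n_ne p hp
      simp [u2]
      field_simp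
      simp
    · simp [u3]
    · simp [u4]
    · exact absurd rfl h5
    · exact absurd rfl h6

/-- As U_xx = ñ U_x², the function e^{-ñU}, and with it L = e^{nu - ñU}, has zero second
x-derivative. -/
theorem pd_pd_lden (h : DeterminingEquations Ω 𝒯) (hΩ : IsOpen Ω) (hsub : Ω ⊆ classSpace)
    (hT : ContDiffOn ℝ ∞ 𝒯 Ω) {p : ExtSpace} (hp : p ∈ Ω) :
    pd (pd (lden 𝒯) (Pi.single 1 1)) (Pi.single 1 1) p = 0 := by
  have hs := contDiffOn_pi.1 hT
  have hL := (contDiffOn_lden hs).contDiffAt (hΩ.mem_nhds hp)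
  have hN := (hs 5).contDiffAt (hΩ.mem_nhds hp)
  have hU := (contDiffOn_pj hΩ hT 2 1).contDiffAt (hΩ.mem_nhds hp)
  rw [pd_congr hΩ (g' := fun p => -(lden 𝒯 p * (𝒯 p 5 * pj 𝒯 2 1 p)))
    (fun q hq => (h.pd_lden hΩ hsub hT hq).1) _ p hp, pd_neg (hL.mul (hN.mul hU)),
    pd_mul hL (hN.mul hU), pd_mul hN hU, (h.pd_lden hΩ hsub hT hp).1,
    h.constants_flat (Or.inl rfl) p hp 1 (by decide) (by decide),
    (h.separated hΩ hsub hT hp).2.1]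
  ring

theorem pd_lnum (h : DeterminingEquations Ω 𝒯) (hΩ : IsOpen Ω) (hsub : Ω ⊆ classSpace)
    (hT : ContDiffOn ℝ ∞ 𝒯 Ω) {p : ExtSpace} (hp : p ∈ Ω) :
    pd (lnum 𝒯) (Pi.single 1 1) p =
      pj 𝒯 1 1 p * lden 𝒯 p + 𝒯 p 1 * pd (lden 𝒯) (Pi.single 1 1) p ∧
    ∀ j : Fin 7, j ≠ 5 → j ≠ 6 → j ≠ 1 → pd (lnum 𝒯) (Pi.single j 1) p = 0 := by
  have hs := contDiffOn_pi.1 hT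
  have hL := (contDiffOn_lden hs).contDiffAt (hΩ.mem_nhds hp)
  have hX := (hs 1).contDiffAt (hΩ.mem_nhds hp)
  refine ⟨pd_mul hX hL _, ?_⟩
  intro j h5 h6 h1
  obtain ⟨x0, x2, x3, x4⟩ := h.space p hp
  have hx : pd (fun q => 𝒯 q 1) (Pi.single j 1) p = 0 := by
    fin_cases j
    · exact x0
    · exact absurd rfl h1
    · exact x2
    · exact x3
    · exact x4
    · exact absurd rfl h5
    · exact absurd rfl h6
  unfold lnum
  rw [pd_mul hX hL, hx, (h.pd_lden hΩ hsub hT hp).2 j h5 h6 h1]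
  ring

/-- In (X L)_xx = X_xx L + 2 X_x L_x + X L_xx the last term is zero, and the others cancel by X_xx =
2ñ U_x X_x and L_x = -ñ U_x L. -/
theorem pd_pd_lnum (h : DeterminingEquations Ω 𝒯) (hΩ : IsOpen Ω) (hsub : Ω ⊆ classSpace)
    (hT : ContDiffOn ℝ ∞ 𝒯 Ω) {p : ExtSpace} (hp : p ∈ Ω) :
    pd (pd (lnum 𝒯) (Pi.single 1 1)) (Pi.single 1 1) p = 0 := by
  have hs := contDiffOn_pi.1 hT
  have hL := (contDiffOn_lden hs).contDiffAt (hΩ.mem_nhds hp)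
  have hX := (hs 1).contDiffAt (hΩ.mem_nhds hp)
  have hX1 := (contDiffOn_pj hΩ hT 1 1).contDiffAt (hΩ.mem_nhds hp)
  have hL1 := contDiffAt_pd hL (Pi.single 1 1)
  rw [pd_congr hΩ (g' := fun p => pj 𝒯 1 1 p * lden 𝒯 p +
      𝒯 p 1 * pd (lden 𝒯) (Pi.single 1 1) p)
    (fun q hq => (h.pd_lnum hΩ hsub hT hq).1) _ p hp, pd_add (hX1.mul hL) (hX.mul hL1),
    pd_mul hX1 hL, pd_mul hX hL1, h.pd_pd_lden hΩ hsub hT hp, (h.pd_lden hΩ hsub hT hp).1,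
    h.second p hp]
  change _ + (pj 𝒯 1 1 p * _ + _) = 0
  ring

/-- The leading relation solved for T_t, with e^{ñU - nu} = 1/L. No factor on the right depends on
t, which is why T is affine in t. -/
theorem time_eq (h : DeterminingEquations Ω 𝒯) (hsub : Ω ⊆ classSpace) {p : ExtSpace}
    (hp : p ∈ Ω) : pj 𝒯 0 0 p = 𝒯 p 3 * (pj 𝒯 1 1 p * pj 𝒯 1 1 p) * lden 𝒯 p * (p 3)⁻¹ := by
  have hl := h.leading p hp
  have hf := (hsub hp).1
  have e : Real.exp (𝒯 p 5 * 𝒯 p 2) * Real.exp (-(p 5 * p 2)) * lden 𝒯 p = 1 := by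
    rw [lden, shift, ← Real.exp_add, ← Real.exp_add, ← Real.exp_zero]; congr 1; ring
  rw [← pow_two, hl]
  field_simp
  linear_combination (-pj 𝒯 0 0 p) * e

theorem pd_pd_time (h : DeterminingEquations Ω 𝒯) (hΩ : IsOpen Ω) (hsub : Ω ⊆ classSpace)
    (hT : ContDiffOn ℝ ∞ 𝒯 Ω) {p : ExtSpace} (hp : p ∈ Ω) :
    pd (pj 𝒯 0 0) (Pi.single 0 1) p = 0 := by
  have hs := contDiffOn_pi.1 hT
  have hL := (contDiffOn_lden hs).contDiffAt (hΩ.mem_nhds hp)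
  have hF := (hs 3).contDiffAt (hΩ.mem_nhds hp)
  have hX1 := (contDiffOn_pj hΩ hT 1 1).contDiffAt (hΩ.mem_nhds hp)
  have hc := (contDiff_coord 3).contDiffAt (x := p)
  have hf := (hsub hp).1
  have hX10 : pd (pj 𝒯 1 1) (Pi.single 0 1) p = 0 :=
    pd_pd_eq_zero hΩ (hs 1) (fun q hq => (h.space q hq).1) _ p hp
  have hF0 : pd (fun q => 𝒯 q 3) (Pi.single 0 1) p = 0 := (h.elements 3 (Or.inl rfl) p hp).1
  have hci : ContDiffAt ℝ ∞ (fun q : ExtSpace => (q 3)⁻¹) p := hc.inv hf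
  rw [pd_congr hΩ (fun q hq => h.time_eq hsub hq) _ p hp,
    pd_mul ((hF.mul (hX1.mul hX1)).mul hL) hci, pd_mul (hF.mul (hX1.mul hX1)) hL,
    pd_mul hF (hX1.mul hX1), pd_mul hX1 hX1, pd_inv hc hf, pd_coord, hX10, hF0,
    (h.pd_lden hΩ hsub hT hp).2 0 (by decide) (by decide) (by decide)]
  simp

end DeterminingEquations

/-! ### Nondegeneracy and recovery of the parameters -/

/-- If `δ₃` violates the nondegeneracy condition, then `(n, m) ↦ (n / δ₃, m / δ₃)` is degenerate. -/
theorem fderiv_ne_of_nondegenerate {Ω : Set ExtSpace} (hΩ : IsOpen Ω) {𝒯 : ExtSpace → ExtSpace}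
    (hT : ContDiffOn ℝ ∞ 𝒯 Ω) {p : ExtSpace} (hp : p ∈ Ω) (hdet : (fderiv ℝ 𝒯 p).det ≠ 0)
    {G : ℝ × ℝ → ℝ} (hG : DifferentiableAt ℝ G (p 5, p 6)) (hG0 : G (p 5, p 6) ≠ 0)
    (h5 : ∀ q ∈ Ω, 𝒯 q 5 = q 5 / G (q 5, q 6)) (h6 : ∀ q ∈ Ω, 𝒯 q 6 = q 6 / G (q 5, q 6)) :
    fderiv ℝ G (p 5, p 6) (p 5, p 6) ≠ G (p 5, p 6) := by
  intro hbad
  set A := fderiv ℝ G (p 5, p 6) with hA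
  have hTd : DifferentiableAt ℝ 𝒯 p := (hT.contDiffAt (hΩ.mem_nhds hp)).differentiableAt (by simp)
  have hs := fun i => (contDiffOn_pi.1 hT i).contDiffAt (hΩ.mem_nhds hp)
  have hline : ∀ v : ExtSpace,
      HasDerivAt (fun s : ℝ => G ((p + s • v) 5, (p + s • v) 6)) (A (v 5, v 6)) 0 := by
    intro v
    have h1 : HasDerivAt (fun s : ℝ => ((p + s • v) 5, (p + s • v) 6)) (v 5, v 6) 0 := by
      refine HasDerivAt.prodMk ?_ ?_
      · simpa using ((hasDerivAt_id (0 : ℝ)).mul_const (v 5)).const_add (p 5)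
      · simpa using ((hasDerivAt_id (0 : ℝ)).mul_const (v 6)).const_add (p 6)
    have h2 : HasFDerivAt G A ((p + (0 : ℝ) • v) 5, (p + (0 : ℝ) • v) 6) := by
      simpa using hG.hasFDerivAt
    exact h2.comp_hasDerivAt (0 : ℝ) h1
  have hrow : ∀ i : Fin 7, (∀ q ∈ Ω, 𝒯 q i = q i / G (q 5, q 6)) → ∀ v : ExtSpace,
      fderiv ℝ 𝒯 p v i * G (p 5, p 6) ^ 2 = v i * G (p 5, p 6) - p i * A (v 5, v 6) := by
    intro i hi v
    rw [fderiv_apply_eq_pd hTd, pd_congr hΩ hi v p hp]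
    have h1 : HasDerivAt (fun s : ℝ => (p + s • v) i) (v i) 0 := by
      simpa using ((hasDerivAt_id (0 : ℝ)).mul_const (v i)).const_add (p i)
    have h2 := h1.fun_div (hline v) (by simpa using hG0)
    have h3 : ContDiffAt ℝ ∞ (fun q => q i / G (q 5, q 6)) p :=
      (hs i).congr_of_eventuallyEq
        (by filter_upwards [hΩ.mem_nhds hp] with q hq using (hi q hq).symm)
    rw [pd_eq_of_hasDerivAt h3 h2]
    simp only [zero_smul, add_zero]
    rw [div_mul_cancel₀ _ (pow_ne_zero 2 hG0)]
  have hlin : ∀ x y : ℝ, A (x, y) = x * A (1, 0) + y * A (0, 1) := by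
    intro x y
    have : ((x, y) : ℝ × ℝ) = x • (1, 0) + y • (0, 1) := by simp
    rw [this, map_add, map_smul, map_smul]
    simp
  -- If the condition fails, the covector (∂_n δ₃, ∂_m δ₃) annihilates the (n, m)-part of the image
  -- of the differential. Surjectivity allows this image to be the same vector, whose sum of squares
  -- must then vanish. The other rows play no role.
  obtain ⟨v, hv⟩ : ∃ v, fderiv ℝ 𝒯 p v =
      A (1, 0) • (Pi.single 5 1 : ExtSpace) + A (0, 1) • (Pi.single 6 1 : ExtSpace) := by
    have := ((fderiv ℝ 𝒯 p).toContinuousLinearEquivOfDetNeZero hdet).surjective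
      (A (1, 0) • (Pi.single 5 1 : ExtSpace) + A (0, 1) • (Pi.single 6 1 : ExtSpace))
    simpa using this
  have r5 := hrow 5 h5 v
  have r6 := hrow 6 h6 v
  rw [hv, hlin (v 5) (v 6)] at r5 r6
  simp at r5 r6
  rw [hlin (p 5) (p 6)] at hbad
  have hsum : (A (1, 0) ^ 2 + A (0, 1) ^ 2) * G (p 5, p 6) ^ 2 = 0 := by
    linear_combination A (1, 0) * r5 + A (0, 1) * r6 -
      (v 5 * A (1, 0) + v 6 * A (0, 1)) * hbad
  have hz := (mul_eq_zero.1 hsum).resolve_right (pow_ne_zero 2 hG0)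
  have ha : A (1, 0) = 0 := by nlinarith [sq_nonneg (A (1, 0)), sq_nonneg (A (0, 1))]
  have hb : A (0, 1) = 0 := by nlinarith [sq_nonneg (A (1, 0)), sq_nonneg (A (0, 1))]
  rw [ha, hb] at hbad
  simp at hbad
  exact hG0 hbad.symm

open DeterminingEquations in
/-- Every generalized equivalence transformation belongs to the family. -/
theorem IsGeneralizedEquivalence.exists_params {Ω : Set ExtSpace} {𝒯 : ExtSpace → ExtSpace}
    (hGE : IsGeneralizedEquivalence Ω 𝒯) (hΩ : IsOpen Ω) (hsub : Ω ⊆ classSpace)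
    (hconn : ∀ n m : ℝ, IsPreconnected {p : ExtSpace | p ∈ Ω ∧ p 5 = n ∧ p 6 = m}) :
    ∃ δ : ℝ × ℝ → Params, SmoothParamsOn δ (paramValues Ω) ∧
      (∀ w ∈ paramValues Ω, (δ w).Valid ∧ fderiv ℝ (fun w' => (δ w').d3) w w ≠ (δ w).d3) ∧
      ∀ p ∈ Ω, p ∈ (δ (p 5, p 6)).maxDomain ∧ 𝒯 p = (δ (p 5, p 6)).toMap p := by
  have h := hGE.determiningEquations hΩ hsub
  have hT := hGE.1
  have hs := contDiffOn_pi.1 hT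
  have hLs := contDiffOn_lden hs
  have hMs := contDiffOn_lnum hs
  -- The parameters are slopes and intercepts of affine functions: δ₁, δ₂ of T in t, then δ₄, δ₅ of
  -- L and δ₆, δ₇ of X L in x; δ₃ is n/ñ.
  obtain ⟨f1, f2⟩ := flat_sub_mul (k := 0) hΩ (hs 0)
    (by
      intro p hp j h5 h6 h0
      obtain ⟨t1, t2, t3, t4⟩ := h.time p hp
      fin_cases j
      · exact absurd rfl h0
      · exact t1
      · exact t2
      · exact t3
      · exact t4
      · exact absurd rfl h5
      · exact absurd rfl h6)
    (fun p hp => h.pd_pd_time hΩ hsub hT hp)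
  obtain ⟨f4, f5⟩ := flat_sub_mul (k := 1) hΩ hLs
    (fun p hp => (h.pd_lden hΩ hsub hT hp).2) (fun p hp => h.pd_pd_lden hΩ hsub hT hp)
  obtain ⟨f6, f7⟩ := flat_sub_mul (k := 1) hΩ hMs
    (fun p hp => (h.pd_lnum hΩ hsub hT hp).2) (fun p hp => h.pd_pd_lnum hΩ hsub hT hp)
  have f3 := h.ratio_flat hΩ hs
  have cc := fun k : Fin 7 => (contDiff_coord k).contDiffOn (s := Ω)
  have s1 := contDiffOn_pd hΩ (hs 0) (Pi.single 0 1)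
  have s4 := contDiffOn_pd hΩ hLs (Pi.single 1 1)
  have s6 := contDiffOn_pd hΩ hMs (Pi.single 1 1)
  obtain ⟨G1, g1, e1⟩ := exists_descend hΩ hconn s1 f1.pd_eq_zero
  obtain ⟨G2, g2, e2⟩ := exists_descend hΩ hconn ((hs 0).sub ((cc 0).mul s1)) f2.pd_eq_zero
  obtain ⟨G3, g3, e3⟩ := exists_descend hΩ hconn ((cc 5).div (hs 5) h.n_ne) f3.pd_eq_zero
  replace e3 : ∀ p ∈ Ω, G3 (p 5, p 6) = p 5 / 𝒯 p 5 := e3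
  obtain ⟨G4, g4, e4⟩ := exists_descend hΩ hconn s4 f4.pd_eq_zero
  obtain ⟨G5, g5, e5⟩ := exists_descend hΩ hconn (hLs.sub ((cc 1).mul s4)) f5.pd_eq_zero
  obtain ⟨G6, g6, e6⟩ := exists_descend hΩ hconn s6 f6.pd_eq_zero
  obtain ⟨G7, g7, e7⟩ := exists_descend hΩ hconn (hMs.sub ((cc 1).mul s6)) f7.pd_eq_zero
  let δ : ℝ × ℝ → Params := fun w => ⟨G1 w, G2 w, G3 w, G4 w, G5 w, G6 w, G7 w⟩
  -- Among the two sign choices for (δ₄, …, δ₇) this construction takes the one with positive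
  -- denominator, so the absolute values disappear.
  have hLpos : ∀ p, 0 < lden 𝒯 p := fun p => Real.exp_pos _
  have hden : ∀ p ∈ Ω, (δ (p 5, p 6)).den (p 1) = lden 𝒯 p := by
    intro p hp
    simp only [δ, Params.den, e4 p hp, e5 p hp]; ring
  have hnum : ∀ p ∈ Ω, (δ (p 5, p 6)).d6 * p 1 + (δ (p 5, p 6)).d7 = lnum 𝒯 p := by
    intro p hp
    simp only [δ, e6 p hp, e7 p hp]; ring
  -- Δ is the Wronskian L (X L)_x - L_x (X L) = X_x L².
  have hdisc : ∀ p ∈ Ω, (δ (p 5, p 6)).disc = pj 𝒯 1 1 p * lden 𝒯 p ^ 2 := by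
    intro p hp
    simp only [δ, Params.disc, e4 p hp, e5 p hp, e6 p hp, e7 p hp,
      (h.pd_lnum hΩ hsub hT hp).1, lnum]
    ring
  have hd3 : ∀ p ∈ Ω, G3 (p 5, p 6) ≠ 0 := by
    intro p hp
    rw [e3 p hp]
    exact div_ne_zero (hsub hp).2 (h.n_ne p hp)
  have hr5 : ∀ p ∈ Ω, 𝒯 p 5 = p 5 / G3 (p 5, p 6) := by
    intro p hp
    have := (hsub hp).2
    rw [e3 p hp, div_div_cancel₀ this]
  have hr6 : ∀ p ∈ Ω, 𝒯 p 6 = p 6 / G3 (p 5, p 6) := by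
    intro p hp
    have h0 := (hsub hp).2
    have hN := h.n_ne p hp
    have := (h.separated hΩ hsub hT hp).2.2.1
    rw [e3 p hp]
    field_simp
    linear_combination this
  refine ⟨δ, ⟨g1, g2, g3, g4, g5, g6, g7⟩, ?_, ?_⟩
  · rintro _ ⟨p, hp, rfl⟩
    refine ⟨⟨mul_ne_zero ?_ (hd3 p hp), ?_⟩, ?_⟩
    · change G1 (p 5, p 6) ≠ 0
      rw [e1 p hp]
      exact h.time_ne p hp
    · rw [hdisc p hp]
      exact mul_ne_zero (h.space_ne p hp) (pow_ne_zero 2 (hLpos p).ne')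
    · exact fderiv_ne_of_nondegenerate hΩ hT hp (hGE.2.1 p hp)
        ((g3.contDiffAt ((isOpen_paramValues hΩ).mem_nhds ⟨p, hp, rfl⟩)).differentiableAt (by simp))
        (hd3 p hp) hr5 hr6
  · intro p hp
    have hn : p 5 ≠ 0 := (hsub hp).2
    have hN := h.n_ne p hp
    have hX := h.space_ne p hp
    have hL := (hLpos p).ne'
    refine ⟨⟨hsub hp, by rw [hden p hp]; exact hL⟩, ?_⟩
    ext i
    fin_cases i
    · change 𝒯 p 0 = G1 (p 5, p 6) * p 0 + G2 (p 5, p 6)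
      rw [e1 p hp, e2 p hp]; ring
    · change 𝒯 p 1 = ((δ (p 5, p 6)).d6 * p 1 + (δ (p 5, p 6)).d7) / (δ (p 5, p 6)).den (p 1)
      rw [hnum p hp, hden p hp, lnum, mul_div_cancel_right₀ _ hL]
    · change 𝒯 p 2 = G3 (p 5, p 6) * p 2 - G3 (p 5, p 6) / p 5 *
        Real.log |(δ (p 5, p 6)).den (p 1)|
      rw [hden p hp, abs_of_pos (hLpos p), lden, Real.log_exp, shift, e3 p hp]
      field_simp
      ring
    · change 𝒯 p 3 = G1 (p 5, p 6) / (δ (p 5, p 6)).disc ^ 2 *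
        |(δ (p 5, p 6)).den (p 1)| ^ 3 * p 3
      rw [hden p hp, abs_of_pos (hLpos p), hdisc p hp, e1 p hp]
      change 𝒯 p 3 = pj 𝒯 0 0 p / _ * _ * _
      rw [h.time_eq hsub hp]
      have := (hsub hp).1
      field_simp
    · change 𝒯 p 4 = G3 (p 5, p 6) / (δ (p 5, p 6)).disc ^ 2 *
        |(δ (p 5, p 6)).den (p 1)| ^ (p 6 / p 5 + 3) * p 4
      rw [hden p hp, abs_of_pos (hLpos p), hdisc p hp, e3 p hp]
      obtain ⟨-, -, hm, hh⟩ := h.separated hΩ hsub hT hp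
      -- The separated equation gives the power m/n - 1 of L, divided by X_x². Since Δ² = X_x² L⁴,
      -- writing this with Δ² adds four to the exponent.
      have hpow : lden 𝒯 p ^ (p 6 / p 5 + 3) = lden 𝒯 p ^ (p 6 / p 5 - 1) * lden 𝒯 p ^ 4 := by
        rw [← Real.rpow_natCast, ← Real.rpow_add (hLpos p)]
        congr 1
        push_cast; ring
      have hexp : Real.exp (𝒯 p 6 * 𝒯 p 2) * Real.exp (-(𝒯 p 5 * 𝒯 p 2)) *
          lden 𝒯 p ^ (p 6 / p 5 - 1) = Real.exp (p 6 * p 2) * Real.exp (-(p 5 * p 2)) := by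
        rw [lden, ← Real.exp_mul, ← Real.exp_add, ← Real.exp_add, ← Real.exp_add, shift]
        congr 1
        have : 𝒯 p 6 = p 6 / p 5 * 𝒯 p 5 := by field_simp; linear_combination hm
        rw [this]
        field_simp
        ring
      rw [← hexp] at hh
      have hne : Real.exp (𝒯 p 6 * 𝒯 p 2) * Real.exp (-(𝒯 p 5 * 𝒯 p 2)) ≠ 0 :=
        mul_ne_zero (Real.exp_ne_zero _) (Real.exp_ne_zero _)
      have hh' : pj 𝒯 1 1 p ^ 2 * 𝒯 p 4 =
          p 5 / 𝒯 p 5 * p 4 * lden 𝒯 p ^ (p 6 / p 5 - 1) := by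
        apply mul_right_cancel₀ hne
        linear_combination hh
      have hT4 : 𝒯 p 4 = p 5 / 𝒯 p 5 * p 4 * lden 𝒯 p ^ (p 6 / p 5 - 1) / pj 𝒯 1 1 p ^ 2 := by
        rw [← hh', mul_div_cancel_left₀ _ (pow_ne_zero 2 hX)]
      rw [hT4, hpow]
      field_simp
    · exact hr5 p hp
    · exact hr6 p hp

/-! ### The family consists of equivalence transformations -/

theorem contDiffAt_toMap {δ : ℝ × ℝ → Params} {p : ExtSpace} (hn : p 5 ≠ 0)
    (hv : (δ (p 5, p 6)).Valid) (hden : (δ (p 5, p 6)).den (p 1) ≠ 0)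
    (h1 : ContDiffAt ℝ ∞ (fun w => (δ w).d1) (p 5, p 6))
    (h2 : ContDiffAt ℝ ∞ (fun w => (δ w).d2) (p 5, p 6))
    (h3 : ContDiffAt ℝ ∞ (fun w => (δ w).d3) (p 5, p 6))
    (h4 : ContDiffAt ℝ ∞ (fun w => (δ w).d4) (p 5, p 6))
    (h5 : ContDiffAt ℝ ∞ (fun w => (δ w).d5) (p 5, p 6))
    (h6 : ContDiffAt ℝ ∞ (fun w => (δ w).d6) (p 5, p 6))
    (h7 : ContDiffAt ℝ ∞ (fun w => (δ w).d7) (p 5, p 6)) :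
    ContDiffAt ℝ ∞ (fun q : ExtSpace => (δ (q 5, q 6)).toMap q) p := by
  have hπ : ContDiffAt ℝ ∞ (fun q : ExtSpace => (q 5, q 6)) p := by fun_prop
  have hc : ∀ {g : ℝ × ℝ → ℝ}, ContDiffAt ℝ ∞ g (p 5, p 6) →
      ContDiffAt ℝ ∞ (fun q : ExtSpace => g (q 5, q 6)) p :=
    fun {g} hg => ContDiffAt.comp (g := g) (f := fun q : ExtSpace => (q 5, q 6)) p hg hπ
  replace h1 := hc h1
  replace h2 := hc h2
  replace h3 := hc h3
  replace h4 := hc h4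
  replace h5 := hc h5
  replace h6 := hc h6
  replace h7 := hc h7
  have c := fun k => (contDiff_coord k).contDiffAt (x := p)
  have hd3 : (δ (p 5, p 6)).d3 ≠ 0 := right_ne_zero_of_mul hv.1
  have hdisc : ContDiffAt ℝ ∞ (fun q : ExtSpace => (δ (q 5, q 6)).disc) p :=
    (h5.mul h6).sub (h4.mul h7)
  have hdenS : ContDiffAt ℝ ∞ (fun q : ExtSpace => (δ (q 5, q 6)).den (q 1)) p :=
    (h4.mul (c 1)).add h5
  have habs : ContDiffAt ℝ ∞ (fun q : ExtSpace => |(δ (q 5, q 6)).den (q 1)|) p :=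
    hdenS.abs hden
  have habs0 : |(δ (p 5, p 6)).den (p 1)| ≠ 0 := abs_ne_zero.2 hden
  have hdisc0 : (δ (p 5, p 6)).disc ^ 2 ≠ 0 := pow_ne_zero 2 hv.2
  rw [contDiffAt_pi]
  intro i
  fin_cases i
  · exact (h1.mul (c 0)).add h2
  · exact ((h6.mul (c 1)).add h7).div hdenS hden
  · exact (h3.mul (c 2)).sub ((h3.div (c 5) hn).mul (habs.log habs0))
  · exact ((h1.div (hdisc.pow 2) hdisc0).mul (habs.pow 3)).mul (c 3)
  · exact ((h3.div (hdisc.pow 2) hdisc0).mul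
      (habs.rpow (((c 6).div (c 5) hn).add contDiffAt_const) habs0)).mul (c 4)
  · exact (c 5).div h3 hd3
  · exact (c 6).div h3 hd3

theorem hasDerivAt_linearFractional (δ : Params) {x : ℝ} (hx : δ.den x ≠ 0) :
    HasDerivAt (fun x => (δ.d6 * x + δ.d7) / δ.den x) (δ.disc / δ.den x ^ 2) x := by
  have h1 : HasDerivAt (fun x => δ.d6 * x + δ.d7) δ.d6 x := by
    simpa using ((hasDerivAt_id x).const_mul δ.d6).add_const δ.d7
  have h2 : HasDerivAt δ.den δ.d4 x := by
    unfold Params.den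
    simpa using ((hasDerivAt_id x).const_mul δ.d4).add_const δ.d5
  refine (h1.fun_div h2 hx).congr_deriv ?_
  simp only [Params.den, Params.disc]; ring

/-- A map which belongs to the family for every `(n, m)` is nondegenerate. -/
theorem det_ne_zero_of_params {Ω : Set ExtSpace} (hΩ : IsOpen Ω) {𝒯 : ExtSpace → ExtSpace}
    (hT : ContDiffOn ℝ ∞ 𝒯 Ω) {δ : ℝ × ℝ → Params}
    (hδ : ∀ q ∈ Ω, 𝒯 q = (δ (q 5, q 6)).toMap q) {p : ExtSpace} (hp : p ∈ Ω)
    (hv : (δ (p 5, p 6)).Valid) (hden : (δ (p 5, p 6)).den (p 1) ≠ 0)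
    (h3 : DifferentiableAt ℝ (fun w => (δ w).d3) (p 5, p 6))
    (hnd : fderiv ℝ (fun w => (δ w).d3) (p 5, p 6) (p 5, p 6) ≠ (δ (p 5, p 6)).d3) :
    (fderiv ℝ 𝒯 p).det ≠ 0 := by
  have hTd : DifferentiableAt ℝ 𝒯 p := (hT.contDiffAt (hΩ.mem_nhds hp)).differentiableAt (by simp)
  have hs := fun i => (contDiffOn_pi.1 hT i).contDiffAt (hΩ.mem_nhds hp)
  have hd1 : (δ (p 5, p 6)).d1 ≠ 0 := left_ne_zero_of_mul hv.1
  have hd3 : (δ (p 5, p 6)).d3 ≠ 0 := right_ne_zero_of_mul hv.1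
  intro hdet
  obtain ⟨v, hv0, hvne⟩ := Submodule.exists_mem_ne_zero_of_ne_bot
    (LinearMap.bot_lt_ker_of_det_eq_zero hdet).ne'
  have hv0' : fderiv ℝ 𝒯 p v = 0 := hv0
  have hrow : ∀ i, HasDerivAt (fun s : ℝ => 𝒯 (p + s • v) i) 0 0 := by
    intro i
    have := hasDerivAt_line_zero (hs i) v
    rwa [← fderiv_apply_eq_pd hTd, hv0', Pi.zero_apply] at this
  have hmem := eventually_line_mem hΩ hp v
  have hline : HasDerivAt (fun s : ℝ => (δ ((p + s • v) 5, (p + s • v) 6)).d3)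
      (fderiv ℝ (fun w => (δ w).d3) (p 5, p 6) (v 5, v 6)) 0 := by
    have h1 : HasDerivAt (fun s : ℝ => ((p + s • v) 5, (p + s • v) 6)) (v 5, v 6) 0 := by
      refine HasDerivAt.prodMk ?_ ?_
      · simpa using ((hasDerivAt_id (0 : ℝ)).mul_const (v 5)).const_add (p 5)
      · simpa using ((hasDerivAt_id (0 : ℝ)).mul_const (v 6)).const_add (p 6)
    have h2 : HasFDerivAt (fun w => (δ w).d3) (fderiv ℝ (fun w => (δ w).d3) (p 5, p 6))
        ((p + (0 : ℝ) • v) 5, (p + (0 : ℝ) • v) 6) := by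
      simpa using h3.hasFDerivAt
    exact h2.comp_hasDerivAt (0 : ℝ) h1
  set A := fderiv ℝ (fun w => (δ w).d3) (p 5, p 6)
  have hrow56 : ∀ i : Fin 7, (∀ q ∈ Ω, 𝒯 q i = q i / (δ (q 5, q 6)).d3) →
      v i * (δ (p 5, p 6)).d3 = p i * A (v 5, v 6) := by
    intro i hi
    have h1 : HasDerivAt (fun s : ℝ => (p + s • v) i) (v i) 0 := by
      simpa using ((hasDerivAt_id (0 : ℝ)).mul_const (v i)).const_add (p i)
    have h2 := h1.fun_div hline (by simpa using hd3)
    have h4 := (hrow i).congr_of_eventuallyEq (f₁ := fun s : ℝ => (p + s • v) i /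
      (δ ((p + s • v) 5, (p + s • v) 6)).d3)
      (by filter_upwards [hmem] with s hs using (hi _ hs).symm)
    have h5 := h2.unique h4
    simp only [zero_smul, add_zero] at h5
    rw [div_eq_zero_iff] at h5
    have := h5.resolve_right (pow_ne_zero 2 hd3)
    linarith
  have r5 := hrow56 5 fun q hq => congrFun (hδ q hq) 5
  have r6 := hrow56 6 fun q hq => congrFun (hδ q hq) 6
  -- For a kernel vector the last two rows give δ₃ (v₅, v₆) = A(v₅, v₆) (n, m), where A is the
  -- differential of δ₃. Applying A and using A(n, m) ≠ δ₃ forces A(v₅, v₆) = 0.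
  have hA0 : A (v 5, v 6) = 0 := by
    have e1 : (δ (p 5, p 6)).d3 • ((v 5, v 6) : ℝ × ℝ) = A (v 5, v 6) • (p 5, p 6) := by
      simp only [Prod.smul_mk, smul_eq_mul, Prod.mk.injEq]
      exact ⟨by linarith, by linarith⟩
    have e2 := congrArg A e1
    rw [map_smul, map_smul, smul_eq_mul, smul_eq_mul] at e2
    by_contra hne
    apply hnd
    apply mul_left_cancel₀ hne
    linear_combination -e2
  have hv5 : v 5 = 0 := by
    rw [hA0, mul_zero] at r5; exact (mul_eq_zero.1 r5).resolve_right hd3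
  have hv6 : v 6 = 0 := by
    rw [hA0, mul_zero] at r6; exact (mul_eq_zero.1 r6).resolve_right hd3
  -- Along the kernel direction n and m, and so all parameters, are now frozen. The remaining rows
  -- are triangular: once the x-component vanishes, so do those of u, f and h.
  have q5 : ∀ s : ℝ, (p + s • v) 5 = p 5 := by intro s; simp [hv5]
  have q6 : ∀ s : ℝ, (p + s • v) 6 = p 6 := by intro s; simp [hv6]
  set d := δ (p 5, p 6)
  have hrow' : ∀ i, HasDerivAt (fun s : ℝ => d.toMap (p + s • v) i) 0 0 := by
    intro i
    refine (hrow i).congr_of_eventuallyEq ?_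
    filter_upwards [hmem] with s hs
    rw [hδ _ hs, q5, q6]
  have hcoord : ∀ i, HasDerivAt (fun s : ℝ => (p + s • v) i) (v i) 0 := fun i => by
    simpa using ((hasDerivAt_id (0 : ℝ)).mul_const (v i)).const_add (p i)
  have v0 : v 0 = 0 := by
    have := (((hcoord 0).const_mul d.d1).add_const d.d2).unique (hrow' 0)
    exact (mul_eq_zero.1 this).resolve_left hd1
  have v1 : v 1 = 0 := by
    have h1 := HasDerivAt.comp (h := fun s : ℝ => (p + s • v) 1) 0
      (hasDerivAt_linearFractional d (x := (p + (0 : ℝ) • v) 1) (by simpa using hden)) (hcoord 1)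
    have := h1.unique (hrow' 1)
    refine (mul_eq_zero.1 this).resolve_left (div_ne_zero hv.2 ?_)
    simpa using hden
  have q1 : ∀ s : ℝ, (p + s • v) 1 = p 1 := by intro s; simp [v1]
  have hdeneq : ∀ s : ℝ, d.den ((p + s • v) 1) = d.den (p 1) := fun s => by rw [q1]
  have v2 : v 2 = 0 := by
    have h1 := ((hcoord 2).const_mul d.d3).sub_const (d.d3 / p 5 * Real.log |d.den (p 1)|)
    have h2 := hrow' 2
    have : (fun s : ℝ => d.toMap (p + s • v) 2) = fun s : ℝ => d.d3 * (p + s • v) 2 -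
        d.d3 / p 5 * Real.log |d.den (p 1)| := by
      funext s
      change d.d3 * (p + s • v) 2 - d.d3 / (p + s • v) 5 * Real.log |d.den ((p + s • v) 1)| = _
      rw [q5, hdeneq]
    rw [this] at h2
    exact (mul_eq_zero.1 (h1.unique h2)).resolve_left hd3
  have v3 : v 3 = 0 := by
    have h1 := (hcoord 3).const_mul (d.d1 / d.disc ^ 2 * |d.den (p 1)| ^ 3)
    have h2 := hrow' 3
    have : (fun s : ℝ => d.toMap (p + s • v) 3) = fun s : ℝ =>
        d.d1 / d.disc ^ 2 * |d.den (p 1)| ^ 3 * (p + s • v) 3 := by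
      funext s
      change d.d1 / d.disc ^ 2 * |d.den ((p + s • v) 1)| ^ 3 * (p + s • v) 3 = _
      rw [hdeneq]
    rw [this] at h2
    exact (mul_eq_zero.1 (h1.unique h2)).resolve_left (mul_ne_zero
      (div_ne_zero hd1 (pow_ne_zero 2 hv.2)) (pow_ne_zero 3 (abs_ne_zero.2 hden)))
  have v4 : v 4 = 0 := by
    have h1 := (hcoord 4).const_mul (d.d3 / d.disc ^ 2 * |d.den (p 1)| ^ (p 6 / p 5 + 3))
    have h2 := hrow' 4
    have : (fun s : ℝ => d.toMap (p + s • v) 4) = fun s : ℝ =>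
        d.d3 / d.disc ^ 2 * |d.den (p 1)| ^ (p 6 / p 5 + 3) * (p + s • v) 4 := by
      funext s
      change d.d3 / d.disc ^ 2 * |d.den ((p + s • v) 1)| ^ ((p + s • v) 6 / (p + s • v) 5 + 3) *
        (p + s • v) 4 = _
      rw [hdeneq, q5, q6]
    rw [this] at h2
    exact (mul_eq_zero.1 (h1.unique h2)).resolve_left (mul_ne_zero
      (div_ne_zero hd3 (pow_ne_zero 2 hv.2))
      (Real.rpow_pos_of_pos (abs_pos.2 hden) _).ne')
  apply hvne
  ext i
  fin_cases i
  · exact v0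
  · exact v1
  · exact v2
  · exact v3
  · exact v4
  · exact hv5
  · exact hv6

theorem Params.inv_den_apply {δ : Params} (h : δ.Valid) {x : ℝ} (hx : δ.den x ≠ 0) :
    δ.inv.den ((δ.d6 * x + δ.d7) / δ.den x) = (δ.den x)⁻¹ := by
  have h1 := den_comp (δ' := δ.inv) hx
  rw [comp_inv_self h] at h1
  have h2 : one.den x = 1 := by simp [one, den]
  rw [h2] at h1
  exact eq_inv_of_mul_eq_one_left h1.symm

theorem Params.inv_apply {δ : Params} (h : δ.Valid) {x : ℝ} (hx : δ.den x ≠ 0) :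
    (δ.inv.d6 * ((δ.d6 * x + δ.d7) / δ.den x) + δ.inv.d7) /
      δ.inv.den ((δ.d6 * x + δ.d7) / δ.den x) = x := by
  have hd := h.2
  rw [inv_den_apply h hx]
  simp only [inv]
  field_simp
  simp only [disc, den]
  ring

/-- The equation to which `θ` is mapped by the transformation with the parameters `δ`. -/
noncomputable def Equation.image (θ : Equation) (δ : Params) (hδ : δ.Valid) : Equation where
  I := {y | δ.inv.den y ≠ 0 ∧ (δ.inv.d6 * y + δ.inv.d7) / δ.inv.den y ∈ θ.I}
  f := fun y => δ.d1 / δ.disc ^ 2 * |δ.inv.den y|⁻¹ ^ 3 *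
    θ.f ((δ.inv.d6 * y + δ.inv.d7) / δ.inv.den y)
  h := fun y => δ.d3 / δ.disc ^ 2 * |δ.inv.den y|⁻¹ ^ (θ.m / θ.n + 3) *
    θ.h ((δ.inv.d6 * y + δ.inv.d7) / δ.inv.den y)
  n := θ.n / δ.d3
  m := θ.m / δ.d3
  isOpen_I := by
    have h1 : IsOpen {y | δ.inv.den y ≠ 0} :=
      isOpen_ne_fun (by unfold Params.den; fun_prop) continuous_const
    have h2 : ContinuousOn (fun y => (δ.inv.d6 * y + δ.inv.d7) / δ.inv.den y)
        {y | δ.inv.den y ≠ 0} :=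
      ContinuousOn.div (by fun_prop) (by unfold Params.den; fun_prop) fun y hy => hy
    exact h2.isOpen_inter_preimage h1 θ.isOpen_I
  smooth_f := by
    rintro y ⟨hy, hyI⟩
    have h1 : ContDiffAt ℝ ∞ δ.inv.den y := by unfold Params.den; fun_prop
    have h2 : ContDiffAt ℝ ∞ (fun y => (δ.inv.d6 * y + δ.inv.d7) / δ.inv.den y) y :=
      ContDiffAt.div (by fun_prop) h1 hy
    have h3 : ContDiffAt ℝ ∞ (fun y => |δ.inv.den y|⁻¹) y :=
      (h1.abs hy).inv (abs_ne_zero.2 hy)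
    exact ((contDiffAt_const.mul (h3.pow 3)).mul
      (ContDiffAt.comp y (θ.smooth_f.contDiffAt (θ.isOpen_I.mem_nhds hyI)) h2)).contDiffWithinAt
  smooth_h := by
    rintro y ⟨hy, hyI⟩
    have h1 : ContDiffAt ℝ ∞ δ.inv.den y := by unfold Params.den; fun_prop
    have h2 : ContDiffAt ℝ ∞ (fun y => (δ.inv.d6 * y + δ.inv.d7) / δ.inv.den y) y :=
      ContDiffAt.div (by fun_prop) h1 hy
    have h3 : ContDiffAt ℝ ∞ (fun y => |δ.inv.den y|⁻¹) y :=
      (h1.abs hy).inv (abs_ne_zero.2 hy)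
    exact ((contDiffAt_const.mul (h3.rpow contDiffAt_const (inv_ne_zero (abs_ne_zero.2 hy)))).mul
      (ContDiffAt.comp y (θ.smooth_h.contDiffAt (θ.isOpen_I.mem_nhds hyI)) h2)).contDiffWithinAt
  f_ne := by
    rintro y ⟨hy, hyI⟩
    exact mul_ne_zero (mul_ne_zero (div_ne_zero (left_ne_zero_of_mul hδ.1) (pow_ne_zero 2 hδ.2))
      (pow_ne_zero 3 (inv_ne_zero (abs_ne_zero.2 hy)))) (θ.f_ne _ hyI)
  n_ne := div_ne_zero θ.n_ne (right_ne_zero_of_mul hδ.1)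

theorem Equation.image_apply (θ : Equation) {δ : Params} (hδ : δ.Valid) {x : ℝ} (hx : x ∈ θ.I)
    (hden : δ.den x ≠ 0) :
    (δ.d6 * x + δ.d7) / δ.den x ∈ (θ.image δ hδ).I ∧
    (θ.image δ hδ).f ((δ.d6 * x + δ.d7) / δ.den x) =
      δ.d1 / δ.disc ^ 2 * |δ.den x| ^ 3 * θ.f x ∧
    (θ.image δ hδ).h ((δ.d6 * x + δ.d7) / δ.den x) =
      δ.d3 / δ.disc ^ 2 * |δ.den x| ^ (θ.m / θ.n + 3) * θ.h x := by
  have h1 := Params.inv_den_apply hδ hden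
  have h2 := Params.inv_apply hδ hden
  refine ⟨⟨?_, ?_⟩, ?_, ?_⟩
  · rw [h1]; exact inv_ne_zero hden
  · rw [h2]; exact hx
  · simp only [Equation.image]
    rw [h2, h1, abs_inv, inv_inv]
  · simp only [Equation.image]
    rw [h2, h1, abs_inv, inv_inv]

/-- The transformation of `(t, x, u)` with the parameters `δ`, for the given value of `n`. -/
noncomputable def Params.pointMap (δ : Params) (n : ℝ) (v : Fin 3 → ℝ) : Fin 3 → ℝ :=
  ![δ.d1 * v 0 + δ.d2, (δ.d6 * v 1 + δ.d7) / δ.den (v 1),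
    δ.d3 * v 2 - δ.d3 / n * Real.log |δ.den (v 1)|]

theorem Params.contDiffAt_pointMap {δ : Params} {n : ℝ} {v : Fin 3 → ℝ} (hden : δ.den (v 1) ≠ 0) :
    ContDiffAt ℝ ∞ (δ.pointMap n) v := by
  have h1 : ContDiffAt ℝ ∞ (fun v : Fin 3 → ℝ => δ.den (v 1)) v := by unfold Params.den; fun_prop
  have h2 : ContDiffAt ℝ ∞ (fun v : Fin 3 → ℝ => |δ.den (v 1)|) v :=
    h1.abs hden
  rw [contDiffAt_pi]
  intro i
  fin_cases i
  · change ContDiffAt ℝ ∞ (fun v : Fin 3 → ℝ => δ.d1 * v 0 + δ.d2) v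
    fun_prop
  · change ContDiffAt ℝ ∞ (fun v : Fin 3 → ℝ => (δ.d6 * v 1 + δ.d7) / δ.den (v 1)) v
    exact ContDiffAt.div (by fun_prop) h1 hden
  · change ContDiffAt ℝ ∞
      (fun v : Fin 3 → ℝ => δ.d3 * v 2 - δ.d3 / n * Real.log |δ.den (v 1)|) v
    exact ContDiffAt.sub (by fun_prop) (contDiffAt_const.mul (h2.log (abs_ne_zero.2 hden)))

theorem Params.pd_pointMap {δ : Params} {n : ℝ} {v : Fin 3 → ℝ} (hden : δ.den (v 1) ≠ 0)
    (ν : Fin 3 → ℝ) :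
    pd (fun v => δ.pointMap n v 0) ν v = δ.d1 * ν 0 ∧
    pd (fun v => δ.pointMap n v 1) ν v = δ.disc / δ.den (v 1) ^ 2 * ν 1 ∧
    pd (fun v => δ.pointMap n v 2) ν v = δ.d3 * ν 2 - δ.d3 / n * (δ.d4 / δ.den (v 1) * ν 1) := by
  have hs := contDiffAt_pi.1 (contDiffAt_pointMap (n := n) hden)
  have hcoord : ∀ i, HasDerivAt (fun s : ℝ => (v + s • ν) i) (ν i) 0 := fun i => by
    simpa using ((hasDerivAt_id (0 : ℝ)).mul_const (ν i)).const_add (v i)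
  have hden0 : δ.den ((v + (0 : ℝ) • ν) 1) ≠ 0 := by simpa using hden
  have hd : HasDerivAt (fun s : ℝ => δ.den ((v + s • ν) 1)) (δ.d4 * ν 1) 0 :=
    ((hcoord 1).const_mul δ.d4).add_const δ.d5
  refine ⟨pd_eq_of_hasDerivAt (hs 0) (((hcoord 0).const_mul δ.d1).add_const δ.d2), ?_, ?_⟩
  · refine pd_eq_of_hasDerivAt (hs 1) ?_
    have h1 := HasDerivAt.comp (h := fun s : ℝ => (v + s • ν) 1) 0
      (hasDerivAt_linearFractional δ hden0) (hcoord 1)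
    exact h1.congr_deriv (by simp)
  · refine pd_eq_of_hasDerivAt (hs 2) ?_
    have h1 : HasDerivAt (fun s : ℝ => Real.log |δ.den ((v + s • ν) 1)|)
        (δ.d4 * ν 1 / δ.den (v 1)) 0 := by
      simp only [Real.log_abs]
      simpa using hd.log hden0
    refine (((hcoord 2).const_mul δ.d3).sub (h1.const_mul (δ.d3 / n))).congr_deriv ?_
    ring

theorem Params.pd_pd_pointMap {δ : Params} {n b : ℝ} {v : Fin 3 → ℝ} {D : Set (Fin 3 → ℝ)}
    (hD : IsOpen D) (hDd : ∀ v ∈ D, δ.den (v 1) ≠ 0) (hv : v ∈ D) :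
    pd (pd (fun v => δ.pointMap n v 0) ![0, 1, b]) ![0, 1, b] v = 0 ∧
    pd (pd (fun v => δ.pointMap n v 1) ![0, 1, b]) ![0, 1, b] v =
      -(2 * δ.disc * δ.d4 / δ.den (v 1) ^ 3) ∧
    pd (pd (fun v => δ.pointMap n v 2) ![0, 1, b]) ![0, 1, b] v =
      δ.d3 / n * (δ.d4 ^ 2 / δ.den (v 1) ^ 2) := by
  have hden := hDd v hv
  have hcoord : HasDerivAt (fun s : ℝ => (v + s • (![0, 1, b] : Fin 3 → ℝ)) 1) 1 0 := by
    simpa using (hasDerivAt_id (0 : ℝ)).const_add (v 1)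
  have hden0 : δ.den ((v + (0 : ℝ) • (![0, 1, b] : Fin 3 → ℝ)) 1) ≠ 0 := by simpa using hden
  have hd : HasDerivAt (fun s : ℝ => δ.den ((v + s • (![0, 1, b] : Fin 3 → ℝ)) 1)) δ.d4 0 := by
    simpa [Params.den] using (hcoord.const_mul δ.d4).add_const δ.d5
  have hS : ContDiffAt ℝ ∞ (fun v : Fin 3 → ℝ => δ.den (v 1)) v := by unfold Params.den; fun_prop
  refine ⟨?_, ?_, ?_⟩
  · exact pd_eq_zero_of_const hD (c := 0)
      (fun y hy => by rw [(pd_pointMap (hDd y hy) _).1]; simp) _ v hv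
  · rw [pd_congr hD (g' := fun v => δ.disc / δ.den (v 1) ^ 2)
      (fun y hy => by rw [(pd_pointMap (hDd y hy) _).2.1]; simp) _ v hv]
    refine pd_eq_of_hasDerivAt (contDiffAt_const.div (hS.pow 2) (pow_ne_zero 2 hden)) ?_
    refine ((hasDerivAt_const (0 : ℝ) δ.disc).fun_div (hd.fun_pow 2)
      (pow_ne_zero 2 hden0)).congr_deriv ?_
    simp only [zero_smul, add_zero]
    field_simp
    push_cast
    ring
  · rw [pd_congr hD (g' := fun v => δ.d3 * b - δ.d3 / n * (δ.d4 / δ.den (v 1)))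
      (fun y hy => by rw [(pd_pointMap (hDd y hy) _).2.2]; simp) _ v hv]
    refine pd_eq_of_hasDerivAt
      (contDiffAt_const.sub (contDiffAt_const.mul (contDiffAt_const.div hS hden))) ?_
    refine (((((hasDerivAt_const (0 : ℝ) δ.d4).fun_div hd hden0).const_mul
      (δ.d3 / n)).const_sub (δ.d3 * b))).congr_deriv ?_
    simp only [zero_smul, add_zero]
    ring

/-- The transformations of the family map equations of the class to equations of the class. -/
theorem transforms_image (θ : Equation) {δ : Params} (hδ : δ.Valid) {D : Set (Fin 3 → ℝ)}
    (hD : IsOpen D) (hDI : ∀ v ∈ D, v 1 ∈ θ.I) (hDd : ∀ v ∈ D, δ.den (v 1) ≠ 0) :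
    Transforms (δ.pointMap θ.n) D θ (θ.image δ hδ) := by
  have hd1 : δ.d1 ≠ 0 := left_ne_zero_of_mul hδ.1
  have hd3 : δ.d3 ≠ 0 := right_ne_zero_of_mul hδ.1
  have hn := θ.n_ne
  refine ⟨fun v hv => (Params.contDiffAt_pointMap (hDd v hv)).contDiffWithinAt, ?_⟩
  intro v hv
  have hden := hDd v hv
  have hsm := Params.contDiffAt_pointMap (n := θ.n) hden
  have hpd := Params.pd_pointMap (n := θ.n) hden
  refine ⟨?_, ?_⟩
  · rw [det_fderiv_three (hsm.differentiableAt (by simp)), Matrix.det_fin_three]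
    simp only [Matrix.of_apply, hpd]
    simp [hd1, hd3, hδ.2, hden]
  · intro u u' hu huv hu' _ heq
    -- T depends on t alone and X on x alone, so the coordinate directions suffice: (1, 0) yields
    -- the new t-derivative, (0, 1) the new first and second x-derivatives.
    obtain ⟨-, hP, -⟩ := graph_relation hsm hu huv hu' heq 1 0 rfl rfl rfl
    obtain ⟨hval, hQ, hS⟩ := graph_relation hsm hu huv hu' heq 0 1 rfl rfl rfl
    obtain ⟨-, hf', hh'⟩ := θ.image_apply hδ (hDI v hv) hden
    have hν : graphVec (pd u (1, 0) (v 0, v 1)) (pd u (0, 1) (v 0, v 1)) 0 1 =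
        ![0, 1, pd u (0, 1) (v 0, v 1)] := by simp [graphVec]
    have hν' : graphVec (pd u (1, 0) (v 0, v 1)) (pd u (0, 1) (v 0, v 1)) 1 0 =
        ![1, 0, pd u (1, 0) (v 0, v 1)] := by simp [graphVec]
    rw [θ.holdsAt_iff hu, (θ.image δ hδ).holdsAt_iff hu', hval, huv]
    rw [hν'] at hP
    rw [hν] at hQ hS
    obtain ⟨p0, p1, p2⟩ := Params.pd_pd_pointMap (δ := δ) (n := θ.n)
      (b := pd u (0, 1) (v 0, v 1)) hD hDd hv
    rw [p0, p1, p2] at hS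
    simp only [hpd] at hP hQ hS
    have x1 : δ.pointMap θ.n v 1 = (δ.d6 * v 1 + δ.d7) / δ.den (v 1) := rfl
    have x2 : δ.pointMap θ.n v 2 = δ.d3 * v 2 - δ.d3 / θ.n * Real.log |δ.den (v 1)| := rfl
    have hw : ∀ ρ : ℝ, pd (pd u' (0, ρ)) (0, ρ) (δ.pointMap θ.n v 0, δ.pointMap θ.n v 1) =
        ρ ^ 2 * pd (pd u' (0, 1)) (0, 1) (δ.pointMap θ.n v 0, δ.pointMap θ.n v 1) := by
      intro ρ
      have e1 : ((0, ρ) : ℝ × ℝ) = ρ • (0, 1) := by simp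
      have e2 : pd u' (0, ρ) = fun z => ρ * pd u' (0, 1) z + 0 := by
        funext z; rw [e1, add_zero]; exact map_smul (fderiv ℝ u' z) ρ _
      rw [e2, pd_const_mul_add ((contDiffAt_pd hu' _).differentiableAt (by simp)), e1]
      simp only [pd, map_smul, smul_eq_mul]
      ring
    simp at hP hQ hS
    rw [hw] at hS
    rw [← x1] at hf' hh'
    rw [hf', hh']
    have hnm : (θ.image δ hδ).n = θ.n / δ.d3 ∧ (θ.image δ hδ).m = θ.m / δ.d3 := ⟨rfl, rfl⟩
    rw [hnm.1, hnm.2]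
    have hpos : 0 < |δ.den (v 1)| := abs_pos.2 hden
    have hE : Real.exp (θ.n / δ.d3 * δ.pointMap θ.n v 2) =
        Real.exp (θ.n * v 2) * |δ.den (v 1)|⁻¹ := by
      have : θ.n / δ.d3 * δ.pointMap θ.n v 2 = θ.n * v 2 - Real.log |δ.den (v 1)| := by
        rw [x2]; field_simp
      rw [this, Real.exp_sub, Real.exp_log hpos, div_eq_mul_inv]
    have hM : |δ.den (v 1)| ^ (θ.m / θ.n + 3) * Real.exp (θ.m / δ.d3 * δ.pointMap θ.n v 2) =
        |δ.den (v 1)| ^ 3 * Real.exp (θ.m * v 2) := by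
      have : θ.m / δ.d3 * δ.pointMap θ.n v 2 =
          θ.m * v 2 - Real.log |δ.den (v 1)| * (θ.m / θ.n) := by
        rw [x2]; field_simp
      rw [this, Real.exp_sub, ← Real.rpow_def_of_pos hpos, Real.rpow_add hpos,
        show (3 : ℝ) = ((3 : ℕ) : ℝ) by norm_num, Real.rpow_natCast]
      have := (Real.rpow_pos_of_pos hpos (θ.m / θ.n)).ne'
      field_simp
    generalize pd u' (1, 0) (δ.pointMap θ.n v 0, δ.pointMap θ.n v 1) = P at *
    generalize pd u' (0, 1) (δ.pointMap θ.n v 0, δ.pointMap θ.n v 1) = Q at *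
    generalize pd (pd u' (0, 1)) (0, 1) (δ.pointMap θ.n v 0, δ.pointMap θ.n v 1) = S at *
    generalize pd u (1, 0) (v 0, v 1) = a at *
    generalize pd u (0, 1) (v 0, v 1) = b at *
    generalize pd (pd u (0, 1)) (0, 1) (v 0, v 1) = q at *
    have hdisc := hδ.2
    generalize δ.disc = Δ at *
    generalize δ.den (v 1) = d at *
    have hQ' : Q = d ^ 2 / Δ * (δ.d3 * b - δ.d3 / θ.n * (δ.d4 / d)) := by
      rw [← hQ]; field_simp
    have hSQ : S + θ.n / δ.d3 * Q ^ 2 = δ.d3 * (q + θ.n * b ^ 2) * d ^ 4 / Δ ^ 2 := by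
      have hS' : S = (d ^ 2 / Δ) ^ 2 * (δ.d3 / θ.n * (δ.d4 ^ 2 / d ^ 2) + q * δ.d3 +
          Q * (2 * Δ * δ.d4 / d ^ 3)) := by
        rw [show δ.d3 / θ.n * (δ.d4 ^ 2 / d ^ 2) + q * δ.d3 + Q * (2 * Δ * δ.d4 / d ^ 3) =
          (Δ / d ^ 2) ^ 2 * S by linear_combination -hS]
        field_simp
      rw [hS', hQ']
      field_simp
      ring
    -- Both sides of the equation are multiplied by this factor under the transformation, so being
    -- nonzero it gives the equivalence of the two conditions.
    have hk : δ.d3 * |d| ^ 3 / Δ ^ 2 ≠ 0 := by positivity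
    have hd4 : d ^ 4 = |d| ^ 4 := by rw [← abs_pow, abs_of_nonneg (by positivity)]
    have hL : δ.d1 / Δ ^ 2 * |d| ^ 3 * θ.f (v 1) * P =
        δ.d3 * |d| ^ 3 / Δ ^ 2 * (θ.f (v 1) * a) := by
      linear_combination (|d| ^ 3 / Δ ^ 2 * θ.f (v 1)) * hP
    have hR : Real.exp (θ.n * v 2) * |d|⁻¹ * (S + θ.n / δ.d3 * Q ^ 2) +
        δ.d3 / Δ ^ 2 * |d| ^ (θ.m / θ.n + 3) * θ.h (v 1) *
          Real.exp (θ.m / δ.d3 * δ.pointMap θ.n v 2) =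
        δ.d3 * |d| ^ 3 / Δ ^ 2 * (Real.exp (θ.n * v 2) * (q + θ.n * b ^ 2) +
          θ.h (v 1) * Real.exp (θ.m * v 2)) := by
      have e1 : |d|⁻¹ * |d| ^ 4 = |d| ^ 3 := by field_simp
      rw [hSQ, hd4]
      linear_combination (δ.d3 / Δ ^ 2 * θ.h (v 1)) * hM +
        Real.exp (θ.n * v 2) * δ.d3 * (q + θ.n * b ^ 2) / Δ ^ 2 * e1
    rw [hE, hL, hR, mul_right_inj' hk]

theorem Equation.isOpen_domain (θ : Equation) {Ω : Set ExtSpace} (hΩ : IsOpen Ω) :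
    IsOpen (θ.domain Ω) := by
  have h1 : IsOpen {v : Fin 3 → ℝ | v 1 ∈ θ.I} := θ.isOpen_I.preimage (continuous_apply 1)
  have h2 : ContinuousOn θ.lift {v : Fin 3 → ℝ | v 1 ∈ θ.I} := by
    have c : ∀ k : Fin 3, ContinuousOn (fun v : Fin 3 → ℝ => v k) {v | v 1 ∈ θ.I} :=
      fun k => (continuous_apply k).continuousOn
    refine continuousOn_pi.2 fun i => ?_
    fin_cases i
    · exact c 0
    · exact c 1
    · exact c 2
    · exact θ.smooth_f.continuousOn.comp (c 1) fun v hv => hv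
    · exact θ.smooth_h.continuousOn.comp (c 1) fun v hv => hv
    · exact continuousOn_const
    · exact continuousOn_const
  exact h2.isOpen_inter_preimage h1 hΩ

/-- All conditions at a point involve only the germ of the transformation there, and nearby points
of the graph of a continuous function stay in the neighbourhood where the two maps agree. -/
theorem Transforms.congr {Φ Ψ : (Fin 3 → ℝ) → (Fin 3 → ℝ)} {D : Set (Fin 3 → ℝ)}
    {θ θ' : Equation} (h : Transforms Ψ D θ θ') (hD : IsOpen D) (heq : ∀ v ∈ D, Φ v = Ψ v) :
    Transforms Φ D θ θ' := by
  refine ⟨h.1.congr heq, fun v hv => ?_⟩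
  obtain ⟨hdet, hjet⟩ := h.2 v hv
  have hev : Φ =ᶠ[𝓝 v] Ψ := by filter_upwards [hD.mem_nhds hv] with y hy using heq y hy
  refine ⟨by rw [hev.fderiv_eq]; exact hdet, ?_⟩
  intro u u' hu huv hu' htr hgr
  rw [heq v hv] at hu' ⊢
  have hg2 : ContinuousAt (fun z : ℝ × ℝ => (![z.1, z.2, u z] : Fin 3 → ℝ)) (v 0, v 1) := by
    refine continuousAt_pi.2 fun i => ?_
    fin_cases i
    · exact continuousAt_fst
    · exact continuousAt_snd
    · exact hu.continuousAt
  have hvv : (![v 0, v 1, u (v 0, v 1)] : Fin 3 → ℝ) = v := by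
    ext i; fin_cases i <;> simp [huv]
  have hmem : ∀ᶠ z : ℝ × ℝ in 𝓝 (v 0, v 1), Φ ![z.1, z.2, u z] = Ψ ![z.1, z.2, u z] :=
    hg2.eventually (p := fun y => Φ y = Ψ y) (by beta_reduce; rw [hvv]; exact hev)
  refine hjet u u' hu huv hu' ?_ ?_
  · have hc : ContinuousAt (fun z : Fin 2 → ℝ => (z 0, z 1)) ![v 0, v 1] := by fun_prop
    have hmem' := hc.eventually (p := fun z : ℝ × ℝ => Φ ![z.1, z.2, u z] = Ψ ![z.1, z.2, u z])
      (by simpa using hmem)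
    have : (fun z : Fin 2 → ℝ =>
        (![Φ ![z 0, z 1, u (z 0, z 1)] 0, Φ ![z 0, z 1, u (z 0, z 1)] 1] : Fin 2 → ℝ))
        =ᶠ[𝓝 ![v 0, v 1]] fun z : Fin 2 → ℝ =>
        (![Ψ ![z 0, z 1, u (z 0, z 1)] 0, Ψ ![z 0, z 1, u (z 0, z 1)] 1] : Fin 2 → ℝ) := by
      filter_upwards [hmem'] with z hz
      rw [show Φ ![z 0, z 1, u (z 0, z 1)] = Ψ ![z 0, z 1, u (z 0, z 1)] from hz]
    rwa [this.fderiv_eq] at htr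
  · filter_upwards [hgr, hmem] with z hz hz'
    rwa [hz'] at hz

/-- The transformations of the family, with parameters depending smoothly on `(n, m)`, are
generalized equivalence transformations. -/
theorem isGeneralizedEquivalence_of_params {Ω : Set ExtSpace} (hΩ : IsOpen Ω)
    {𝒯 : ExtSpace → ExtSpace} {δ : ℝ × ℝ → Params} (hsm : SmoothParamsOn δ (paramValues Ω))
    (hw : ∀ w ∈ paramValues Ω, (δ w).Valid ∧
      fderiv ℝ (fun w' => (δ w').d3) w w ≠ (δ w).d3)
    (hδ : ∀ p ∈ Ω, p ∈ (δ (p 5, p 6)).maxDomain ∧ 𝒯 p = (δ (p 5, p 6)).toMap p) :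
    IsGeneralizedEquivalence Ω 𝒯 := by
  have hW := isOpen_paramValues hΩ
  have hmem : ∀ p ∈ Ω, (p 5, p 6) ∈ paramValues Ω := fun p hp => ⟨p, hp, rfl⟩
  obtain ⟨s1, s2, s3, s4, s5, s6, s7⟩ := hsm
  have hT : ContDiffOn ℝ ∞ 𝒯 Ω := by
    refine ContDiffOn.congr (f := fun q => (δ (q 5, q 6)).toMap q) (fun p hp => ?_)
      fun p hp => (hδ p hp).2
    have hn := hW.mem_nhds (hmem p hp)
    exact (contDiffAt_toMap (hδ p hp).1.1.2 (hw _ (hmem p hp)).1 (hδ p hp).1.2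
      (s1.contDiffAt hn) (s2.contDiffAt hn) (s3.contDiffAt hn) (s4.contDiffAt hn)
      (s5.contDiffAt hn) (s6.contDiffAt hn) (s7.contDiffAt hn)).contDiffWithinAt
  refine ⟨hT, fun p hp => ?_, fun θ => ?_⟩
  · obtain ⟨hv, hnd⟩ := hw _ (hmem p hp)
    exact det_ne_zero_of_params hΩ hT (fun q hq => (hδ q hq).2) hp hv (hδ p hp).1.2
      ((s3.contDiffAt (hW.mem_nhds (hmem p hp))).differentiableAt (by simp)) hnd
  · by_cases hθ : (θ.n, θ.m) ∈ paramValues Ω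
    · have hv := (hw _ hθ).1
      have hD := θ.isOpen_domain hΩ
      have hDd : ∀ v ∈ θ.domain Ω, (δ (θ.n, θ.m)).den (v 1) ≠ 0 := fun v hv => (hδ _ hv.2).1.2
      have hval : ∀ v ∈ θ.domain Ω, 𝒯 (θ.lift v) = (δ (θ.n, θ.m)).toMap (θ.lift v) :=
        fun v hv => (hδ _ hv.2).2
      refine ⟨θ.image (δ (θ.n, θ.m)) hv, fun v hvD => ?_, ?_⟩
      · obtain ⟨i1, i2, i3⟩ := θ.image_apply hv hvD.1 (hDd v hvD)
        rw [hval v hvD]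
        exact ⟨i1, i2.symm, i3.symm, rfl, rfl⟩
      · refine (transforms_image θ hv hD (fun v hv => hv.1) hDd).congr hD fun v hvD => ?_
        simp only [Equation.restrict]
        rw [hval v hvD]
        rfl
    -- If (n, m) does not occur in Ω, there are no points over which to check anything, and θ itself
    -- serves as the image equation.
    · have hempty : ∀ v, v ∉ θ.domain Ω := fun v hv => hθ (hmem _ hv.2)
      exact ⟨θ, fun v hv => absurd hv (hempty v),
        fun v hv => absurd hv (hempty v), fun v hv => absurd hv (hempty v)⟩

theorem isOpen_maxDomain (δ : Params) : IsOpen δ.maxDomain := by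
  have h1 : IsOpen {p : ExtSpace | p 3 ≠ 0} :=
    isOpen_ne_fun (continuous_apply 3) continuous_const
  have h2 : IsOpen {p : ExtSpace | p 5 ≠ 0} :=
    isOpen_ne_fun (continuous_apply 5) continuous_const
  have h3 : IsOpen {p : ExtSpace | δ.den (p 1) ≠ 0} :=
    isOpen_ne_fun (by unfold Params.den; fun_prop) continuous_const
  exact (h1.inter h2).inter h3

theorem isGeneralizedEquivalence_toMap {δ : Params} (hδ : δ.Valid) :
    IsGeneralizedEquivalence δ.maxDomain δ.toMap := by
  refine isGeneralizedEquivalence_of_params (isOpen_maxDomain δ) (δ := fun _ => δ) ?_ ?_ ?_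
  · exact ⟨contDiffOn_const, contDiffOn_const, contDiffOn_const, contDiffOn_const,
      contDiffOn_const, contDiffOn_const, contDiffOn_const⟩
  · intro w _
    refine ⟨hδ, ?_⟩
    -- For constant δ₃ the nondegeneracy condition reads 0 ≠ δ₃.
    simpa using (right_ne_zero_of_mul hδ.1).symm
  · exact fun p hp => ⟨hp, rfl⟩

end RDExp

theorem theorem3 :
    -- every transformation of the family, with constant parameters, is a generalized equivalence
    -- transformation of the class on its whole natural domain
    (∀ δ : RDExp.Params, δ.Valid →
      RDExp.IsGeneralizedEquivalence δ.maxDomain δ.toMap) ∧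
    -- the transformations of the family form a group: unit, composition, inverse
    (∃ δ : RDExp.Params, δ.Valid ∧ ∀ p ∈ RDExp.classSpace, p ∈ δ.maxDomain ∧ δ.toMap p = p) ∧
    (∀ δ δ' : RDExp.Params, δ.Valid → δ'.Valid →
      ∃ δ'' : RDExp.Params, δ''.Valid ∧
        ∀ p ∈ δ.maxDomain, δ.toMap p ∈ δ'.maxDomain →
          p ∈ δ''.maxDomain ∧ δ'.toMap (δ.toMap p) = δ''.toMap p) ∧
    (∀ δ : RDExp.Params, δ.Valid →
      ∃ δ' : RDExp.Params, δ'.Valid ∧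
        ∀ p ∈ δ.maxDomain, δ.toMap p ∈ δ'.maxDomain ∧ δ'.toMap (δ.toMap p) = p) ∧
    -- the parameters are determined by the transformation, up to a common sign of `δ₄, …, δ₇`
    (∀ δ δ' : RDExp.Params, δ.Valid → δ'.Valid →
      ∀ Ω : Set RDExp.ExtSpace, IsOpen Ω → Ω.Nonempty → Ω ⊆ δ.maxDomain → Ω ⊆ δ'.maxDomain →
        (Set.EqOn δ.toMap δ'.toMap Ω ↔
          δ.d1 = δ'.d1 ∧ δ.d2 = δ'.d2 ∧ δ.d3 = δ'.d3 ∧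
          ∃ ε : ℝ, (ε = 1 ∨ ε = -1) ∧
            δ.d4 = ε * δ'.d4 ∧ δ.d5 = ε * δ'.d5 ∧ δ.d6 = ε * δ'.d6 ∧ δ.d7 = ε * δ'.d7)) ∧
    -- the generalized equivalence transformations are exactly those of the family; the parameters
    -- do not depend on `t, x, u, f, h`, but may vary with the constants `n, m`
    (∀ (Ω : Set RDExp.ExtSpace) (𝒯 : RDExp.ExtSpace → RDExp.ExtSpace),
      IsOpen Ω → Ω ⊆ RDExp.classSpace →
      (∀ n m : ℝ, IsPreconnected {p : RDExp.ExtSpace | p ∈ Ω ∧ p 5 = n ∧ p 6 = m}) →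
      (RDExp.IsGeneralizedEquivalence Ω 𝒯 ↔
        ∃ δ : ℝ × ℝ → RDExp.Params,
          RDExp.SmoothParamsOn δ (RDExp.paramValues Ω) ∧
          (∀ w ∈ RDExp.paramValues Ω,
            (δ w).Valid ∧
            -- nondegeneracy of `(n, m) ↦ (n / δ₃, m / δ₃)`: `n ∂δ₃/∂n + m ∂δ₃/∂m ≠ δ₃`
            fderiv ℝ (fun w' => (δ w').d3) w w ≠ (δ w).d3) ∧
          ∀ p ∈ Ω, p ∈ (δ (p 5, p 6)).maxDomain ∧ 𝒯 p = (δ (p 5, p 6)).toMap p)) := by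
  refine ⟨fun δ hδ => RDExp.isGeneralizedEquivalence_toMap hδ, ?_, ?_, ?_, ?_, ?_⟩
  · exact ⟨RDExp.Params.one, RDExp.Params.one_valid,
      fun p hp => ⟨RDExp.Params.mem_maxDomain_one hp, RDExp.Params.toMap_one p⟩⟩
  · intro δ δ' hδ hδ'
    refine ⟨RDExp.Params.comp δ' δ, RDExp.Params.comp_valid hδ' hδ, fun p hp hp' => ?_⟩
    obtain ⟨h1, h2⟩ := RDExp.Params.toMap_comp hδ hp hp'.2
    exact ⟨⟨hp.1, h1⟩, h2⟩
  · intro δ hδ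
    exact ⟨δ.inv, RDExp.Params.inv_valid hδ, fun p hp => RDExp.Params.toMap_inv hδ hp⟩
  · intro δ δ' hδ hδ' Ω hΩ hne hsub hsub'
    constructor
    · exact RDExp.sign_of_eqOn hδ hδ' hΩ hne hsub hsub'
    · rintro ⟨h1, h2, h3, ε, hε, h4, h5, h6, h7⟩ p _
      rw [RDExp.toMap_eq_of_sign hε h1 h2 h3 h4 h5 h6 h7]
  · intro Ω 𝒯 hΩ hsub hconn
    constructor
    · intro h
      exact h.exists_params hΩ hsub hconn
    · rintro ⟨δ, hsm, hw, hδ⟩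
      exact RDExp.isGeneralizedEquivalence_of_params hΩ hsm hw hδ
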